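/- **Theorem (least squares estimation error).** There are universal constants $c, C > 0$ such that the following holds. *System.* Let $A^\star \in \mathbb{R}^{d_x\times d_x}$, $B^\star\in\mathbb{R}^{d_x\times d_u}$ with $\mathrm{vec}\,[A^\star\ B^\star] = \Phi^\star\theta^\star$, where $\mathrm{vec}$ stacks columns, $\Phi^\star \in \mathbb{R}^{d_x(d_x+d_u)\times d_\theta}$ and $\theta^\star\in\mathbb{R}^{d_\theta}$. Let $K \in \mathbb{R}^{d_u\times d_x}$ be such that $A_K = A^\star+B^\star K$ has spectral radius less than $1$, let $\sigma_u^2\le 1$, let $Q\succeq I$ be symmetric, and put $P_K=\sum_{j\ge 0}(A_K^\top)^j(Q+K^\top K)A_K^j$ (the solution of $P = A_K^\top P A_K + Q + K^\top K$) and $\Psi_{B^\star}=\max\{1,\|B^\star\|\}$. Matrix norms are spectral norms and vector norms are Euclidean. *Data.* Let $x_{s+1} = A^\star x_s + B^\star u_s + w_s$, $u_s = Kx_s+\sigma_u g_s$ for $s \ge 1$, where $x_1$ is a random vector independent of the noise $(w_s,g_s)_{s\ge 1}$, all coordinates of all the $w_s$ and $g_s$ are mutually independent, the coordinates of $g_s$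 are standard normal, $\mathbb{E}[w_sw_s^\top]=I$, and each coordinate $w_{s,i}$ is $\sigma^2$-sub-Gaussian, that is, $\mathbb{E}\,e^{\lambda w_{s,i}}\le e^{\sigma^2\lambda^2/2}$ for all $\lambda\in\mathbb{R}$. *Estimate.* Let $\hat\Phi\in\mathbb{R}^{d_x(d_x+d_u)\times d_\theta}$ be a fixed matrix with orthonormal columns, let $z_s=\begin{bmatrix}x_s\\u_s\end{bmatrix}$, and let $$\hat\theta=\Lambda^\dagger\sum_{s=1}^t\hat\Phi^\top(z_s\otimes I_{d_x})x_{s+1},\qquad \Lambda=\sum_{s=1}^t\hat\Phi^\top(z_sz_s^\top\otimes I_{d_x})\hat\Phi .$$ Let $d(\hat\Phi,\Phi^\star)=\|\hat\Phi_\perp^\top\Phi^\star\| = \|(I-\hat\Phi\hat\Phi^\top)\Phi^\star\|$, where $\hat\Phi_\perp$ completes $\hat\Phi$ to an orthogonal matrix $[\hat\Phi\ \hat\Phi_\perp]$. *Claim.* For $\delta\in(0,1/2)$ and $\bar x \ge 0$ put $$\tau_{\rm ls}(K,\bar x,\delta)=\max\Big\{\sigma^4\|P_K\|^3\Psi_{B^\star}^2\big(d_x+d_u+\log\tfrac1\delta\big),\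 \bar x\,\|P_K\|+1\Big\},$$ $$\bar\Delta^t=\hat\Phi^\top\left(\left(\frac1t\sum_{s=0}^{t-2}\sum_{j=0}^{s}\begin{bmatrix}I\\K\end{bmatrix}A_K^j(\sigma_u^2B^\star B^{\star\top}+I)(A_K^j)^\top\begin{bmatrix}I\\K\end{bmatrix}^\top+\begin{bmatrix}0&0\\0&\sigma_u^2I_{d_u}\end{bmatrix}\right)\otimes I_{d_x}\right)\hat\Phi ,$$ and suppose $\lambda_{\min}(\bar\Delta^t)>0$ (otherwise the bound below is to be read as $+\infty$). Then there is an event $\mathcal{E}$ of probability at least $1-\delta$ such that, at every outcome in $\mathcal{E}$ at which $t\ge c\,\tau_{\rm ls}(K,\|x_1\|^2,\delta)$, $$\|\hat\Phi\hat\theta-\Phi^\star\theta^\star\|^2\le C\left[\frac{d_\theta\sigma^2}{t\,\lambda_{\min}(\bar\Delta^t)}\log\frac1\delta+\left(1+\frac{\sigma^4\|P_K\|^7\Psi_{B^\star}^6\big(d_x+d_u+\log\frac1\delta\big)}{t\,\lambda_{\min}(\bar\Delta^t)^2}\right)\frac{\|P_K\|^2\Psi_{B^\star}^2\,d(\hat\Phi,\Phi^\star)^2\,\|\theta^\star\|^2}{\lambda_{\min}(\bar\Delta^t)}\right].$$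 -/

import Mathlib

open Matrix MeasureTheory ProbabilityTheory
open scoped NNReal Kronecker

noncomputable section

namespace LSEst

/-- Euclidean norm of a real vector. -/
def vnorm {ι : Type*} [Fintype ι] (v : ι → ℝ) : ℝ :=
  ‖(WithLp.toLp 2 v : EuclideanSpace ℝ ι)‖

open scoped Matrix.Norms.L2Operator in
/-- Spectral norm of a real matrix (operator norm for the Euclidean norms). -/
def opNorm {m n : Type*} [Fintype m] [Fintype n] [DecidableEq n] (M : Matrix m n ℝ) : ℝ :=
  ‖M‖

/-- Smallest eigenvalue of a (nonempty) real symmetric matrix. -/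
def lambdaMin {n : Type*} [Fintype n] [DecidableEq n] (S : Matrix n n ℝ) : ℝ :=
  sInf (spectrum ℝ S)

/-- All complex eigenvalues of the real matrix lie in the open unit disc. -/
def IsStable {n : Type*} [Fintype n] [DecidableEq n] (M : Matrix n n ℝ) : Prop :=
  ∀ z ∈ spectrum ℂ (M.map (fun r : ℝ => (r : ℂ))), ‖z‖ < 1

/-- For stable `M`, the solution `P = ∑_{j ≥ 0} (Mᵀ)^j S M^j` of the discrete Lyapunov equation
`P = Mᵀ P M + S`. -/
def dlyap {n : Type*} [Fintype n] [DecidableEq n] (M S : Matrix n n ℝ) : Matrix n n ℝ :=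
  ∑' j : ℕ, Mᵀ ^ j * S * M ^ j

/-- Moore-Penrose pseudoinverse of a real symmetric matrix: the functional calculus of
`r ↦ r⁻¹` (where `0⁻¹ = 0`). -/
def symPinv {n : Type*} [Fintype n] [DecidableEq n] (S : Matrix n n ℝ) : Matrix n n ℝ :=
  cfc (fun r : ℝ => r⁻¹) S

/-- `M M† M = M` and `M† M M† = M†`, and `M M† = M† M` is symmetric. -/
theorem symPinv_spec {n : Type*} [Fintype n] [DecidableEq n] (S : Matrix n n ℝ)
    (hS : S.IsHermitian) :
    S * symPinv S * S = S ∧ symPinv S * S * symPinv S = symPinv S ∧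
      (S * symPinv S)ᵀ = S * symPinv S ∧ (symPinv S * S)ᵀ = symPinv S * S := by
  have hsa : IsSelfAdjoint S := hS
  have hc : ∀ f : ℝ → ℝ, ContinuousOn f (spectrum ℝ S) :=
    fun f => (Matrix.finite_real_spectrum (A := S)).continuousOn f
  have hid : cfc (fun r : ℝ => r) S = S := cfc_id' ℝ S
  have h1 : S * symPinv S = cfc (fun r : ℝ => r * r⁻¹) S := by
    rw [cfc_mul _ _ S (hc _) (hc _), hid, symPinv]
  have h2 : symPinv S * S = cfc (fun r : ℝ => r * r⁻¹) S := by
    have : (fun r : ℝ => r * r⁻¹) = fun r : ℝ => r⁻¹ * r := by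
      funext r; ring
    rw [this, cfc_mul _ _ S (hc _) (hc _), hid, symPinv]
  have h3 : (cfc (fun r : ℝ => r * r⁻¹) S)ᵀ = cfc (fun r : ℝ => r * r⁻¹) S := by
    have h : IsSelfAdjoint (cfc (fun r : ℝ => r * r⁻¹) S) := cfc_predicate _ S
    have h' := h.star_eq
    rwa [Matrix.star_eq_conjTranspose, Matrix.conjTranspose_eq_transpose_of_trivial] at h'
  refine ⟨?_, ?_, by rw [h1, h3], by rw [h2, h3]⟩
  · rw [h1]
    calc cfc (fun r : ℝ => r * r⁻¹) S * S
        = cfc (fun r : ℝ => r * r⁻¹) S * cfc (fun r : ℝ => r) S := by rw [hid]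
      _ = cfc (fun r : ℝ => r * r⁻¹ * r) S := (cfc_mul _ _ S (hc _) (hc _)).symm
      _ = cfc (fun r : ℝ => r) S := by simp only [mul_inv_mul_cancel]
      _ = S := hid
  · rw [h2]
    calc cfc (fun r : ℝ => r * r⁻¹) S * symPinv S
        = cfc (fun r : ℝ => r * r⁻¹ * r⁻¹) S := (cfc_mul _ _ S (hc _) (hc _)).symm
      _ = symPinv S := by
        unfold symPinv
        congr 1
        funext r
        by_cases hr : r = 0
        · simp [hr]
        · rw [mul_inv_cancel₀ hr, one_mul]

/-- Subspace distance: the spectral norm of `(I - Φ̂ Φ̂ᵀ) Φ`. -/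
def subspaceDist {N p q : Type*} [Fintype N] [DecidableEq N] [Fintype p] [Fintype q]
    [DecidableEq q] (Φhat : Matrix N p ℝ) (Φ : Matrix N q ℝ) : ℝ :=
  opNorm ((1 - Φhat * Φhatᵀ) * Φ)

open scoped Matrix.Norms.L2Operator in
/-- If `Φperp` completes `Φhat` to an orthogonal matrix, the distance is `‖Φperpᵀ Φ‖`. -/
theorem subspaceDist_eq {N p q r : Type*} [Fintype N] [DecidableEq N] [Fintype p] [Fintype q]
    [DecidableEq q] [Fintype r] [DecidableEq r] [DecidableEq p]
    (Φhat : Matrix N p ℝ) (Φ : Matrix N q ℝ) (Φperp : Matrix N r ℝ)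
    (h1 : (fromCols Φhat Φperp)ᵀ * fromCols Φhat Φperp = 1)
    (h2 : fromCols Φhat Φperp * (fromCols Φhat Φperp)ᵀ = 1) :
    subspaceDist Φhat Φ = opNorm (Φperpᵀ * Φ) := by
  have hp : Φperpᵀ * Φperp = 1 := by
    have h := congrArg Matrix.toBlocks₂₂ h1
    rw [Matrix.transpose_fromCols, Matrix.fromRows_mul_fromCols] at h
    rw [Matrix.toBlocks_fromBlocks₂₂, ← Matrix.fromBlocks_one, Matrix.toBlocks_fromBlocks₂₂] at h
    exact h
  have hs : 1 - Φhat * Φhatᵀ = Φperp * Φperpᵀ := by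
    rw [Matrix.transpose_fromCols, Matrix.fromCols_mul_fromRows] at h2
    rw [← h2, add_sub_cancel_left]
  have key : ((1 - Φhat * Φhatᵀ) * Φ)ᴴ * ((1 - Φhat * Φhatᵀ) * Φ)
      = (Φperpᵀ * Φ)ᴴ * (Φperpᵀ * Φ) := by
    rw [hs]
    simp only [Matrix.conjTranspose_eq_transpose_of_trivial, Matrix.transpose_mul,
      Matrix.transpose_transpose, Matrix.mul_assoc]
    rw [← Matrix.mul_assoc Φperpᵀ Φperp, hp, Matrix.one_mul]
  have e : opNorm ((1 - Φhat * Φhatᵀ) * Φ) * opNorm ((1 - Φhat * Φhatᵀ) * Φ)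
      = opNorm (Φperpᵀ * Φ) * opNorm (Φperpᵀ * Φ) := by
    unfold opNorm
    rw [← Matrix.l2_opNorm_conjTranspose_mul_self, ← Matrix.l2_opNorm_conjTranspose_mul_self, key]
  have nn : ∀ X : Matrix N q ℝ, 0 ≤ opNorm X := fun X => by unfold opNorm; exact norm_nonneg X
  have nn' : 0 ≤ opNorm (Φperpᵀ * Φ) := by unfold opNorm; exact norm_nonneg _
  exact (mul_self_inj (nn _) nn').mp e

attribute [local instance] Matrix.linftyOpNormedRing Matrix.linftyOpNormedAlgebra in
theorem IsStable.exists_bound {n : Type*} [Fintype n] [DecidableEq n] {M : Matrix n n ℝ}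
    (hM : IsStable M) :
    ∃ C r : ℝ, 0 ≤ C ∧ 0 ≤ r ∧ r < 1 ∧ ∀ (k : ℕ) (a b : n), |(M ^ k) a b| ≤ C * r ^ k := by
  rcases isEmpty_or_nonempty n with hn | hn
  · exact ⟨0, 0, le_rfl, le_rfl, one_pos, fun k a => (hn.false a).elim⟩
  set Z : Matrix n n ℂ := M.map (fun r : ℝ => (r : ℂ)) with hZ
  have hpow : ∀ k : ℕ, Z ^ k = (M ^ k).map (fun r : ℝ => (r : ℂ)) := fun k =>
    (map_pow (Complex.ofRealHom.mapMatrix : Matrix n n ℝ →+* Matrix n n ℂ) M k).symm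
  have hρ : spectralRadius ℂ Z < ((1 : ℝ≥0) : ENNReal) :=
    spectrum.spectralRadius_lt_of_forall_lt Z fun z hz => by
      have := hM z hz
      exact_mod_cast this
  obtain ⟨r, hr1, hr2⟩ := ENNReal.lt_iff_exists_nnreal_btwn.mp hρ
  have hr0 : 0 < r := by
    have h0 : (0 : ENNReal) < r := lt_of_le_of_lt bot_le hr1
    exact_mod_cast h0
  have hG := (spectrum.pow_nnnorm_pow_one_div_tendsto_nhds_spectralRadius Z).eventually
    (gt_mem_nhds hr1)
  have hO : (fun k : ℕ => Z ^ k) =O[Filter.atTop] (fun k : ℕ => (r : ℝ) ^ k) := by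
    refine Asymptotics.IsBigO.of_bound 1 ?_
    filter_upwards [hG, Filter.eventually_gt_atTop 0] with k hk hk0
    have h1 : (‖Z ^ k‖₊ : ENNReal) ≤ (r : ENNReal) ^ k := by
      have h2 := ENNReal.rpow_le_rpow hk.le (Nat.cast_nonneg (α := ℝ) k)
      rwa [← ENNReal.rpow_mul, one_div, inv_mul_cancel₀ (by positivity), ENNReal.rpow_one,
        ENNReal.rpow_natCast] at h2
    have h3 : ‖Z ^ k‖₊ ≤ r ^ k := by exact_mod_cast h1
    have h4 : ‖Z ^ k‖ ≤ (r : ℝ) ^ k := by exact_mod_cast h3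
    simpa [abs_of_nonneg] using h4
  obtain ⟨C, hC⟩ := (Asymptotics.isBigO_nat_atTop_iff (fun k hk =>
    absurd hk (pow_pos (NNReal.coe_pos.mpr hr0) k).ne')).mp hO
  have hle : ∀ k : ℕ, ‖Z ^ k‖ ≤ C * (r : ℝ) ^ k := fun k => by
    simpa [abs_of_nonneg] using hC k
  refine ⟨C, r, ?_, r.2, by exact_mod_cast hr2, fun k a b => ?_⟩
  · have := (norm_nonneg _).trans (hle 0)
    simpa using this
  · refine le_trans ?_ (hle k)
    have h5 : |(M ^ k) a b| = ‖(Z ^ k) a b‖ := by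
      rw [hpow, Matrix.map_apply, Complex.norm_real, Real.norm_eq_abs]
    have h6 : ‖(Z ^ k) a b‖₊ ≤ ‖Z ^ k‖₊ := by
      rw [Matrix.linfty_opNNNorm_def]
      exact (Finset.single_le_sum (f := fun j => ‖(Z ^ k) a j‖₊)
        (fun _ _ => bot_le) (Finset.mem_univ b)).trans
        (Finset.le_sup (f := fun i => ∑ j, ‖(Z ^ k) i j‖₊) (Finset.mem_univ a))
    rw [h5]
    exact_mod_cast h6

/-- The series `dlyap M S` solves the discrete Lyapunov equation when `M` is stable. -/
theorem dlyap_eq {n : Type*} [Fintype n] [DecidableEq n] (M S : Matrix n n ℝ)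
    (hM : IsStable M) : dlyap M S = Mᵀ * dlyap M S * M + S := by
  obtain ⟨C, r, hC, hr0, hr1, hb⟩ := hM.exists_bound
  have hsum : Summable (fun j : ℕ => Mᵀ ^ j * S * M ^ j) := by
    refine Pi.summable.mpr fun a => Pi.summable.mpr fun b => ?_
    have hg : Summable (fun j : ℕ => (∑ c, ∑ d, C * |S d c| * C) * (r * r) ^ j) :=
      (summable_geometric_of_lt_one (mul_nonneg hr0 hr0)
        (by nlinarith)).mul_left _
    refine Summable.of_norm_bounded hg fun j => ?_
    rw [Matrix.mul_apply, Finset.sum_mul]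
    refine (norm_sum_le _ _).trans (Finset.sum_le_sum fun c _ => ?_)
    rw [Matrix.mul_apply, Finset.sum_mul, Finset.sum_mul]
    refine (norm_sum_le _ _).trans (Finset.sum_le_sum fun d _ => ?_)
    rw [← Matrix.transpose_pow, Matrix.transpose_apply, Real.norm_eq_abs, abs_mul, abs_mul]
    calc |(M ^ j) d a| * |S d c| * |(M ^ j) c b|
        ≤ (C * r ^ j) * |S d c| * (C * r ^ j) := by
          gcongr
          · exact hb j d a
          · exact hb j c b
      _ = C * |S d c| * C * (r * r) ^ j := by rw [mul_pow]; ring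
  unfold dlyap
  have hT : ∀ j : ℕ, Mᵀ ^ (j + 1) * S * M ^ (j + 1) = Mᵀ * (Mᵀ ^ j * S * M ^ j) * M := fun j => by
    rw [pow_succ' Mᵀ, pow_succ M]
    simp only [Matrix.mul_assoc]
  conv_lhs => rw [hsum.tsum_eq_zero_add]
  simp only [hT]
  rw [(hsum.mul_left Mᵀ).tsum_mul_right, hsum.tsum_mul_left]
  simp [add_comm]

/-- `Ψ_B = max {1, ‖B‖}`. -/
def Psi {n m : ℕ} (B : Matrix (Fin n) (Fin m) ℝ) : ℝ := max 1 (opNorm B)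

/-- `P_K`, the solution of the Lyapunov equation for the closed loop `A + B K` with stage cost
`xᵀ Q x + uᵀ u`, that is, with `S = Q + Kᵀ K`. -/
def lyapP {n m : ℕ} (A : Matrix (Fin n) (Fin n) ℝ) (B : Matrix (Fin n) (Fin m) ℝ)
    (Q : Matrix (Fin n) (Fin n) ℝ) (K : Matrix (Fin m) (Fin n) ℝ) : Matrix (Fin n) (Fin n) ℝ :=
  dlyap (A + B * K) (Q + Kᵀ * K)

/-- The burn-in time `max {σ⁴ ‖P‖³ Ψ² (n + m + log (1/δ)), xbar ‖P‖ + 1}`. -/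
def tauLS (n m : ℕ) (σ normP Ψ xbar δ : ℝ) : ℝ :=
  max (σ ^ 4 * normP ^ 3 * Ψ ^ 2 * ((n : ℝ) + (m : ℝ) + Real.log (1 / δ))) (xbar * normP + 1)

/-- The matrix `t⁻¹ ∑_{s=0}^{t-2} ∑_{j=0}^{s} [I; K] A_K^j (σu² B Bᵀ + I) (A_K^j)ᵀ [I; K]ᵀ
+ diag (0, σu² I)` with `A_K = A + B K`. -/
def avgCov {n m : ℕ} (A : Matrix (Fin n) (Fin n) ℝ) (B : Matrix (Fin n) (Fin m) ℝ)
    (K : Matrix (Fin m) (Fin n) ℝ) (σu : ℝ) (t : ℕ) :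
    Matrix (Fin n ⊕ Fin m) (Fin n ⊕ Fin m) ℝ :=
  (t : ℝ)⁻¹ • (∑ s ∈ Finset.range (t - 1), ∑ j ∈ Finset.range (s + 1),
      fromRows (1 : Matrix (Fin n) (Fin n) ℝ) K * (A + B * K) ^ j *
        (σu ^ 2 • (B * Bᵀ) + (1 : Matrix (Fin n) (Fin n) ℝ)) *
        ((A + B * K) ^ j)ᵀ * (fromRows (1 : Matrix (Fin n) (Fin n) ℝ) K)ᵀ)
    + fromBlocks 0 0 0 (σu ^ 2 • (1 : Matrix (Fin m) (Fin m) ℝ))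

/-- The projected excitation matrix `Φᵀ (avgCov ⊗ I) Φ`. -/
def Delta {n m d : ℕ} (A : Matrix (Fin n) (Fin n) ℝ) (B : Matrix (Fin n) (Fin m) ℝ)
    (K : Matrix (Fin m) (Fin n) ℝ) (σu : ℝ) (t : ℕ)
    (Φ : Matrix ((Fin n ⊕ Fin m) × Fin n) (Fin d) ℝ) : Matrix (Fin d) (Fin d) ℝ :=
  Φᵀ * (avgCov A B K σu t ⊗ₖ (1 : Matrix (Fin n) (Fin n) ℝ)) * Φ

/-- The matrix `z ⊗ I_n` for a column vector `z`. -/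
def kronId {ι : Type*} (n : ℕ) (z : ι → ℝ) : Matrix (ι × Fin n) (Fin n) ℝ :=
  Matrix.of fun p r => z p.1 * (1 : Matrix (Fin n) (Fin n) ℝ) p.2 r

/-- `Λ = ∑_s Φᵀ ([x_s; u_s] [x_s; u_s]ᵀ ⊗ I) Φ`, over the first `t` samples. -/
def lsGram {n m d : ℕ} (Φ : Matrix ((Fin n ⊕ Fin m) × Fin n) (Fin d) ℝ) (t : ℕ)
    (x : ℕ → Fin n → ℝ) (u : ℕ → Fin m → ℝ) : Matrix (Fin d) (Fin d) ℝ :=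
  ∑ s ∈ Finset.range t,
    Φᵀ * (vecMulVec (Sum.elim (x s) (u s)) (Sum.elim (x s) (u s)) ⊗ₖ
      (1 : Matrix (Fin n) (Fin n) ℝ)) * Φ

/-- The least squares estimate `Λ† ∑_s Φᵀ ([x_s; u_s] ⊗ I) x_{s+1}`, over the first `t`
samples. -/
def lsEstimate {n m d : ℕ} (Φ : Matrix ((Fin n ⊕ Fin m) × Fin n) (Fin d) ℝ) (t : ℕ)
    (x : ℕ → Fin n → ℝ) (u : ℕ → Fin m → ℝ) : Fin d → ℝ :=
  symPinv (lsGram Φ t x u) *ᵥ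
    ∑ s ∈ Finset.range t, Φᵀ *ᵥ (kronId n (Sum.elim (x s) (u s)) *ᵥ x (s + 1))

/-- The random data. Time is counted from `0`: `x s`, `u s`, `w s`, `g s` are the state, input,
process noise and exploration noise at time `s + 1`, so that `x 0` is the initial state. The
initial state is random and independent of the noise; all noise coordinates are independent, the
process noise has identity covariance and `σ²`-sub-Gaussian mean-zero coordinates (zero mean
follows from the moment generating function bound), the exploration noise is standard normal. -/
structure IsRollout {Ω : Type*} [MeasurableSpace Ω] (μ : Measure Ω) {n m : ℕ}
    (A : Matrix (Fin n) (Fin n) ℝ) (B : Matrix (Fin n) (Fin m) ℝ)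
    (K : Matrix (Fin m) (Fin n) ℝ) (σu : ℝ) (σ : ℝ≥0)
    (x : ℕ → Ω → Fin n → ℝ) (u : ℕ → Ω → Fin m → ℝ)
    (w : ℕ → Ω → Fin n → ℝ) (g : ℕ → Ω → Fin m → ℝ) : Prop where
  state_eq : ∀ s ω, x (s + 1) ω = A *ᵥ x s ω + B *ᵥ u s ω + w s ω
  input_eq : ∀ s ω, u s ω = K *ᵥ x s ω + σu • g s ω
  measurable_init : Measurable (x 0)
  measurable_w : ∀ s, Measurable (w s)
  measurable_g : ∀ s, Measurable (g s)
  subgaussian_w : ∀ s i, HasSubgaussianMGF (fun ω => w s ω i) (σ ^ 2) μ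
  cov_w : ∀ s i j, ∫ ω, w s ω i * w s ω j ∂μ = if i = j then 1 else 0
  gaussian_g : ∀ s j, μ.map (fun ω => g s ω j) = gaussianReal 0 1
  indep_noise : iIndepFun
    (fun (p : ℕ × (Fin n ⊕ Fin m)) (ω : Ω) => Sum.elim (w p.1 ω) (g p.1 ω) p.2) μ
  indep_init : IndepFun (x 0)
    (fun (ω : Ω) (p : ℕ × (Fin n ⊕ Fin m)) => Sum.elim (w p.1 ω) (g p.1 ω) p.2) μ

end LSEst

end

/-! Let q = Φ*θ*, let v = (I - Φ̂Φ̂ᵀ)q be the part of q missed by the model class, and e = θ̂ -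
Φ̂ᵀq. The error is Φ̂e - v, and once Λ is invertible the normal equations read Λe = ∑ Φ̂ᵀ(z_s ⊗
I)((z_s ⊗ I)ᵀv + w_s). Pairing with e and applying Young's inequality to both terms on the right
absorbs half of eᵀΛe (`lsEstimate_error_le`). Three inputs remain: Λ ≥ (t/8)Δ̄, an upper bound
t·12‖P‖²Ψ² on the full Gram matrix, and control of the noise term in the norm of Δ̄.

Covariance. The state is the free response to the initial state plus a part linear in the noise. In
a fixed direction the energy of the noise-driven part is ‖Mη‖² with M = `respMat`, and its mean is
the trace of MᵀM (`respMat_trace`). Hanson-Wright (`measure_hansonWright_le`) gives concentration at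
a rate governed by ‖M‖². The Lyapunov equation makes the closed loop contract at rate 1 - 1/‖P‖
(`pow_mulVec_decay`), so Young's convolution inequality gives ‖M‖² ≲ ‖P‖³Ψ² (`respMat_bound`); this
is the source of the burn-in time. A net in the norm of the mean covariance makes the estimate
uniform in the direction (`IsRollout.measure_cov_deviation_le`).

Initial state. The free response has total energy at most ‖P‖ times the squared norm of the initial
state, a small fraction of the excitation after burn-in. This step is deterministic
(`IsRollout.excitation_bounds`), so the good event does not involve the burn-in condition, which can
then be tested outcome by outcome.

Noise term. Given the past and the current input, w_s is a fresh sub-Gaussian vector, which yields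
an exponential supermartingale (`lintegral_exp_martingale_le`). Where the quadratic variation is at
most 4t, a Chernoff bound and a net in the norm of Δ̄ control all directions
(`IsRollout.exists_noise_bound`).

The bound is obtained with the factor (1 + ...) replaced by 1; the additional summand is nonnegative
and only weakens it. -/

noncomputable section

namespace LSEst

/-! ### Exponential moments of linear and quadratic forms. -/

section Chaos

variable {Ω : Type*} [MeasurableSpace Ω] {μ : Measure Ω} [IsProbabilityMeasure μ]
variable {ι : Type*} [Fintype ι]

-- Exponential moments are kept as lower integrals of `ENNReal.ofReal`, so Fubini and monotonicity
-- apply later without integrability conditions.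
omit [IsProbabilityMeasure μ] in
theorem lintegral_exp_sum_le {η : ι → Ω → ℝ} {k : ℝ≥0} (hind : iIndepFun η μ)
    (hsub : ∀ i, HasSubgaussianMGF (η i) k μ) (c : ι → ℝ) :
    ∫⁻ ω, ENNReal.ofReal (Real.exp (∑ i, c i * η i ω)) ∂μ
      ≤ ENNReal.ofReal (Real.exp (k / 2 * ∑ i, c i ^ 2)) := by
  have h : HasSubgaussianMGF (fun ω => ∑ i, c i * η i ω) (∑ i, NNReal.mk (c i ^ 2) (sq_nonneg _) * k) μ :=
    HasSubgaussianMGF.sum_of_iIndepFun (X := fun i ω => c i * η i ω)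
      (hind.comp (fun i y => c i * y) (fun i => measurable_const_mul _))
      (fun i _ => (hsub i).const_mul (c i))
  have h1 := h.integrable_exp_mul 1
  have h2 := h.mgf_le 1
  simp only [one_mul, mgf] at h1 h2
  rw [← ofReal_integral_eq_lintegral_ofReal h1 (Filter.Eventually.of_forall fun _ =>
    (Real.exp_pos _).le)]
  refine ENNReal.ofReal_le_ofReal (h2.trans_eq ?_)
  congr 1
  push_cast
  simp only [← Finset.sum_mul]
  ring

/-- Integrating out a sub-Gaussian vector `W` that is independent of `U`. -/
theorem lintegral_mul_exp_le {α : Type*} [MeasurableSpace α] {U : Ω → α} {W : Ω → ι → ℝ}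
    {k : ℝ≥0} (hUW : IndepFun U W μ) (hU : Measurable U) (hW : Measurable W)
    (hsub : ∀ c : ι → ℝ, ∫⁻ ω, ENNReal.ofReal (Real.exp (∑ i, c i * W ω i)) ∂μ
      ≤ ENNReal.ofReal (Real.exp (k / 2 * ∑ i, c i ^ 2)))
    {F : α → ENNReal} (hF : Measurable F) {h : α → ι → ℝ} (hh : Measurable h) :
    ∫⁻ ω, F (U ω) * ENNReal.ofReal (Real.exp (∑ i, h (U ω) i * W ω i)) ∂μ
      ≤ ∫⁻ ω, F (U ω) * ENNReal.ofReal (Real.exp (k / 2 * ∑ i, h (U ω) i ^ 2)) ∂μ := by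
  have hh' : ∀ i, Measurable fun a => h a i := fun i => (measurable_pi_apply i).comp hh
  have hG : Measurable fun p : α × (ι → ℝ) =>
      F p.1 * ENNReal.ofReal (Real.exp (∑ i, h p.1 i * p.2 i)) := by
    refine (hF.comp measurable_fst).mul (ENNReal.measurable_ofReal.comp
      (Real.measurable_exp.comp (Finset.measurable_sum _ fun i _ => ?_)))
    exact ((hh' i).comp measurable_fst).mul ((measurable_pi_apply i).comp measurable_snd)
  have hmap := (indepFun_iff_map_prod_eq_prod_map_map hU.aemeasurable hW.aemeasurable).mp hUW
  have e1 : ∫⁻ ω, F (U ω) * ENNReal.ofReal (Real.exp (∑ i, h (U ω) i * W ω i)) ∂μ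
      = ∫⁻ p, F p.1 * ENNReal.ofReal (Real.exp (∑ i, h p.1 i * p.2 i))
        ∂(μ.map fun ω => (U ω, W ω)) := (lintegral_map hG (hU.prodMk hW)).symm
  have := Measure.isProbabilityMeasure_map (μ := μ) hU.aemeasurable
  have := Measure.isProbabilityMeasure_map (μ := μ) hW.aemeasurable
  have hK : Measurable fun a => F a * ENNReal.ofReal (Real.exp (k / 2 * ∑ i, h a i ^ 2)) := by
    refine hF.mul (ENNReal.measurable_ofReal.comp (Real.measurable_exp.comp
      ((Finset.measurable_sum _ fun i _ => (hh' i).pow_const 2).const_mul _)))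
  rw [e1, hmap, lintegral_prod _ hG.aemeasurable, ← lintegral_map hK hU]
  refine lintegral_mono fun a => ?_
  have hm : Measurable fun y : ι → ℝ => ENNReal.ofReal (Real.exp (∑ i, h a i * y i)) := by
    fun_prop
  simp only
  rw [lintegral_const_mul _ hm, lintegral_map hm hW]
  gcongr
  exact hsub (h a)

theorem lintegral_exp_mul_gaussianReal (a : ℝ) :
    ∫⁻ h, ENNReal.ofReal (Real.exp (a * h)) ∂(gaussianReal 0 1)
      = ENNReal.ofReal (Real.exp (a ^ 2 / 2)) := by
  rw [← ofReal_integral_eq_lintegral_ofReal (integrable_exp_mul_gaussianReal a)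
    (Filter.Eventually.of_forall fun _ => (Real.exp_pos _).le)]
  congr 1
  have := congrFun (mgf_fun_id_gaussianReal (μ := 0) (v := 1)) a
  simpa [mgf] using this

/-- The integral equals (1 - c)^(-1/2), and (1 - c)(1 + 2c) ≥ 1 exactly because c ≤ 1/2. -/
theorem lintegral_exp_sq_gaussianReal_le {c : ℝ} (hc0 : 0 ≤ c) (hc : c ≤ 1 / 2) :
    ∫⁻ h, ENNReal.ofReal (Real.exp (c / 2 * h ^ 2)) ∂(gaussianReal 0 1)
      ≤ ENNReal.ofReal (Real.exp c) := by
  have e : ∀ h : ℝ, gaussianPDFReal 0 1 h * Real.exp (c / 2 * h ^ 2)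
      = (√(2 * Real.pi))⁻¹ * Real.exp (-((1 - c) / 2) * h ^ 2) := fun h => by
    rw [gaussianPDFReal, mul_assoc, ← Real.exp_add]
    congr 2
    · simp
    · push_cast; ring
  have hint : Integrable (fun h : ℝ => gaussianPDFReal 0 1 h * Real.exp (c / 2 * h ^ 2)) := by
    simp_rw [e]
    exact (integrable_exp_neg_mul_sq (by linarith)).const_mul _
  rw [gaussianReal_of_var_ne_zero _ one_ne_zero,
    lintegral_withDensity_eq_lintegral_mul _ (measurable_gaussianPDF 0 1) (by fun_prop)]
  have e2 : ∀ h : ℝ, (gaussianPDF 0 1 * fun h => ENNReal.ofReal (Real.exp (c / 2 * h ^ 2))) h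
      = ENNReal.ofReal (gaussianPDFReal 0 1 h * Real.exp (c / 2 * h ^ 2)) := fun h => by
    rw [Pi.mul_apply, gaussianPDF, ENNReal.ofReal_mul (gaussianPDFReal_nonneg _ _ _)]
  simp_rw [e2]
  rw [← ofReal_integral_eq_lintegral_ofReal hint (Filter.Eventually.of_forall fun h =>
    mul_nonneg (gaussianPDFReal_nonneg _ _ _) (Real.exp_pos _).le)]
  refine ENNReal.ofReal_le_ofReal ?_
  simp_rw [e]
  rw [integral_const_mul, integral_gaussian, ← Real.sqrt_inv, ← Real.sqrt_mul (by positivity)]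
  refine Real.sqrt_le_iff.mpr ⟨(Real.exp_pos _).le, ?_⟩
  have h1 : (2 * Real.pi)⁻¹ * (Real.pi / ((1 - c) / 2)) = (1 - c)⁻¹ := by
    have : (1 - c) ≠ 0 := by linarith
    field_simp
  rw [h1, ← Real.exp_nat_mul, inv_le_iff_one_le_mul₀ (by linarith)]
  have h2 := Real.add_one_le_exp (((2 : ℕ) : ℝ) * c)
  push_cast at h2 ⊢
  nlinarith

theorem lintegral_pi_prod {ι : Type*} [Fintype ι] {ν : Measure ℝ} [IsProbabilityMeasure ν]
    {f : ι → ℝ → ENNReal} (hf : ∀ i, Measurable (f i)) :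
    ∫⁻ x, ∏ i, f i (x i) ∂(Measure.pi fun _ : ι => ν) = ∏ i, ∫⁻ y, f i y ∂ν := by
  have h := lintegral_prod_eq_prod_lintegral_of_indepFun
    (μ := Measure.pi fun _ : ι => ν) Finset.univ (fun i x => f i (x i))
    (iIndepFun_pi fun i => (hf i).aemeasurable)
    (fun i => (hf i).comp (measurable_pi_apply i))
  rw [h]
  refine Finset.prod_congr rfl fun i _ => ?_
  exact (measurePreserving_eval (fun _ : ι => ν) i).lintegral_comp (hf i)

/-- Spectral decomposition of the quadratic form of a symmetric matrix. -/
theorem exists_diagonalization_of_isHermitian [DecidableEq ι] {S : Matrix ι ι ℝ}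
    (hS : S.IsHermitian) :
    ∃ U : Matrix ι ι ℝ, Uᵀ * U = 1 ∧
      ∀ x, x ⬝ᵥ S *ᵥ x = ∑ i, hS.eigenvalues i * (Uᵀ *ᵥ x) i ^ 2 := by
  set U : Matrix ι ι ℝ := hS.eigenvectorUnitary.1 with hUdef
  have hU : Uᵀ * U = 1 := by
    have := (Matrix.mem_unitaryGroup_iff'.mp hS.eigenvectorUnitary.2)
    rwa [Matrix.star_eq_conjTranspose, Matrix.conjTranspose_eq_transpose_of_trivial] at this
  refine ⟨U, hU, fun x => ?_⟩
  have h := hS.spectral_theorem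
  rw [Unitary.conjStarAlgAut_apply, Matrix.star_eq_conjTranspose,
    Matrix.conjTranspose_eq_transpose_of_trivial] at h
  conv_lhs => rw [h]
  rw [← Matrix.mulVec_mulVec, ← Matrix.mulVec_mulVec, Matrix.dotProduct_mulVec,
    ← Matrix.mulVec_transpose, dotProduct]
  refine Finset.sum_congr rfl fun i _ => ?_
  rw [Matrix.mulVec_diagonal]
  simp only [Function.comp_apply, RCLike.ofReal_real_eq_id, id]
  ring

theorem exists_diagonalization [DecidableEq ι] {S : Matrix ι ι ℝ} (hS : S.PosSemidef) :
    ∃ (U : Matrix ι ι ℝ) (l : ι → ℝ), Uᵀ * U = 1 ∧ (∀ i, 0 ≤ l i) ∧ ∑ i, l i = S.trace ∧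
      ∀ x, x ⬝ᵥ S *ᵥ x = ∑ i, l i * (Uᵀ *ᵥ x) i ^ 2 := by
  obtain ⟨U, hU, hq⟩ := exists_diagonalization_of_isHermitian hS.1
  exact ⟨U, hS.1.eigenvalues, hU, hS.eigenvalues_nonneg,
    by rw [hS.1.trace_eq_sum_eigenvalues]; simp, hq⟩

/-- Moment generating function of a positive semidefinite quadratic form in sub-Gaussian
variables. -/
theorem lintegral_exp_quadratic_le [DecidableEq ι] {η : ι → Ω → ℝ} {k : ℝ≥0}
    (hη : ∀ i, Measurable (η i))
    (hsub : ∀ c : ι → ℝ, ∫⁻ ω, ENNReal.ofReal (Real.exp (∑ i, c i * η i ω)) ∂μ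
      ≤ ENNReal.ofReal (Real.exp (k / 2 * ∑ i, c i ^ 2)))
    {S : Matrix ι ι ℝ} (hS : S.PosSemidef)
    (hk : ∀ x, k * (x ⬝ᵥ S *ᵥ x) ≤ 1 / 2 * (x ⬝ᵥ x)) :
    ∫⁻ ω, ENNReal.ofReal (Real.exp (1 / 2 * ((fun i => η i ω) ⬝ᵥ S *ᵥ fun i => η i ω))) ∂μ
      ≤ ENNReal.ofReal (Real.exp (k * S.trace)) := by
  obtain ⟨U, l, hU, hl, htr, hq⟩ := exists_diagonalization hS
  -- Evaluate `hk` at the eigenvectors.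
  have hlk : ∀ j, k * l j ≤ 1 / 2 := fun j => by
    have h1 := hk (U *ᵥ Pi.single j 1)
    rw [hq, Matrix.mulVec_mulVec, hU, Matrix.one_mulVec, Matrix.dotProduct_mulVec,
      ← Matrix.mulVec_transpose, Matrix.mulVec_mulVec, hU, Matrix.one_mulVec] at h1
    simpa [Pi.single_apply] using h1
  set γ := gaussianReal 0 1
  -- Gaussian linearisation: exp(a²/2) is the mean of exp(ah) for standard normal h. The quadratic
  -- exponent becomes linear in η, at the price of an auxiliary Gaussian vector h independent of η.
  have e1 : ∀ ω, ENNReal.ofReal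
      (Real.exp (1 / 2 * ((fun i => η i ω) ⬝ᵥ S *ᵥ fun i => η i ω)))
      = ∫⁻ h, ENNReal.ofReal (Real.exp (∑ i, (∑ j, √(l j) * h j * U i j) * η i ω))
          ∂(Measure.pi fun _ : ι => γ) := fun ω => by
    have e2 : ∀ h : ι → ℝ, ENNReal.ofReal
        (Real.exp (∑ i, (∑ j, √(l j) * h j * U i j) * η i ω))
        = ∏ j, ENNReal.ofReal (Real.exp (√(l j) * (Uᵀ *ᵥ fun i => η i ω) j * h j)) := fun h => by
      rw [← ENNReal.ofReal_prod_of_nonneg (fun _ _ => (Real.exp_pos _).le), ← Real.exp_sum]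
      congr 2
      simp only [Matrix.mulVec, dotProduct, Matrix.transpose_apply, Finset.mul_sum,
        Finset.sum_mul]
      rw [Finset.sum_comm]
      exact Finset.sum_congr rfl fun _ _ => Finset.sum_congr rfl fun _ _ => by ring
    simp_rw [e2]
    rw [lintegral_pi_prod (f := fun j y => ENNReal.ofReal
      (Real.exp (√(l j) * (Uᵀ *ᵥ fun i => η i ω) j * y))) (fun j => by fun_prop)]
    simp_rw [γ, lintegral_exp_mul_gaussianReal]
    rw [← ENNReal.ofReal_prod_of_nonneg (fun _ _ => (Real.exp_pos _).le), ← Real.exp_sum, hq,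
      Finset.mul_sum]
    congr 2
    refine Finset.sum_congr rfl fun j _ => ?_
    rw [mul_pow, Real.sq_sqrt (hl j)]
    ring
  have hn : ∀ h : ι → ℝ, ∑ i, (∑ j, √(l j) * h j * U i j) ^ 2 = ∑ j, l j * h j ^ 2 := fun h => by
    have h1 : ∑ i, (∑ j, √(l j) * h j * U i j) ^ 2
        = (U *ᵥ fun j => √(l j) * h j) ⬝ᵥ (U *ᵥ fun j => √(l j) * h j) := by
      simp only [Matrix.mulVec, dotProduct]
      exact Finset.sum_congr rfl fun i _ => by
        rw [sq]; simp only [mul_comm (U i _)]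
    rw [h1, Matrix.dotProduct_mulVec, ← Matrix.mulVec_transpose, Matrix.mulVec_mulVec, hU,
      Matrix.one_mulVec, dotProduct]
    refine Finset.sum_congr rfl fun j _ => ?_
    rw [mul_mul_mul_comm, Real.mul_self_sqrt (hl j)]
    ring
  simp_rw [e1]
  -- With h frozen, the sub-Gaussian hypothesis removes η; what is left factors over the coordinates
  -- of h.
  rw [lintegral_lintegral_swap (by fun_prop)]
  calc ∫⁻ h, ∫⁻ ω, ENNReal.ofReal (Real.exp (∑ i, (∑ j, √(l j) * h j * U i j) * η i ω)) ∂μ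
        ∂(Measure.pi fun _ : ι => γ)
      ≤ ∫⁻ h, ∏ j, ENNReal.ofReal (Real.exp ((k * l j) / 2 * h j ^ 2))
        ∂(Measure.pi fun _ : ι => γ) := by
        refine lintegral_mono fun h => (hsub _).trans_eq ?_
        rw [hn, ← ENNReal.ofReal_prod_of_nonneg (fun _ _ => (Real.exp_pos _).le), ← Real.exp_sum,
          Finset.mul_sum]
        congr 2
        exact Finset.sum_congr rfl fun j _ => by ring
    _ = ∏ j, ∫⁻ y, ENNReal.ofReal (Real.exp ((k * l j) / 2 * y ^ 2)) ∂γ :=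
        lintegral_pi_prod (f := fun j y => ENNReal.ofReal (Real.exp ((k * l j) / 2 * y ^ 2)))
          (fun j => by fun_prop)
    _ ≤ ∏ j, ENNReal.ofReal (Real.exp (k * l j)) :=
        Finset.prod_le_prod' fun j _ =>
          lintegral_exp_sq_gaussianReal_le (mul_nonneg k.2 (hl j)) (hlk j)
    _ = ENNReal.ofReal (Real.exp (k * S.trace)) := by
        rw [← ENNReal.ofReal_prod_of_nonneg (fun _ _ => (Real.exp_pos _).le), ← Real.exp_sum,
          ← Finset.mul_sum, htr]

end Chaos

/-! ### Diagonal and off-diagonal chaos. -/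

section HansonWright

variable {Ω : Type*} [MeasurableSpace Ω] {μ : Measure Ω} [IsProbabilityMeasure μ]
variable {ι : Type*} [Fintype ι]

theorem exp_le_one_add_add_sq_mul_exp_abs (x : ℝ) :
    Real.exp x ≤ 1 + x + x ^ 2 * Real.exp |x| := by
  have h := Complex.norm_exp_sub_sum_le_norm_mul_exp (x : ℂ) 2
  simp only [Finset.sum_range_succ, Finset.sum_range_zero, zero_add, pow_zero, pow_one,
    Nat.factorial, Nat.cast_one, div_one, mul_one] at h
  rw [← Complex.ofReal_exp, ← Complex.ofReal_one, ← Complex.ofReal_add, ← Complex.ofReal_sub,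
    Complex.norm_real, Complex.norm_real, Real.norm_eq_abs, Real.norm_eq_abs, sq_abs] at h
  linarith [le_abs_self (Real.exp x - (1 + x))]

/-- The exponent 5/8 is 1/2 + 1/8, where the factors exp(1/2) and exp(1/8) of
`lintegral_exp_sq_sub_one_le` meet; 129 · 1.9 then stays below 256. -/
theorem exp_half_le : Real.exp (5 / 8) ≤ 1.9 := by
  have h : Real.exp (5 / 8) ^ 8 ≤ (1.9 : ℝ) ^ 8 := by
    rw [← Real.exp_nat_mul]
    have h1 := Real.exp_one_lt_d9
    have h2 : Real.exp (((8 : ℕ) : ℝ) * (5 / 8)) = Real.exp 1 ^ 5 := by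
      rw [← Real.exp_nat_mul]; norm_num
    rw [h2]
    calc Real.exp 1 ^ 5 ≤ (2.7182818286 : ℝ) ^ 5 := by gcongr
      _ ≤ _ := by norm_num
  exact le_of_pow_le_pow_left₀ (by norm_num) (by norm_num) h

/-- Moment generating function of a centred squared sub-Gaussian variable of unit variance. -/
theorem lintegral_exp_sq_sub_one_le {X : Ω → ℝ} {k : ℝ≥0} (hX : Measurable X)
    (hsub : HasSubgaussianMGF X k μ) (hvar : ∫ ω, X ω * X ω ∂μ = 1) (hk : 1 ≤ k) {s : ℝ}
    (hs : |s| * (8 * k) ≤ 1) :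
    ∫⁻ ω, ENNReal.ofReal (Real.exp (s * (X ω * X ω - 1))) ∂μ
      ≤ ENNReal.ofReal (Real.exp (256 * s ^ 2 * k ^ 2)) := by
  have hk0 : (0 : ℝ) < k := lt_of_lt_of_le one_pos (by exact_mod_cast hk)
  have hk1 : (1 : ℝ) ≤ k := by exact_mod_cast hk
  -- exponential moment of the square
  have hq : ∫⁻ ω, ENNReal.ofReal (Real.exp (1 / (4 * k) * (X ω * X ω))) ∂μ
      ≤ ENNReal.ofReal (Real.exp (1 / 2)) := by
    have h := lintegral_exp_quadratic_le (μ := μ) (ι := Unit) (η := fun _ => X) (k := k)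
      (fun _ => hX)
      (lintegral_exp_sum_le (η := fun _ : Unit => X) (iIndepFun.of_subsingleton) fun _ => hsub)
      -- The largest multiple of the identity allowed by `lintegral_exp_quadratic_le`.
      (S := Matrix.diagonal fun _ => 1 / (2 * (k : ℝ)))
      (Matrix.posSemidef_diagonal_iff.mpr fun _ => by positivity)
      (fun x => by
        simp only [Matrix.mulVec_diagonal, dotProduct, Finset.univ_unique, Finset.sum_singleton]
        refine le_of_eq ?_
        field_simp)
    refine le_trans (lintegral_mono fun ω => le_of_eq ?_) (h.trans_eq ?_)
    · congr 2
      simp only [Matrix.mulVec_diagonal, dotProduct, Finset.univ_unique, Finset.sum_singleton]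
      field_simp; ring
    · congr 2
      simp only [Matrix.trace_diagonal, Finset.univ_unique, Finset.sum_singleton]
      field_simp
  have hint2 : Integrable (fun ω => X ω * X ω) μ := by
    have h := (hsub.memLp 2).integrable_sq
    simpa [sq] using h
  have hexp_meas : Measurable fun ω => Real.exp (1 / (4 * k) * (X ω * X ω)) := by fun_prop
  have hinte : Integrable (fun ω => Real.exp (1 / (4 * k) * (X ω * X ω))) μ := by
    refine ⟨hexp_meas.aestronglyMeasurable, ?_⟩
    rw [hasFiniteIntegral_iff_ofReal (Filter.Eventually.of_forall fun _ => (Real.exp_pos _).le)]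
    exact hq.trans_lt ENNReal.ofReal_lt_top
  have hqr : ∫ ω, Real.exp (1 / (4 * k) * (X ω * X ω)) ∂μ ≤ Real.exp (1 / 2) := by
    rw [← ofReal_integral_eq_lintegral_ofReal hinte
      (Filter.Eventually.of_forall fun _ => (Real.exp_pos _).le)] at hq
    exact (ENNReal.ofReal_le_ofReal_iff (Real.exp_pos _).le).mp hq
  set D : ℝ := 129 * s ^ 2 * k ^ 2 * Real.exp (1 / 8) with hD
  -- Second-order expansion: the linear term has mean zero by the variance hypothesis, and the
  -- remainder is O(s²k²) times an exponential of X² whose mean is already bounded.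
  have hpt : ∀ ω, Real.exp (s * (X ω * X ω - 1))
      ≤ 1 + s * (X ω * X ω - 1) + D * Real.exp (1 / (4 * k) * (X ω * X ω)) := fun ω => by
    refine (exp_le_one_add_add_sq_mul_exp_abs _).trans ?_
    gcongr 1 + s * (X ω * X ω - 1) + ?_
    set y : ℝ := X ω * X ω / (8 * k) with hy
    have hXy : X ω * X ω = 8 * k * y := by rw [hy]; field_simp
    have hy0 : 0 ≤ y := div_nonneg (mul_self_nonneg _) (by positivity)
    rw [hXy]
    have habs : |s * (8 * k * y - 1)| ≤ y + 1 / 8 := by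
      rw [abs_mul]
      have h1 : |8 * k * y - 1| ≤ 8 * k * y + 1 := by
        rw [abs_le]; constructor <;> nlinarith [mul_nonneg hk0.le hy0]
      have h2 : |s| ≤ 1 / 8 := by
        have := abs_nonneg s
        nlinarith
      calc |s| * |8 * k * y - 1| ≤ |s| * (8 * k * y + 1) := by gcongr
        _ = (|s| * (8 * k)) * y + |s| := by ring
        _ ≤ 1 * y + 1 / 8 := by gcongr
        _ = y + 1 / 8 := by ring
    have hy2 : y ^ 2 ≤ 2 * Real.exp y := by
      have := Real.quadratic_le_exp_of_nonneg hy0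
      nlinarith
    have hey : 1 ≤ Real.exp y := Real.one_le_exp hy0
    have hsq : (s * (8 * k * y - 1)) ^ 2 ≤ 129 * s ^ 2 * k ^ 2 * Real.exp y := by
      have h1 : (8 * k * y - 1) ^ 2 ≤ 64 * (k ^ 2 * y ^ 2) + k ^ 2 := by
        nlinarith [mul_nonneg hk0.le hy0]
      have h2 : (8 * k * y - 1) ^ 2 ≤ k ^ 2 * (129 * Real.exp y) := by
        nlinarith [mul_le_mul_of_nonneg_left hy2 (sq_nonneg (k : ℝ)),
          mul_le_mul_of_nonneg_left hey (sq_nonneg (k : ℝ))]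
      calc (s * (8 * k * y - 1)) ^ 2 = s ^ 2 * (8 * k * y - 1) ^ 2 := by ring
        _ ≤ s ^ 2 * (k ^ 2 * (129 * Real.exp y)) := by gcongr
        _ = _ := by ring
    calc (s * (8 * k * y - 1)) ^ 2 * Real.exp |s * (8 * k * y - 1)|
        ≤ (129 * s ^ 2 * k ^ 2 * Real.exp y) * Real.exp (y + 1 / 8) := by gcongr
      _ = D * Real.exp (1 / (4 * k) * (8 * k * y)) := by
          have : 1 / (4 * (k : ℝ)) * (8 * k * y) = y + y := by field_simp; ring
          rw [this, Real.exp_add, Real.exp_add, hD]; ring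
  have hI1 : Integrable (fun ω => s * (X ω * X ω - 1)) μ :=
    (hint2.sub (integrable_const 1)).const_mul s
  have hI2 : Integrable (fun ω => 1 + s * (X ω * X ω - 1)) μ := (integrable_const 1).add hI1
  have hI3 : Integrable (fun ω => D * Real.exp (1 / (4 * k) * (X ω * X ω))) μ :=
    hinte.const_mul D
  calc ∫⁻ ω, ENNReal.ofReal (Real.exp (s * (X ω * X ω - 1))) ∂μ
      ≤ ∫⁻ ω, ENNReal.ofReal (1 + s * (X ω * X ω - 1)
          + D * Real.exp (1 / (4 * k) * (X ω * X ω))) ∂μ :=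
        lintegral_mono fun ω => ENNReal.ofReal_le_ofReal (hpt ω)
    _ = ENNReal.ofReal (∫ ω, (1 + s * (X ω * X ω - 1)
          + D * Real.exp (1 / (4 * k) * (X ω * X ω))) ∂μ) :=
        (ofReal_integral_eq_lintegral_ofReal (hI2.add hI3) (Filter.Eventually.of_forall fun ω =>
          (Real.exp_pos _).le.trans (hpt ω))).symm
    _ ≤ _ := by
        refine ENNReal.ofReal_le_ofReal ?_
        rw [integral_add hI2 hI3, integral_add (integrable_const 1) hI1, integral_const_mul,
          integral_const_mul, integral_sub hint2 (integrable_const 1), hvar]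
        simp only [integral_const, probReal_univ, smul_eq_mul, mul_one, sub_self, mul_zero,
          add_zero]
        have h1 : D * ∫ ω, Real.exp (1 / (4 * k) * (X ω * X ω)) ∂μ ≤ 256 * s ^ 2 * k ^ 2 := by
          calc D * ∫ ω, Real.exp (1 / (4 * k) * (X ω * X ω)) ∂μ
              ≤ D * Real.exp (1 / 2) := by gcongr
            _ = 129 * s ^ 2 * k ^ 2 * Real.exp (5 / 8) := by
                rw [hD, mul_assoc, ← Real.exp_add]; norm_num
            _ ≤ 129 * s ^ 2 * k ^ 2 * 1.9 := by gcongr; exact exp_half_le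
            _ ≤ 256 * s ^ 2 * k ^ 2 := by nlinarith [mul_nonneg (sq_nonneg s) (sq_nonneg (k : ℝ))]
        linarith [Real.add_one_le_exp (256 * s ^ 2 * (k : ℝ) ^ 2)]

/-- For i ≠ j, exactly a quarter of all subsets I contain i and miss j; for i = j none does. -/
theorem sum_offDiag_eq_average [DecidableEq ι] (b : ι → ι → ℝ) :
    ∑ i, ∑ j, (if i = j then 0 else b i j)
      = ∑ I : Finset ι, (1 / 2 ^ Fintype.card ι : ℝ) *
          (4 * ∑ i ∈ I, ∑ j ∈ Iᶜ, b i j) := by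
  have h1 : ∀ I : Finset ι, ∑ i ∈ I, ∑ j ∈ Iᶜ, b i j
      = ∑ i, ∑ j, if i ∈ I ∧ j ∉ I then b i j else 0 := fun I => by
    rw [← Finset.sum_ite_mem_eq I]
    refine Finset.sum_congr rfl fun i _ => ?_
    split_ifs with hi
    · rw [← Finset.sum_ite_mem_eq Iᶜ]
      simp [hi]
    · simp [hi]
  have h2 : ∀ i j : ι, i ≠ j → ((Finset.univ.filter fun I : Finset ι => i ∈ I ∧ j ∉ I).card : ℝ) * 4
      = 2 ^ Fintype.card ι := fun i j hij => by
    have e : (Finset.univ.filter fun I : Finset ι => i ∈ I ∧ j ∉ I)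
        = Finset.Icc {i} (Finset.univ.erase j) := by
      ext I
      simp only [Finset.mem_filter, Finset.mem_univ, true_and, Finset.mem_Icc,
        Finset.singleton_subset_iff, Finset.subset_erase,
        Finset.subset_univ]
    have hcard : 2 ≤ Fintype.card ι := by
      have : ({i, j} : Finset ι).card ≤ Fintype.card ι := Finset.card_le_univ _
      rwa [Finset.card_pair hij] at this
    rw [e, Finset.card_Icc_finset (by simp [hij]), Finset.card_erase_of_mem (Finset.mem_univ j),
      Finset.card_univ, Finset.card_singleton]
    obtain ⟨r, hr⟩ := Nat.exists_eq_add_of_le hcard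
    rw [hr, show 2 + r - 1 - 1 = r by omega]
    push_cast
    ring
  simp_rw [h1, Finset.mul_sum]
  conv_rhs => rw [Finset.sum_comm]
  refine Finset.sum_congr rfl fun i _ => ?_
  conv_rhs => rw [Finset.sum_comm]
  refine Finset.sum_congr rfl fun j _ => ?_
  split_ifs with hij
  · subst hij
    simp
  · simp_rw [mul_ite, mul_zero]
    rw [← Finset.sum_filter, Finset.sum_const, nsmul_eq_mul]
    have := h2 i j hij
    field_simp
    rw [← this]; ring

/-- Moment generating function of an off-diagonal quadratic form, by decoupling. -/
theorem lintegral_exp_offDiag_le [DecidableEq ι] {η : ι → Ω → ℝ} {k : ℝ≥0}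
    (hη : ∀ i, Measurable (η i)) (hind : iIndepFun η μ)
    (hsub : ∀ i, HasSubgaussianMGF (η i) k μ) {a : Matrix ι ι ℝ} {β : ℝ}
    (ha : ∀ y, (a *ᵥ y) ⬝ᵥ (a *ᵥ y) ≤ β ^ 2 * (y ⬝ᵥ y)) {s : ℝ}
    (hs : |s * k * β| ≤ 1 / 8) :
    ∫⁻ ω, ENNReal.ofReal
        (Real.exp (s * ∑ i, ∑ j, if i = j then 0 else a i j * η i ω * η j ω)) ∂μ
      ≤ ENNReal.ofReal (Real.exp (16 * s ^ 2 * k ^ 2 * ∑ i, ∑ j, a i j ^ 2)) := by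
  set R := ENNReal.ofReal (Real.exp (16 * s ^ 2 * k ^ 2 * ∑ i, ∑ j, a i j ^ 2)) with hR
  -- For fixed I the form is bilinear in the independent blocks indexed by I and its complement.
  -- Integrating out the block I leaves the exponential of a positive semidefinite form in the other
  -- block, whose matrix is S.
  have hI : ∀ I : Finset ι, ∫⁻ ω, ENNReal.ofReal
      (Real.exp (s * (4 * ∑ i ∈ I, ∑ j ∈ Iᶜ, a i j * η i ω * η j ω))) ∂μ ≤ R := fun I => by
    set B : Matrix ι ι ℝ := Matrix.of fun i j => if i ∈ I ∧ j ∉ I then a i j else 0 with hB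
    set S : Matrix ι ι ℝ := (16 * s ^ 2 * (k : ℝ)) • (Bᵀ * B) with hS
    have hBB : ∀ x, x ⬝ᵥ S *ᵥ x = 16 * s ^ 2 * k * ((B *ᵥ x) ⬝ᵥ (B *ᵥ x)) := fun x => by
      rw [hS, Matrix.smul_mulVec, dotProduct_smul, smul_eq_mul, ← Matrix.mulVec_mulVec,
        Matrix.dotProduct_mulVec x, Matrix.vecMul_transpose]
    have hBx : ∀ x i, (B *ᵥ x) i = if i ∈ I then ∑ j ∈ Iᶜ, a i j * x j else 0 := fun x i => by
      simp only [Matrix.mulVec, dotProduct, hB, Matrix.of_apply]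
      split_ifs with hi
      · rw [← Finset.sum_ite_mem_eq Iᶜ]
        refine Finset.sum_congr rfl fun j _ => ?_
        by_cases hj : j ∈ I <;> simp [hi, hj]
      · simp [hi]
    have hSpsd : S.PosSemidef := by
      have h := Matrix.posSemidef_conjTranspose_mul_self B
      rw [Matrix.conjTranspose_eq_transpose_of_trivial] at h
      exact h.smul (by positivity)
    have hSk : ∀ x, (k : ℝ) * (x ⬝ᵥ S *ᵥ x) ≤ 1 / 2 * (x ⬝ᵥ x) := fun x => by
      set x' : ι → ℝ := fun j => if j ∈ Iᶜ then x j else 0 with hx'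
      have h1 : (B *ᵥ x) ⬝ᵥ (B *ᵥ x) ≤ (a *ᵥ x') ⬝ᵥ (a *ᵥ x') := by
        refine Finset.sum_le_sum fun i _ => ?_
        have e : (a *ᵥ x') i = ∑ j ∈ Iᶜ, a i j * x j := by
          simp only [Matrix.mulVec, dotProduct, hx', mul_ite, mul_zero]
          rw [Finset.sum_ite_mem_eq]
        rw [hBx, e]
        split_ifs
        · exact le_rfl
        · simpa using mul_self_nonneg _
      have h2 : x' ⬝ᵥ x' ≤ x ⬝ᵥ x := by
        refine Finset.sum_le_sum fun i _ => ?_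
        simp only [hx']
        split_ifs
        · exact le_rfl
        · simpa using mul_self_nonneg _
      have h3 : (s * k * β) ^ 2 ≤ 1 / 64 := by
        rw [← sq_abs]
        calc |s * k * β| ^ 2 ≤ (1 / 8) ^ 2 := by gcongr
          _ = 1 / 64 := by norm_num
      have h4 : 0 ≤ x ⬝ᵥ x := Finset.sum_nonneg fun i _ => mul_self_nonneg _
      rw [hBB]
      calc (k : ℝ) * (16 * s ^ 2 * k * ((B *ᵥ x) ⬝ᵥ (B *ᵥ x)))
          ≤ (k : ℝ) * (16 * s ^ 2 * k * (β ^ 2 * (x ⬝ᵥ x))) := by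
            gcongr
            exact h1.trans ((ha x').trans (by gcongr))
        _ = 16 * (s * k * β) ^ 2 * (x ⬝ᵥ x) := by ring
        _ ≤ 16 * (1 / 64) * (x ⬝ᵥ x) := by gcongr
        _ ≤ 1 / 2 * (x ⬝ᵥ x) := by nlinarith
    have hdis : Disjoint Iᶜ I := disjoint_compl_left
    have hUW := hind.indepFun_finset Iᶜ I hdis hη
    have hMGF := lintegral_exp_sum_le (μ := μ) (η := fun i : I => η i)
      (hind.precomp Subtype.val_injective) (fun i => hsub i)
    have key := lintegral_mul_exp_le hUW (measurable_pi_lambda _ fun i => hη i)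
      (measurable_pi_lambda _ fun i => hη i) hMGF (F := fun _ => 1) measurable_const
      (h := fun (y : ↥(Iᶜ) → ℝ) (i : ↥I) => 4 * s * ∑ j : ↥(Iᶜ), a i j * y j)
      (measurable_pi_lambda _ fun i => by fun_prop)
    simp only [one_mul] at key
    have e1 : ∀ ω, ∑ i : ↥I, 4 * s * (∑ j : ↥(Iᶜ), a i j * η j ω) * η i ω
        = s * (4 * ∑ i ∈ I, ∑ j ∈ Iᶜ, a i j * η i ω * η j ω) := fun ω => by
      rw [Finset.sum_coe_sort I fun i => 4 * s * (∑ j : ↥(Iᶜ), a i j * η j ω) * η i ω]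
      simp_rw [fun i => Finset.sum_coe_sort Iᶜ fun j => a i j * η j ω, Finset.mul_sum,
        Finset.sum_mul]
      exact Finset.sum_congr rfl fun _ _ => Finset.sum_congr rfl fun _ _ => by ring
    have e2 : ∀ ω, (k : ℝ) / 2 * ∑ i : ↥I, (4 * s * ∑ j : ↥(Iᶜ), a i j * η j ω) ^ 2
        = 1 / 2 * ((fun i => η i ω) ⬝ᵥ S *ᵥ fun i => η i ω) := fun ω => by
      rw [hBB, Finset.sum_coe_sort I fun i => (4 * s * (∑ j : ↥(Iᶜ), a i j * η j ω)) ^ 2]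
      simp_rw [fun i => Finset.sum_coe_sort Iᶜ fun j => a i j * η j ω]
      have : (B *ᵥ fun i => η i ω) ⬝ᵥ (B *ᵥ fun i => η i ω)
          = ∑ i ∈ I, (∑ j ∈ Iᶜ, a i j * η j ω) ^ 2 := by
        rw [dotProduct, ← Finset.sum_ite_mem_eq I]
        refine Finset.sum_congr rfl fun i _ => ?_
        rw [hBx]
        split_ifs <;> ring
      rw [this]
      simp_rw [mul_pow, ← Finset.mul_sum]
      ring
    simp_rw [e1, e2] at key
    refine key.trans ((lintegral_exp_quadratic_le hη (lintegral_exp_sum_le hind hsub) hSpsd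
      hSk).trans (ENNReal.ofReal_le_ofReal (Real.exp_le_exp.mpr ?_)))
    have htr : (Bᵀ * B).trace ≤ ∑ i, ∑ j, a i j ^ 2 := by
      simp only [Matrix.trace, Matrix.diag, Matrix.mul_apply, Matrix.transpose_apply]
      rw [Finset.sum_comm]
      refine Finset.sum_le_sum fun i _ => Finset.sum_le_sum fun j _ => ?_
      simp only [hB, Matrix.of_apply]
      split_ifs
      · exact (sq _).ge
      · simpa using sq_nonneg _
    rw [hS, Matrix.trace_smul, smul_eq_mul]
    calc (k : ℝ) * (16 * s ^ 2 * k * (Bᵀ * B).trace)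
        ≤ (k : ℝ) * (16 * s ^ 2 * k * ∑ i, ∑ j, a i j ^ 2) := by gcongr
      _ = _ := by ring
  have hw : ∑ _I : Finset ι, (1 / 2 ^ Fintype.card ι : ℝ) = 1 := by
    rw [Finset.sum_const, Finset.card_univ, Fintype.card_finset, nsmul_eq_mul]
    push_cast
    field_simp
  -- Jensen: the exponential of an average over subsets is at most the average of the exponentials.
  have hJ : ∀ ω, ENNReal.ofReal
      (Real.exp (s * ∑ i, ∑ j, if i = j then 0 else a i j * η i ω * η j ω))
      ≤ ∑ I : Finset ι, ENNReal.ofReal (1 / 2 ^ Fintype.card ι) * ENNReal.ofReal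
      (Real.exp (s * (4 * ∑ i ∈ I, ∑ j ∈ Iᶜ, a i j * η i ω * η j ω))) := fun ω => by
    have h := convexOn_exp.map_sum_le (t := Finset.univ)
      (w := fun _ : Finset ι => (1 / 2 ^ Fintype.card ι : ℝ))
      (p := fun I => s * (4 * ∑ i ∈ I, ∑ j ∈ Iᶜ, a i j * η i ω * η j ω))
      (fun _ _ => by positivity) hw (fun _ _ => Set.mem_univ _)
    simp only [smul_eq_mul] at h
    rw [sum_offDiag_eq_average fun i j => a i j * η i ω * η j ω, Finset.mul_sum]
    simp_rw [← ENNReal.ofReal_mul (show (0 : ℝ) ≤ 1 / 2 ^ Fintype.card ι by positivity)]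
    rw [← ENNReal.ofReal_sum_of_nonneg fun _ _ => by positivity]
    refine ENNReal.ofReal_le_ofReal (le_trans (le_of_eq ?_) h)
    congr 1
    exact Finset.sum_congr rfl fun _ _ => by ring
  refine (lintegral_mono hJ).trans ?_
  rw [lintegral_finsetSum _ fun I _ => by fun_prop]
  simp_rw [lintegral_const_mul' _ _ ENNReal.ofReal_ne_top]
  calc ∑ I : Finset ι, ENNReal.ofReal (1 / 2 ^ Fintype.card ι) * (∫⁻ ω, ENNReal.ofReal
      (Real.exp (s * (4 * ∑ i ∈ I, ∑ j ∈ Iᶜ, a i j * η i ω * η j ω))) ∂μ)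
      ≤ ∑ _I : Finset ι, ENNReal.ofReal (1 / 2 ^ Fintype.card ι) * R := by
        gcongr with I
        exact hI I
    _ = R := by
        rw [← Finset.sum_mul, ← ENNReal.ofReal_sum_of_nonneg fun _ _ => by positivity, hw]
        simp

end HansonWright

/-! ### Euclidean inequalities for quadratic forms. -/

theorem dotProduct_self_nonneg' {ι : Type*} [Fintype ι] (x : ι → ℝ) : 0 ≤ x ⬝ᵥ x :=
  Finset.sum_nonneg fun _ _ => mul_self_nonneg _

theorem dotProduct_sq_le {ι : Type*} [Fintype ι] (x y : ι → ℝ) :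
    (x ⬝ᵥ y) ^ 2 ≤ (x ⬝ᵥ x) * (y ⬝ᵥ y) := by
  have h := Finset.sum_mul_sq_le_sq_mul_sq Finset.univ x y
  simpa only [dotProduct, sq] using h

/-- Cancels one factor `a` with no case distinction on its sign; it closes the duality arguments
below. -/
theorem le_of_sq_le_mul {a b : ℝ} (hb : 0 ≤ b) (h : a ^ 2 ≤ b * a) : a ≤ b := by
  by_contra hlt
  push Not at hlt
  nlinarith [mul_pos (sub_pos.mpr hlt) (hb.trans_lt hlt)]

theorem dotProduct_mulVec_transpose {κ ι : Type*} [Fintype κ] [Fintype ι] (M : Matrix κ ι ℝ)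
    (z : κ → ℝ) (y : ι → ℝ) : (Mᵀ *ᵥ z) ⬝ᵥ y = z ⬝ᵥ M *ᵥ y := by
  rw [Matrix.mulVec_transpose, Matrix.dotProduct_mulVec]

/-- Duality: ‖Mᵀz‖² = ⟨z, MMᵀz⟩, so Cauchy-Schwarz and the bound on M give ‖Mᵀz‖⁴ ≤ ‖z‖² · β‖Mᵀz‖².
-/
theorem transpose_mulVec_bound {κ ι : Type*} [Fintype κ] [Fintype ι] {M : Matrix κ ι ℝ} {β : ℝ}
    (hβ0 : 0 ≤ β) (hβ : ∀ y, (M *ᵥ y) ⬝ᵥ (M *ᵥ y) ≤ β * (y ⬝ᵥ y)) (z : κ → ℝ) :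
    (Mᵀ *ᵥ z) ⬝ᵥ (Mᵀ *ᵥ z) ≤ β * (z ⬝ᵥ z) := by
  refine le_of_sq_le_mul (mul_nonneg hβ0 (dotProduct_self_nonneg' z)) ?_
  conv_lhs => rw [dotProduct_mulVec_transpose]
  refine (dotProduct_sq_le _ _).trans ?_
  calc (z ⬝ᵥ z) * ((M *ᵥ Mᵀ *ᵥ z) ⬝ᵥ (M *ᵥ Mᵀ *ᵥ z))
      ≤ (z ⬝ᵥ z) * (β * ((Mᵀ *ᵥ z) ⬝ᵥ (Mᵀ *ᵥ z))) :=
        mul_le_mul_of_nonneg_left (hβ _) (dotProduct_self_nonneg' z)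
    _ = _ := by ring

/-- Column j of MᵀM is Mᵀ applied to column j of M. This bounds the Frobenius norm in Hanson-Wright
by operator norm times trace. -/
theorem sum_sq_transpose_mul_self_le {κ ι : Type*} [Fintype κ] [Fintype ι] [DecidableEq ι]
    {M : Matrix κ ι ℝ} {β : ℝ}
    (hβ0 : 0 ≤ β) (hβ : ∀ y, (M *ᵥ y) ⬝ᵥ (M *ᵥ y) ≤ β * (y ⬝ᵥ y)) :
    ∑ i, ∑ j, (Mᵀ * M) i j ^ 2 ≤ β * (Mᵀ * M).trace := by
  rw [Finset.sum_comm, Matrix.trace, Finset.mul_sum]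
  refine Finset.sum_le_sum fun j _ => ?_
  have h := transpose_mulVec_bound hβ0 hβ (M *ᵥ Pi.single j 1)
  have e1 : Mᵀ *ᵥ (M *ᵥ Pi.single j 1) = fun i => (Mᵀ * M) i j := by
    rw [Matrix.mulVec_mulVec]; ext; simp
  have e2 : (M *ᵥ Pi.single j 1) ⬝ᵥ (M *ᵥ Pi.single j 1) = (Mᵀ * M) j j := by
    rw [← dotProduct_mulVec_transpose, e1]; simp
  rw [e1, e2] at h
  simpa only [dotProduct, sq, Matrix.diag] using h

/-! ### The Hanson-Wright inequality. -/

section HansonWright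

variable {Ω : Type*} [MeasurableSpace Ω] {μ : Measure Ω} [IsProbabilityMeasure μ]
variable {ι κ : Type*} [Fintype ι] [Fintype κ] [DecidableEq ι]

/-- **Hanson-Wright inequality** (moment generating function form) for `‖M η‖²`, with `η` a vector
of independent sub-Gaussian coordinates of unit variance. -/
theorem lintegral_exp_hansonWright_le {η : ι → Ω → ℝ} {k : ℝ≥0}
    (hη : ∀ i, Measurable (η i)) (hind : iIndepFun η μ)
    (hsub : ∀ i, HasSubgaussianMGF (η i) k μ) (hvar : ∀ i, ∫ ω, η i ω * η i ω ∂μ = 1)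
    (hk : 1 ≤ k) {M : Matrix κ ι ℝ} {β : ℝ} (hβ0 : 0 ≤ β)
    (hβ : ∀ y, (M *ᵥ y) ⬝ᵥ (M *ᵥ y) ≤ β * (y ⬝ᵥ y)) {s : ℝ} (hs : |s| * (16 * k * β) ≤ 1) :
    ∫⁻ ω, ENNReal.ofReal (Real.exp (s * ((M *ᵥ fun i => η i ω) ⬝ᵥ (M *ᵥ fun i => η i ω)
        - (Mᵀ * M).trace))) ∂μ
      ≤ ENNReal.ofReal (Real.exp (544 * s ^ 2 * k ^ 2 * (β * (Mᵀ * M).trace))) := by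
  have hk0 : (0 : ℝ) < k := lt_of_lt_of_le one_pos (by exact_mod_cast hk)
  set a : Matrix ι ι ℝ := Mᵀ * M with ha
  have haF : ∑ i, ∑ j, a i j ^ 2 ≤ β * a.trace := sum_sq_transpose_mul_self_le hβ0 hβ
  set F := ∑ i, ∑ j, a i j ^ 2 with hF
  have hdiag : ∀ i, |a i i| ≤ β := fun i => by
    have h := hβ (Pi.single i 1)
    rw [← dotProduct_mulVec_transpose, Matrix.mulVec_mulVec, dotProduct_comm] at h
    have h0 : 0 ≤ a i i := by
      rw [ha, Matrix.mul_apply]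
      exact Finset.sum_nonneg fun _ _ => by
        rw [Matrix.transpose_apply]; exact mul_self_nonneg _
    rw [abs_of_nonneg h0]
    simpa [dotProduct, Pi.single_apply] using h
  have hop : ∀ y, (a *ᵥ y) ⬝ᵥ (a *ᵥ y) ≤ β ^ 2 * (y ⬝ᵥ y) := fun y => by
    rw [ha, ← Matrix.mulVec_mulVec]
    refine (transpose_mulVec_bound hβ0 hβ _).trans ?_
    rw [sq, mul_assoc]
    exact mul_le_mul_of_nonneg_left (hβ y) hβ0
  have hq : ∀ ω, (M *ᵥ fun i => η i ω) ⬝ᵥ (M *ᵥ fun i => η i ω) - a.trace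
      = ∑ i, a i i * (η i ω * η i ω - 1)
        + ∑ i, ∑ j, (if i = j then 0 else a i j * η i ω * η j ω) := fun ω => by
    rw [← dotProduct_mulVec_transpose, Matrix.mulVec_mulVec, ← ha, dotProduct_comm, dotProduct,
      Matrix.trace, ← Finset.sum_sub_distrib, ← Finset.sum_add_distrib]
    refine Finset.sum_congr rfl fun i _ => ?_
    have : ∑ j, (if i = j then 0 else a i j * η i ω * η j ω)
        = ∑ j, a i j * η i ω * η j ω - a i i * η i ω * η i ω := by
      rw [eq_sub_iff_add_eq, ← Finset.sum_erase_add _ _ (Finset.mem_univ i),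
        ← Finset.sum_erase_add Finset.univ (fun j => a i j * η i ω * η j ω) (Finset.mem_univ i),
        if_pos rfl, add_zero]
      congr 1
      exact Finset.sum_congr rfl fun j hj => if_neg (Finset.ne_of_mem_erase hj).symm
    rw [this, Matrix.mulVec, dotProduct, Finset.mul_sum, Matrix.diag]
    have e : ∀ j, η i ω * (a i j * η j ω) = a i j * η i ω * η j ω := fun j => by ring
    simp_rw [e]
    ring
  -- The diagonal and off-diagonal parts are dependent, so each is estimated at parameter `2 * s`
  -- and the two are combined by a Cauchy-Schwarz argument.
  have hD : ∫⁻ ω, ENNReal.ofReal (Real.exp (2 * s * ∑ i, a i i * (η i ω * η i ω - 1))) ∂μ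
      ≤ ENNReal.ofReal (Real.exp (1024 * s ^ 2 * k ^ 2 * F)) := by
    have e1 : ∀ ω, ENNReal.ofReal (Real.exp (2 * s * ∑ i, a i i * (η i ω * η i ω - 1)))
        = ∏ i, ENNReal.ofReal (Real.exp ((2 * s * a i i) * (η i ω * η i ω - 1))) := fun ω => by
      rw [← ENNReal.ofReal_prod_of_nonneg (fun _ _ => (Real.exp_pos _).le), ← Real.exp_sum,
        Finset.mul_sum]
      congr 2
      exact Finset.sum_congr rfl fun _ _ => by ring
    simp_rw [e1]
    rw [lintegral_prod_eq_prod_lintegral_of_indepFun Finset.univ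
      (fun i ω => ENNReal.ofReal (Real.exp ((2 * s * a i i) * (η i ω * η i ω - 1))))
      (hind.comp (fun i y => ENNReal.ofReal (Real.exp ((2 * s * a i i) * (y * y - 1))))
        fun i => by fun_prop)
      (fun i => by have := hη i; fun_prop)]
    calc ∏ i, ∫⁻ ω, ENNReal.ofReal (Real.exp ((2 * s * a i i) * (η i ω * η i ω - 1))) ∂μ
        ≤ ∏ i, ENNReal.ofReal (Real.exp (256 * (2 * s * a i i) ^ 2 * k ^ 2)) := by
          refine Finset.prod_le_prod' fun i _ =>
            lintegral_exp_sq_sub_one_le (hη i) (hsub i) (hvar i) hk ?_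
          rw [abs_mul, abs_mul, abs_two]
          calc 2 * |s| * |a i i| * (8 * k) ≤ 2 * |s| * β * (8 * k) := by
                gcongr; exact hdiag i
            _ = |s| * (16 * k * β) := by ring
            _ ≤ 1 := hs
      _ = ENNReal.ofReal (Real.exp (1024 * s ^ 2 * k ^ 2 * ∑ i, a i i ^ 2)) := by
          rw [← ENNReal.ofReal_prod_of_nonneg (fun _ _ => (Real.exp_pos _).le), ← Real.exp_sum,
            Finset.mul_sum]
          congr 2
          exact Finset.sum_congr rfl fun _ _ => by ring
      _ ≤ _ := by
          gcongr
          exact Finset.sum_le_sum fun i _ =>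
            Finset.single_le_sum (f := fun j => a i j ^ 2) (fun _ _ => sq_nonneg _)
              (Finset.mem_univ i)
  have hO := lintegral_exp_offDiag_le (s := 2 * s) hη hind hsub hop (by
    rw [abs_mul, abs_mul, abs_mul, abs_two, abs_of_pos hk0, abs_of_nonneg hβ0]
    linarith)
  set d := 1024 * s ^ 2 * k ^ 2 * F
  set o := 16 * (2 * s) ^ 2 * k ^ 2 * F
  set X := fun ω => ∑ i, a i i * (η i ω * η i ω - 1)
  set Y := fun ω => ∑ i, ∑ j, (if i = j then 0 else a i j * η i ω * η j ω)
  have hY : Measurable Y := Finset.measurable_sum _ fun i _ => Finset.measurable_sum _ fun j _ => by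
    have := hη i
    have := hη j
    split_ifs <;> fun_prop
  have hX : Measurable X := by fun_prop
  -- Pointwise 2ab ≤ a² + b² in place of Cauchy-Schwarz. The weights exp(±(o - d)/2) make both terms
  -- contribute equally after integration, giving exp((o + d)/2), hence 544 = (1024 + 64)/2.
  have hpt : ∀ ω, ENNReal.ofReal (Real.exp (s * (X ω + Y ω)))
      ≤ ENNReal.ofReal (Real.exp ((o - d) / 2) / 2) * ENNReal.ofReal (Real.exp (2 * s * X ω))
        + ENNReal.ofReal (Real.exp ((d - o) / 2) / 2)
          * ENNReal.ofReal (Real.exp (2 * s * Y ω)) := fun ω => by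
    rw [← ENNReal.ofReal_mul (by positivity), ← ENNReal.ofReal_mul (by positivity),
      ← ENNReal.ofReal_add (by positivity) (by positivity)]
    refine ENNReal.ofReal_le_ofReal ?_
    have e1 : Real.exp ((o - d) / 2) / 2 * Real.exp (2 * s * X ω)
        = Real.exp ((o - d) / 4 + s * X ω) ^ 2 / 2 := by
      rw [← Real.exp_nat_mul, div_mul_eq_mul_div, ← Real.exp_add]; congr 2; push_cast; ring
    have e2 : Real.exp ((d - o) / 2) / 2 * Real.exp (2 * s * Y ω)
        = Real.exp ((d - o) / 4 + s * Y ω) ^ 2 / 2 := by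
      rw [← Real.exp_nat_mul, div_mul_eq_mul_div, ← Real.exp_add]; congr 2; push_cast; ring
    have e3 : Real.exp (s * (X ω + Y ω))
        = Real.exp ((o - d) / 4 + s * X ω) * Real.exp ((d - o) / 4 + s * Y ω) := by
      rw [← Real.exp_add]; congr 1; ring
    rw [e1, e2, e3]
    nlinarith [sq_nonneg (Real.exp ((o - d) / 4 + s * X ω) - Real.exp ((d - o) / 4 + s * Y ω))]
  simp_rw [hq]
  refine (lintegral_mono hpt).trans ?_
  rw [lintegral_add_left (by fun_prop), lintegral_const_mul' _ _ ENNReal.ofReal_ne_top,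
    lintegral_const_mul' _ _ ENNReal.ofReal_ne_top]
  refine (add_le_add (mul_le_mul_right hD _) (mul_le_mul_right hO _)).trans ?_
  rw [← ENNReal.ofReal_mul (by positivity), ← ENNReal.ofReal_mul (by positivity),
    ← ENNReal.ofReal_add (by positivity) (by positivity)]
  refine ENNReal.ofReal_le_ofReal ?_
  have e4 : Real.exp ((o - d) / 2) / 2 * Real.exp d + Real.exp ((d - o) / 2) / 2 * Real.exp o
      = Real.exp ((o + d) / 2) := by
    rw [div_mul_eq_mul_div, div_mul_eq_mul_div, ← Real.exp_add, ← Real.exp_add,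
      show (o - d) / 2 + d = (o + d) / 2 by ring, show (d - o) / 2 + o = (o + d) / 2 by ring]
    ring
  rw [e4]
  refine Real.exp_le_exp.mpr ?_
  calc (o + d) / 2 = 544 * s ^ 2 * k ^ 2 * F := by ring
    _ ≤ _ := by gcongr

theorem measure_hansonWright_le {η : ι → Ω → ℝ} {k : ℝ≥0}
    (hη : ∀ i, Measurable (η i)) (hind : iIndepFun η μ)
    (hsub : ∀ i, HasSubgaussianMGF (η i) k μ) (hvar : ∀ i, ∫ ω, η i ω * η i ω ∂μ = 1)
    (hk : 1 ≤ k) {M : Matrix κ ι ℝ} {β τ : ℝ} (hβ0 : 0 < β)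
    (hβ : ∀ y, (M *ᵥ y) ⬝ᵥ (M *ᵥ y) ≤ β * (y ⬝ᵥ y)) (hτ : (Mᵀ * M).trace ≤ 4 * τ) :
    μ {ω | τ / 4 < |(M *ᵥ fun i => η i ω) ⬝ᵥ (M *ᵥ fun i => η i ω) - (Mᵀ * M).trace|}
      ≤ ENNReal.ofReal (2 * Real.exp (-(τ / (139264 * k ^ 2 * β)))) := by
  have hk1 : (1 : ℝ) ≤ k := by exact_mod_cast hk
  have hk0 : (0 : ℝ) < k := one_pos.trans_le hk1
  have htr0 : 0 ≤ (Mᵀ * M).trace := by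
    have h := (Matrix.posSemidef_conjTranspose_mul_self M).trace_nonneg
    rwa [Matrix.conjTranspose_eq_transpose_of_trivial] at h
  have hτ0 : 0 ≤ τ := by linarith
  set q := fun ω => (M *ᵥ fun i => η i ω) ⬝ᵥ (M *ᵥ fun i => η i ω) - (Mᵀ * M).trace with hq
  -- The minimiser of -sτ/4 + 544 s²k²β·4τ; the minimum is -sτ/8, and 8 · 17408 = 139264.
  set s : ℝ := 1 / (17408 * k ^ 2 * β) with hs
  have hs0 : 0 < s := by positivity
  have hone : ∀ e : ℝ, |e| = 1 → μ {ω | τ / 4 ≤ e * q ω}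
      ≤ ENNReal.ofReal (Real.exp (-(τ / (139264 * k ^ 2 * β)))) := fun e he => by
    have hb := lintegral_exp_hansonWright_le (s := e * s) hη hind hsub hvar hk hβ0.le hβ (by
      rw [abs_mul, he, one_mul, abs_of_pos hs0, hs, div_mul_eq_mul_div, div_le_one (by positivity)]
      nlinarith [mul_pos hk0 hβ0, mul_le_mul_of_nonneg_right hk1 (mul_pos hk0 hβ0).le])
    have hqm : Measurable q := by
      simp only [hq, Matrix.mulVec, dotProduct]
      fun_prop
    have hmk := mul_meas_ge_le_lintegral (μ := μ)
      (f := fun ω => ENNReal.ofReal (Real.exp (e * s * q ω))) (by fun_prop)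
      (ENNReal.ofReal (Real.exp (s * (τ / 4))))
    have hsub' : {ω | τ / 4 ≤ e * q ω} ⊆ {ω | ENNReal.ofReal (Real.exp (s * (τ / 4)))
        ≤ ENNReal.ofReal (Real.exp (e * s * q ω))} := fun ω hω => by
      refine ENNReal.ofReal_le_ofReal (Real.exp_le_exp.mpr ?_)
      have := mul_le_mul_of_nonneg_left (show τ / 4 ≤ e * q ω from hω) hs0.le
      linarith
    have h1 := (mul_le_mul_right (measure_mono hsub') _).trans (hmk.trans hb)
    have h2 : μ {ω | τ / 4 ≤ e * q ω} = ENNReal.ofReal (Real.exp (-(s * (τ / 4)))) *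
        (ENNReal.ofReal (Real.exp (s * (τ / 4))) * μ {ω | τ / 4 ≤ e * q ω}) := by
      rw [← mul_assoc, ← ENNReal.ofReal_mul (Real.exp_pos _).le, ← Real.exp_add]
      simp
    rw [h2]
    refine (mul_le_mul_right h1 _).trans ?_
    rw [← ENNReal.ofReal_mul (Real.exp_pos _).le, ← Real.exp_add]
    refine ENNReal.ofReal_le_ofReal (Real.exp_le_exp.mpr ?_)
    have he2 : e ^ 2 = 1 := by rw [← sq_abs, he, one_pow]
    calc -(s * (τ / 4)) + 544 * (e * s) ^ 2 * k ^ 2 * (β * (Mᵀ * M).trace)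
        ≤ -(s * (τ / 4)) + 544 * (e * s) ^ 2 * k ^ 2 * (β * (4 * τ)) := by gcongr
      _ = -(τ / (139264 * k ^ 2 * β)) := by
          rw [mul_pow, he2, hs]; field_simp; ring
  have hsplit : {ω | τ / 4 < |q ω|} ⊆ {ω | τ / 4 ≤ 1 * q ω} ∪ {ω | τ / 4 ≤ (-1) * q ω} :=
    fun ω hω => by
      rcases lt_abs.mp (show τ / 4 < |q ω| from hω) with h | h
      · left; show τ / 4 ≤ 1 * q ω; linarith
      · right; show τ / 4 ≤ -1 * q ω; linarith
  refine (measure_mono hsplit).trans ((measure_union_le _ _).trans ?_)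
  rw [two_mul, ENNReal.ofReal_add (Real.exp_pos _).le (Real.exp_pos _).le]
  exact add_le_add (hone 1 (by simp)) (hone (-1) (by simp))

end HansonWright

/-! ### Finite norming sets. -/

section Net

/-- A finite-dimensional normed space has a norming subset of its unit ball with at most `5 ^ dim`
elements. -/
theorem exists_norming_finset (E : Type*) [NormedAddCommGroup E] [NormedSpace ℝ E]
    [FiniteDimensional ℝ E] :
    ∃ N : Finset E, N.card ≤ 5 ^ Module.finrank ℝ E ∧ (∀ c ∈ N, ‖c‖ ≤ 1) ∧
      ∀ (f : E →L[ℝ] ℝ) (m : ℝ), (∀ c ∈ N, |f c| ≤ m) → ‖f‖ ≤ 2 * m := by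
  classical
  let Sep : Finset E → Prop := fun s =>
    (∀ c ∈ s, ‖c‖ ≤ 2) ∧ ∀ c ∈ s, ∀ d ∈ s, c ≠ d → 1 ≤ ‖c - d‖
  let P : ℕ → Prop := fun n => ∃ s, Sep s ∧ s.card = n
  have hP0 : P 0 := ⟨∅, ⟨by simp, by simp⟩, rfl⟩
  -- A 1-separated set of maximal size in the ball of radius 2; volume comparison caps its size at 5
  -- ^ dim, which is why the search is bounded.
  obtain ⟨s, hs, hcard⟩ : P (Nat.findGreatest P (5 ^ Module.finrank ℝ E)) :=
    Nat.findGreatest_spec (Nat.zero_le _) hP0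
  have hcov : ∀ x : E, ‖x‖ ≤ 2 → ∃ c ∈ s, ‖x - c‖ < 1 := fun x hx => by
    by_contra hne
    push Not at hne
    have hxs : x ∉ s := fun h => by
      have := hne x h
      simp at this
      linarith
    have hins : Sep (insert x s) := by
      refine ⟨fun c hc => ?_, fun c hc d hd hcd => ?_⟩
      · rcases Finset.mem_insert.mp hc with rfl | hc
        · exact hx
        · exact hs.1 c hc
      · rcases Finset.mem_insert.mp hc with rfl | hc' <;>
          rcases Finset.mem_insert.mp hd with rfl | hd'
        · exact absurd rfl hcd
        · exact hne d hd'
        · rw [norm_sub_rev]; exact hne c hc'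
        · exact hs.2 c hc' d hd' hcd
    have hle := Besicovitch.card_le_of_separated _ hins.1 hins.2
    have := Nat.le_findGreatest hle (show P (insert x s).card from ⟨_, hins, rfl⟩)
    rw [← hcard, Finset.card_insert_of_notMem hxs] at this
    omega
  -- By maximality `s` is a 1-net of the ball of radius 2. Halving gives a 1/2-net of the unit ball,
  -- so ‖f‖ ≤ m + ‖f‖/2.
  refine ⟨s.image fun c => (1 / 2 : ℝ) • c, ?_, ?_, fun f m hm => ?_⟩
  · exact Finset.card_image_le.trans (Besicovitch.card_le_of_separated _ hs.1 hs.2)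
  · intro c hc
    obtain ⟨d, hd, rfl⟩ := Finset.mem_image.mp hc
    rw [norm_smul]
    have := hs.1 d hd
    norm_num
    linarith
  · have hbound : ∀ x : E, ‖x‖ = 1 → ‖f x‖ ≤ m + ‖f‖ / 2 := fun x hx => by
      obtain ⟨c, hc, hxc⟩ := hcov ((2 : ℝ) • x) (by rw [norm_smul, hx]; norm_num)
      have h1 := hm _ (Finset.mem_image_of_mem _ hc)
      have h2 : f x = f ((1 / 2 : ℝ) • c) + f ((1 / 2 : ℝ) • ((2 : ℝ) • x - c)) := by
        rw [← map_add]; congr 1; module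
      have h3 := f.le_opNorm ((1 / 2 : ℝ) • ((2 : ℝ) • x - c))
      rw [norm_smul] at h3
      have h4 : ‖(1 / 2 : ℝ)‖ = 1 / 2 := by norm_num
      rw [h4] at h3
      rw [h2]
      refine (norm_add_le _ _).trans (add_le_add h1 (h3.trans ?_))
      nlinarith [norm_nonneg f]
    have hm0 : 0 ≤ m := by
      obtain ⟨c, hc, -⟩ := hcov 0 (by simp)
      exact (abs_nonneg _).trans (hm _ (Finset.mem_image_of_mem _ hc))
    have := ContinuousLinearMap.opNorm_le_of_unit_norm (f := f) (C := m + ‖f‖ / 2) (by positivity)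
      hbound
    linarith

variable {ι : Type*} [Fintype ι] [DecidableEq ι]

/-- A norming set for the norm `x ↦ √(xᵀ V x)`. -/
theorem exists_norming_finset_posDef {V : Matrix ι ι ℝ} (hV : V.PosDef) :
    ∃ N : Finset (ι → ℝ), N.card ≤ 5 ^ Fintype.card ι ∧ (∀ c ∈ N, c ⬝ᵥ V *ᵥ c ≤ 1) ∧
      ∀ (f : (ι → ℝ) →ₗ[ℝ] ℝ) (m : ℝ), (∀ c ∈ N, |f c| ≤ m) →
        ∀ y, |f y| ≤ 2 * m * √(y ⬝ᵥ V *ᵥ y) := by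
  classical
  obtain ⟨U, l, -, hl, -, hq⟩ := exists_diagonalization hV.posSemidef
  -- R satisfies RᵀR = V, so it carries the V-norm isometrically to the Euclidean norm, and the net
  -- is pulled back along it.
  set R : Matrix ι ι ℝ := Matrix.diagonal (fun i => √(l i)) * Uᵀ with hR
  have hRq : ∀ x, ‖WithLp.toLp 2 (R *ᵥ x)‖ ^ 2 = x ⬝ᵥ V *ᵥ x := fun x => by
    rw [EuclideanSpace.real_norm_sq_eq, hq]
    refine Finset.sum_congr rfl fun i _ => ?_
    simp only [hR, ← Matrix.mulVec_mulVec, Matrix.mulVec_diagonal, mul_pow, Real.sq_sqrt (hl i)]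
  let L : (ι → ℝ) →ₗ[ℝ] EuclideanSpace ℝ ι :=
    (WithLp.linearEquiv 2 ℝ (ι → ℝ)).symm.toLinearMap ∘ₗ R.mulVecLin
  have hL : ∀ x, ‖L x‖ ^ 2 = x ⬝ᵥ V *ᵥ x := hRq
  have hinj : Function.Injective L := by
    rw [← LinearMap.ker_eq_bot, LinearMap.ker_eq_bot']
    intro x hx
    by_contra hne
    have h := hL x
    rw [hx] at h
    have := hV.dotProduct_mulVec_pos hne
    simp only [star_trivial] at this
    simp at h
    linarith
  let e : (ι → ℝ) ≃ₗ[ℝ] EuclideanSpace ℝ ι :=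
    LinearEquiv.ofInjectiveOfFinrankEq L hinj (by simp)
  have he : ∀ x, e x = L x := fun x => rfl
  obtain ⟨N, hcard, hball, hnorm⟩ := exists_norming_finset (EuclideanSpace ℝ ι)
  refine ⟨N.image e.symm, ?_, ?_, fun f m hm y => ?_⟩
  · refine Finset.card_image_le.trans (hcard.trans_eq ?_)
    simp
  · intro c hc
    obtain ⟨d, hd, rfl⟩ := Finset.mem_image.mp hc
    rw [← hL, ← he, LinearEquiv.apply_symm_apply]
    have := hball d hd
    nlinarith [norm_nonneg d]
  · have h := hnorm (LinearMap.toContinuousLinearMap (f ∘ₗ e.symm.toLinearMap)) m fun c hc =>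
      hm _ (Finset.mem_image_of_mem _ hc)
    have h2 := (LinearMap.toContinuousLinearMap (f ∘ₗ e.symm.toLinearMap)).le_of_opNorm_le h (e y)
    simp only [LinearMap.coe_toContinuousLinearMap', LinearMap.comp_apply, LinearEquiv.coe_coe,
      LinearEquiv.symm_apply_apply, Real.norm_eq_abs] at h2
    rwa [← hL, Real.sqrt_sq (norm_nonneg _)]

omit [DecidableEq ι] in
/-- Control of a symmetric bilinear form from a norming set. -/
theorem quadratic_le_of_norming {V : Matrix ι ι ℝ} {N : Finset (ι → ℝ)}
    (hN : ∀ (f : (ι → ℝ) →ₗ[ℝ] ℝ) (m : ℝ), (∀ c ∈ N, |f c| ≤ m) →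
        ∀ y, |f y| ≤ 2 * m * √(y ⬝ᵥ V *ᵥ y)) (hV : ∀ y, 0 ≤ y ⬝ᵥ V *ᵥ y)
    {S : Matrix ι ι ℝ} (hS : Sᵀ = S) {m : ℝ}
    (hm : ∀ c ∈ N, ∀ d ∈ N, |(c + d) ⬝ᵥ S *ᵥ (c + d)| ≤ m ∧ |(c - d) ⬝ᵥ S *ᵥ (c - d)| ≤ m)
    (x : ι → ℝ) : |x ⬝ᵥ S *ᵥ x| ≤ 2 * m * (x ⬝ᵥ V *ᵥ x) := by
  let f : (ι → ℝ) → (ι → ℝ) →ₗ[ℝ] ℝ := fun c =>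
    { toFun := fun y => c ⬝ᵥ S *ᵥ y
      map_add' := fun y z => by rw [Matrix.mulVec_add, dotProduct_add]
      map_smul' := fun r y => by rw [Matrix.mulVec_smul, dotProduct_smul]; rfl }
  have hf : ∀ c y, f c y = c ⬝ᵥ S *ᵥ y := fun _ _ => rfl
  have hsymm : ∀ c y, f c y = f y c := fun c y => by
    rw [hf, hf, ← dotProduct_mulVec_transpose, hS, dotProduct_comm]
  have h1 : ∀ c ∈ N, ∀ d ∈ N, |f c d| ≤ m / 2 := fun c hc d hd => by
    obtain ⟨hp, hq⟩ := hm c hc d hd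
    have e : f c d = ((c + d) ⬝ᵥ S *ᵥ (c + d) - (c - d) ⬝ᵥ S *ᵥ (c - d)) / 4 := by
      have h := hsymm c d
      rw [hf, hf] at h
      simp only [Matrix.mulVec_add, Matrix.mulVec_sub, dotProduct_add, dotProduct_sub,
        add_dotProduct, sub_dotProduct]
      rw [hf, ← h]; ring
    -- Polarisation gives m/2 on pairs of net points; each of the two variables is then freed at the
    -- cost of a factor 2.
    rw [e, abs_le]
    rw [abs_le] at hp hq
    constructor <;> linarith [hp.1, hp.2, hq.1, hq.2]
  have h2 : ∀ c ∈ N, ∀ y, |f c y| ≤ m * √(y ⬝ᵥ V *ᵥ y) := fun c hc y => by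
    have := hN (f c) _ (h1 c hc) y
    linarith
  have h3 := hN (f x) (m * √(x ⬝ᵥ V *ᵥ x)) (fun c hc => by rw [hsymm]; exact h2 c hc x) x
  rw [hf] at h3
  calc |x ⬝ᵥ S *ᵥ x| ≤ 2 * (m * √(x ⬝ᵥ V *ᵥ x)) * √(x ⬝ᵥ V *ᵥ x) := h3
    _ = 2 * m * (√(x ⬝ᵥ V *ᵥ x) * √(x ⬝ᵥ V *ᵥ x)) := by ring
    _ = _ := by rw [Real.mul_self_sqrt (hV x)]

end Net

/-! ### Stability estimates from the Lyapunov equation. -/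

section Lyapunov

theorem vnorm_sq {ι : Type*} [Fintype ι] (v : ι → ℝ) : vnorm v ^ 2 = v ⬝ᵥ v := by
  rw [vnorm, EuclideanSpace.real_norm_sq_eq, dotProduct]
  exact Finset.sum_congr rfl fun _ _ => sq _

theorem vnorm_nonneg {ι : Type*} [Fintype ι] (v : ι → ℝ) : 0 ≤ vnorm v := norm_nonneg _

open scoped Matrix.Norms.L2Operator in
theorem opNorm_nonneg {m n : Type*} [Fintype m] [Fintype n] [DecidableEq n] (M : Matrix m n ℝ) :
    0 ≤ opNorm M := norm_nonneg M

open scoped Matrix.Norms.L2Operator in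
theorem vnorm_mulVec_le {m n : Type*} [Fintype m] [Fintype n] [DecidableEq n] (M : Matrix m n ℝ)
    (v : n → ℝ) : vnorm (M *ᵥ v) ≤ opNorm M * vnorm v :=
  Matrix.l2_opNorm_mulVec M (WithLp.toLp 2 v)

theorem mulVec_dotProduct_self_le {m n : Type*} [Fintype m] [Fintype n] [DecidableEq n]
    (M : Matrix m n ℝ) (v : n → ℝ) : (M *ᵥ v) ⬝ᵥ (M *ᵥ v) ≤ opNorm M ^ 2 * (v ⬝ᵥ v) := by
  rw [← vnorm_sq, ← vnorm_sq, ← mul_pow]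
  exact pow_le_pow_left₀ (vnorm_nonneg _) (vnorm_mulVec_le M v) 2

theorem abs_dotProduct_mulVec_self_le {n : Type*} [Fintype n] [DecidableEq n]
    (M : Matrix n n ℝ) (v : n → ℝ) : |v ⬝ᵥ M *ᵥ v| ≤ opNorm M * (v ⬝ᵥ v) := by
  refine abs_le_of_sq_le_sq ?_ (mul_nonneg (opNorm_nonneg M) (dotProduct_self_nonneg' v))
  refine (dotProduct_sq_le _ _).trans ?_
  nlinarith [mul_le_mul_of_nonneg_left (mulVec_dotProduct_self_le M v) (dotProduct_self_nonneg' v)]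

variable {n m : ℕ} {A : Matrix (Fin n) (Fin n) ℝ} {B : Matrix (Fin n) (Fin m) ℝ}
  {Q : Matrix (Fin n) (Fin n) ℝ} {K : Matrix (Fin m) (Fin n) ℝ}

/-- The Lyapunov equation as a dissipation inequality, with Q ≥ I. The term in K is kept because
inputs Kx must be controlled together with states. -/
theorem lyapP_step (hQ : (Q - 1).PosSemidef) (hst : IsStable (A + B * K)) (v : Fin n → ℝ) :
    ((A + B * K) *ᵥ v) ⬝ᵥ lyapP A B Q K *ᵥ ((A + B * K) *ᵥ v) + v ⬝ᵥ v + (K *ᵥ v) ⬝ᵥ (K *ᵥ v)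
      ≤ v ⬝ᵥ lyapP A B Q K *ᵥ v := by
  have h := dlyap_eq (A + B * K) (Q + Kᵀ * K) hst
  change lyapP A B Q K = (A + B * K)ᵀ * lyapP A B Q K * (A + B * K) + (Q + Kᵀ * K) at h
  have hq := hQ.dotProduct_mulVec_nonneg v
  rw [star_trivial, Matrix.sub_mulVec, Matrix.one_mulVec, dotProduct_sub] at hq
  have e : v ⬝ᵥ lyapP A B Q K *ᵥ v
      = ((A + B * K) *ᵥ v) ⬝ᵥ lyapP A B Q K *ᵥ ((A + B * K) *ᵥ v) + v ⬝ᵥ Q *ᵥ v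
        + (K *ᵥ v) ⬝ᵥ (K *ᵥ v) := by
    conv_lhs => rw [h]
    rw [Matrix.add_mulVec, Matrix.add_mulVec, dotProduct_add, dotProduct_add,
      ← Matrix.mulVec_mulVec, ← Matrix.mulVec_mulVec, ← Matrix.mulVec_mulVec (M := Kᵀ),
      dotProduct_comm v ((A + B * K)ᵀ *ᵥ _), dotProduct_mulVec_transpose,
      dotProduct_comm v (Kᵀ *ᵥ _), dotProduct_mulVec_transpose,
      dotProduct_comm ((A + B * K) *ᵥ v), add_assoc]
  linarith

theorem lyapP_iterate (hQ : (Q - 1).PosSemidef) (hst : IsStable (A + B * K)) (v : Fin n → ℝ)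
    (j : ℕ) :
    ((A + B * K) ^ j *ᵥ v) ⬝ᵥ lyapP A B Q K *ᵥ ((A + B * K) ^ j *ᵥ v)
      + ∑ i ∈ Finset.range j, ((A + B * K) ^ i *ᵥ v) ⬝ᵥ ((A + B * K) ^ i *ᵥ v)
      ≤ v ⬝ᵥ lyapP A B Q K *ᵥ v := by
  induction j with
  | zero => simp
  | succ j ih =>
    have h := lyapP_step hQ hst ((A + B * K) ^ j *ᵥ v)
    rw [Matrix.mulVec_mulVec, ← pow_succ'] at h
    rw [Finset.sum_range_succ]
    linarith [dotProduct_self_nonneg' (K *ᵥ ((A + B * K) ^ j *ᵥ v))]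

/-- Along the closed loop the value never increases, and it tends to 0 since the trajectory does. -/
theorem lyapP_nonneg (hQ : (Q - 1).PosSemidef) (hst : IsStable (A + B * K)) (v : Fin n → ℝ) :
    0 ≤ v ⬝ᵥ lyapP A B Q K *ᵥ v := by
  obtain ⟨C, r, hC, hr0, hr1, hb⟩ := hst.exists_bound
  have hlim : Filter.Tendsto (fun j : ℕ => (A + B * K) ^ j *ᵥ v) Filter.atTop (nhds 0) := by
    rw [tendsto_pi_nhds]
    intro i
    have h0 : Filter.Tendsto (fun j : ℕ => (C * ∑ l, |v l|) * r ^ j) Filter.atTop (nhds 0) := by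
      simpa using (tendsto_pow_atTop_nhds_zero_of_lt_one hr0 hr1).const_mul (C * ∑ l, |v l|)
    refine squeeze_zero_norm (fun j => ?_) h0
    rw [Matrix.mulVec, dotProduct]
    refine (norm_sum_le _ _).trans ?_
    rw [Finset.mul_sum, Finset.sum_mul]
    refine Finset.sum_le_sum fun l _ => ?_
    rw [norm_mul, Real.norm_eq_abs, Real.norm_eq_abs]
    nlinarith [mul_le_mul_of_nonneg_right (hb j i l) (abs_nonneg (v l))]
  have hcont : Continuous fun y : Fin n → ℝ => y ⬝ᵥ lyapP A B Q K *ᵥ y := by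
    simp only [Matrix.mulVec, dotProduct]
    fun_prop
  have hlim2 := (hcont.tendsto 0).comp hlim
  simp only [zero_dotProduct] at hlim2
  refine le_of_tendsto hlim2 (Filter.Eventually.of_forall fun j => ?_)
  have h := lyapP_iterate hQ hst v j
  have : 0 ≤ ∑ i ∈ Finset.range j, ((A + B * K) ^ i *ᵥ v) ⬝ᵥ ((A + B * K) ^ i *ᵥ v) :=
    Finset.sum_nonneg fun i _ => dotProduct_self_nonneg' _
  simp only [Function.comp_apply]
  linarith

theorem sum_pow_mulVec_le (hQ : (Q - 1).PosSemidef) (hst : IsStable (A + B * K)) (v : Fin n → ℝ)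
    (j : ℕ) :
    ∑ i ∈ Finset.range j, ((A + B * K) ^ i *ᵥ v) ⬝ᵥ ((A + B * K) ^ i *ᵥ v)
      ≤ opNorm (lyapP A B Q K) * (v ⬝ᵥ v) := by
  linarith [lyapP_iterate hQ hst v j, lyapP_nonneg hQ hst ((A + B * K) ^ j *ᵥ v),
    le_abs_self (v ⬝ᵥ lyapP A B Q K *ᵥ v), abs_dotProduct_mulVec_self_le (lyapP A B Q K) v]

theorem self_add_gain_le_lyapP (hQ : (Q - 1).PosSemidef) (hst : IsStable (A + B * K))
    (v : Fin n → ℝ) : v ⬝ᵥ v + (K *ᵥ v) ⬝ᵥ (K *ᵥ v) ≤ v ⬝ᵥ lyapP A B Q K *ᵥ v := by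
  linarith [lyapP_step hQ hst v, lyapP_nonneg hQ hst ((A + B * K) *ᵥ v)]

theorem one_le_opNorm_lyapP [NeZero n] (hQ : (Q - 1).PosSemidef) (hst : IsStable (A + B * K)) :
    1 ≤ opNorm (lyapP A B Q K) := by
  have h := self_add_gain_le_lyapP hQ hst (Pi.single (0 : Fin n) 1)
  have h2 := abs_dotProduct_mulVec_self_le (lyapP A B Q K) (Pi.single (0 : Fin n) 1)
  have h3 := (le_abs_self _).trans h2
  have e : (Pi.single (0 : Fin n) (1 : ℝ)) ⬝ᵥ Pi.single (0 : Fin n) 1 = 1 := by simp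
  rw [e] at h h3
  linarith [dotProduct_self_nonneg' (K *ᵥ (Pi.single (0 : Fin n) (1 : ℝ)))]

/-- Geometric decay of the closed loop, in terms of the norm of the Lyapunov solution. -/
theorem pow_mulVec_decay [NeZero n] (hQ : (Q - 1).PosSemidef) (hst : IsStable (A + B * K))
    (v : Fin n → ℝ) (j : ℕ) :
    ((A + B * K) ^ j *ᵥ v) ⬝ᵥ ((A + B * K) ^ j *ᵥ v)
      + (K *ᵥ ((A + B * K) ^ j *ᵥ v)) ⬝ᵥ (K *ᵥ ((A + B * K) ^ j *ᵥ v))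
      ≤ opNorm (lyapP A B Q K) * (1 - 1 / opNorm (lyapP A B Q K)) ^ j * (v ⬝ᵥ v) := by
  set p := opNorm (lyapP A B Q K) with hp
  have hp1 : 1 ≤ p := one_le_opNorm_lyapP hQ hst
  have hρ : 0 ≤ 1 - 1 / p := by
    rw [sub_nonneg, div_le_one (by linarith)]; exact hp1
  have hup : ∀ y, y ⬝ᵥ lyapP A B Q K *ᵥ y ≤ p * (y ⬝ᵥ y) := fun y =>
    (le_abs_self _).trans (abs_dotProduct_mulVec_self_le _ y)
  have key : ((A + B * K) ^ j *ᵥ v) ⬝ᵥ lyapP A B Q K *ᵥ ((A + B * K) ^ j *ᵥ v)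
      ≤ (1 - 1 / p) ^ j * (v ⬝ᵥ lyapP A B Q K *ᵥ v) := by
    induction j with
    | zero => simp
    | succ j ih =>
      have h := lyapP_step hQ hst ((A + B * K) ^ j *ᵥ v)
      rw [Matrix.mulVec_mulVec, ← pow_succ'] at h
      set y := (A + B * K) ^ j *ᵥ v
      -- Since P ≤ pI, the energy dissipated in one step is at least the fraction 1/p of the current
      -- value.
      have h1 : 1 / p * (y ⬝ᵥ lyapP A B Q K *ᵥ y) ≤ y ⬝ᵥ y := by
        rw [one_div, inv_mul_le_iff₀ (by linarith)]; exact hup y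
      have h2 := mul_le_mul_of_nonneg_left ih hρ
      rw [pow_succ' (1 - 1 / p), mul_assoc]
      linarith [dotProduct_self_nonneg' (K *ᵥ y)]
  have h1 := self_add_gain_le_lyapP hQ hst ((A + B * K) ^ j *ᵥ v)
  have h2 := mul_le_mul_of_nonneg_left (hup v) (pow_nonneg hρ j)
  linarith

theorem sum_geometric_le {p : ℝ} (hp : 1 ≤ p) (N : ℕ) :
    ∑ j ∈ Finset.range N, (1 - 1 / p) ^ j ≤ p := by
  have hρ : 0 ≤ 1 - 1 / p := by
    rw [sub_nonneg, div_le_one (by linarith)]; exact hp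
  have h := mul_neg_geom_sum (1 - 1 / p) N
  have h1 : 1 / p * ∑ j ∈ Finset.range N, (1 - 1 / p) ^ j ≤ 1 := by
    have : 1 - (1 - 1 / p) = 1 / p := by ring
    rw [this] at h
    rw [h]
    linarith [pow_nonneg hρ N]
  have h2 := mul_le_mul_of_nonneg_left h1 (zero_le_one.trans hp)
  rwa [← mul_assoc, mul_one_div_cancel (by linarith), one_mul, mul_one] at h2

/-- With q = √(1 - 1/p), 1/(1 - q) = (1 + q)p ≤ 2p. Squared, this gives 4p³, the cube of ‖P‖ in the
burn-in time. -/
theorem sum_sqrt_geometric_le {p : ℝ} (hp : 1 ≤ p) (N : ℕ) :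
    ∑ j ∈ Finset.range N, √(p * (1 - 1 / p) ^ j) ≤ 2 * p * √p := by
  have hp0 : 0 < p := by linarith
  have hρ : 0 ≤ 1 - 1 / p := by
    rw [sub_nonneg, div_le_one hp0]; exact hp
  set q := √(1 - 1 / p) with hq
  have hq0 : 0 ≤ q := Real.sqrt_nonneg _
  have hq2 : q ^ 2 = 1 - 1 / p := Real.sq_sqrt hρ
  have hq1 : q ≤ 1 := by
    refine Real.sqrt_le_one.mpr ?_
    have : 0 < 1 / p := by positivity
    linarith
  have e : ∀ j, √(p * (1 - 1 / p) ^ j) = √p * q ^ j := fun j => by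
    rw [Real.sqrt_mul hp0.le, ← hq2, ← pow_mul, mul_comm 2 j, pow_mul, Real.sqrt_sq (by positivity)]
  simp_rw [e]
  rw [← Finset.mul_sum]
  have h := mul_neg_geom_sum q N
  have h1 : ∑ j ∈ Finset.range N, q ^ j ≤ 2 * p := by
    have h2 : (1 - q) * ∑ j ∈ Finset.range N, q ^ j ≤ 1 := by
      rw [h]; linarith [pow_nonneg hq0 N]
    have h3 : (1 + q) * (1 - q) = 1 / p := by
      have : (1 + q) * (1 - q) = 1 - q ^ 2 := by ring
      rw [this, hq2]; ring
    have h4 : 1 / p * ∑ j ∈ Finset.range N, q ^ j ≤ 2 := by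
      rw [← h3, mul_assoc]
      nlinarith
    rw [one_div, inv_mul_le_iff₀ hp0] at h4
    linarith
  have := mul_le_mul_of_nonneg_left h1 (Real.sqrt_nonneg p)
  linarith

/-- Young's inequality for causal convolutions. -/
theorem sum_sq_convolution_le {k y : ℕ → ℝ} (hk : ∀ j, 0 ≤ k j) {c : ℝ}
    (hc : ∀ N, ∑ j ∈ Finset.range N, k j ≤ c) (t : ℕ) :
    ∑ s ∈ Finset.range t, (∑ r ∈ Finset.range s, k (s - 1 - r) * y r) ^ 2
      ≤ c ^ 2 * ∑ r ∈ Finset.range t, y r ^ 2 := by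
  have hc0 : 0 ≤ c := by simpa using hc 0
  calc ∑ s ∈ Finset.range t, (∑ r ∈ Finset.range s, k (s - 1 - r) * y r) ^ 2
      ≤ ∑ s ∈ Finset.range t, c * ∑ r ∈ Finset.range s, k (s - 1 - r) * y r ^ 2 := by
        refine Finset.sum_le_sum fun s _ => ?_
        -- Cauchy-Schwarz with kernel weights; exchanging the order of summation then yields the
        -- second factor c.
        have h := Finset.sum_sq_le_sum_mul_sum_of_sq_le_mul (Finset.range s)
          (r := fun r => k (s - 1 - r) * y r) (f := fun r => k (s - 1 - r))
          (g := fun r => k (s - 1 - r) * y r ^ 2) (fun _ _ => hk _)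
          (fun _ _ => mul_nonneg (hk _) (sq_nonneg _)) (fun _ _ => le_of_eq (by ring))
        refine h.trans (mul_le_mul_of_nonneg_right ?_
          (Finset.sum_nonneg fun _ _ => mul_nonneg (hk _) (sq_nonneg _)))
        rw [Finset.sum_range_reflect k s]
        exact hc s
    _ = c * ∑ r ∈ Finset.range t, (∑ s ∈ Finset.Ico (r + 1) t, k (s - 1 - r)) * y r ^ 2 := by
        rw [← Finset.mul_sum]
        simp_rw [Finset.sum_mul]
        congr 1
        refine Finset.sum_comm' fun s r => ?_
        simp only [Finset.mem_range, Finset.mem_Ico]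
        omega
    _ ≤ c * ∑ r ∈ Finset.range t, c * y r ^ 2 := by
        gcongr with r _
        rw [Finset.sum_Ico_eq_sum_range]
        refine le_trans (le_of_eq ?_) (hc (t - (r + 1)))
        refine Finset.sum_congr rfl fun j _ => ?_
        congr 1
        omega
    _ = _ := by rw [← Finset.mul_sum]; ring

end Lyapunov

/-! ### Mean covariance and the noise-to-output map. -/

section Covariance

variable {n m : ℕ}

/-- The energy `‖a‖² + σu² ‖Bᵀ a‖²` injected in direction `a` at one time step. -/
def noiseGain (B : Matrix (Fin n) (Fin m) ℝ) (σu : ℝ) (a : Fin n → ℝ) : ℝ :=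
  a ⬝ᵥ a + σu ^ 2 * ((Bᵀ *ᵥ a) ⬝ᵥ (Bᵀ *ᵥ a))

/-- Average covariance of the noise-driven part of the state, and of the exploration noise. -/
def noiseCov (F : Matrix (Fin n) (Fin n) ℝ) (B : Matrix (Fin n) (Fin m) ℝ) (σu : ℝ) (t : ℕ) :
    Matrix (Fin n ⊕ Fin m) (Fin n ⊕ Fin m) ℝ :=
  fromBlocks ((t : ℝ)⁻¹ • ∑ s ∈ Finset.range (t - 1), ∑ j ∈ Finset.range (s + 1),
    F ^ j * (σu ^ 2 • (B * Bᵀ) + (1 : Matrix (Fin n) (Fin n) ℝ)) * (F ^ j)ᵀ) 0 0 1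

/-- The state reached from `0` under the noise `η`. -/
def noiseState (F : Matrix (Fin n) (Fin n) ℝ) (B : Matrix (Fin n) (Fin m) ℝ) (σu : ℝ)
    (η : ℕ → Fin n ⊕ Fin m → ℝ) (s : ℕ) : Fin n → ℝ :=
  ∑ r ∈ Finset.range s,
    F ^ (s - 1 - r) *ᵥ ((fun i => η r (Sum.inl i)) + σu • B *ᵥ fun j => η r (Sum.inr j))

/-- Response of the direction `a` of the state at time `s` to the noise at time `r`. -/
def respVec (F : Matrix (Fin n) (Fin n) ℝ) (a : Fin n → ℝ) (s r : ℕ) : Fin n → ℝ :=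
  if r < s then (F ^ (s - 1 - r))ᵀ *ᵥ a else 0

/-- The matrix mapping the noise to the first `t` values of the direction `v` of
(noise-driven state, exploration noise). -/
def respMat (F : Matrix (Fin n) (Fin n) ℝ) (B : Matrix (Fin n) (Fin m) ℝ) (σu : ℝ) (t : ℕ)
    (v : Fin n ⊕ Fin m → ℝ) : Matrix (Fin t) (Fin t × (Fin n ⊕ Fin m)) ℝ :=
  Matrix.of fun s p => Sum.elim (respVec F (v ∘ Sum.inl) s p.1)
    (fun j => σu * (Bᵀ *ᵥ respVec F (v ∘ Sum.inl) s p.1) j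
      + if p.1 = s then v (Sum.inr j) else 0) p.2

theorem dotProduct_sum_type {ι κ : Type*} [Fintype ι] [Fintype κ] (x y : ι ⊕ κ → ℝ) :
    x ⬝ᵥ y = (x ∘ Sum.inl) ⬝ᵥ (y ∘ Sum.inl) + (x ∘ Sum.inr) ⬝ᵥ (y ∘ Sum.inr) := by
  simp [dotProduct, Fintype.sum_sum_type]

variable {F : Matrix (Fin n) (Fin n) ℝ} {B : Matrix (Fin n) (Fin m) ℝ} {σu : ℝ}

theorem noiseGain_nonneg (a : Fin n → ℝ) : 0 ≤ noiseGain B σu a :=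
  add_nonneg (dotProduct_self_nonneg' _) (mul_nonneg (sq_nonneg _) (dotProduct_self_nonneg' _))

theorem one_le_Psi : 1 ≤ Psi B := le_max_left _ _

theorem transpose_mulVec_input_le (a : Fin n → ℝ) :
    (Bᵀ *ᵥ a) ⬝ᵥ (Bᵀ *ᵥ a) ≤ Psi B ^ 2 * (a ⬝ᵥ a) := by
  refine (transpose_mulVec_bound (sq_nonneg (opNorm B)) (mulVec_dotProduct_self_le B) a).trans ?_
  have h1 : opNorm B ≤ Psi B := le_max_right _ _
  have := dotProduct_self_nonneg' a
  have := opNorm_nonneg B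
  gcongr

theorem mulVec_input_le (a : Fin m → ℝ) :
    (B *ᵥ a) ⬝ᵥ (B *ᵥ a) ≤ Psi B ^ 2 * (a ⬝ᵥ a) := by
  refine (mulVec_dotProduct_self_le B a).trans ?_
  have h1 : opNorm B ≤ Psi B := le_max_right _ _
  have := dotProduct_self_nonneg' a
  have := opNorm_nonneg B
  gcongr

theorem noiseGain_le (hσu : σu ^ 2 ≤ 1) (a : Fin n → ℝ) :
    noiseGain B σu a ≤ 2 * Psi B ^ 2 * (a ⬝ᵥ a) := by
  have h1 := transpose_mulVec_input_le (B := B) a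
  have h2 := dotProduct_self_nonneg' (Bᵀ *ᵥ a)
  have h3 := dotProduct_self_nonneg' a
  have h4 : 1 ≤ Psi B ^ 2 := one_le_pow₀ one_le_Psi
  unfold noiseGain
  nlinarith

theorem step_quadratic (j : ℕ) (a : Fin n → ℝ) :
    a ⬝ᵥ (F ^ j * (σu ^ 2 • (B * Bᵀ) + (1 : Matrix (Fin n) (Fin n) ℝ)) * (F ^ j)ᵀ) *ᵥ a
      = noiseGain B σu ((F ^ j)ᵀ *ᵥ a) := by
  rw [← Matrix.mulVec_mulVec, ← Matrix.mulVec_mulVec, ← dotProduct_mulVec_transpose,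
    Matrix.add_mulVec, Matrix.one_mulVec, dotProduct_add, Matrix.smul_mulVec, dotProduct_smul,
    ← Matrix.mulVec_mulVec, ← dotProduct_mulVec_transpose, noiseGain, smul_eq_mul, add_comm]

theorem noiseCov_quadratic (t : ℕ) (v : Fin n ⊕ Fin m → ℝ) :
    v ⬝ᵥ noiseCov F B σu t *ᵥ v
      = (t : ℝ)⁻¹ * ∑ s ∈ Finset.range (t - 1), ∑ j ∈ Finset.range (s + 1),
          noiseGain B σu ((F ^ j)ᵀ *ᵥ (v ∘ Sum.inl))
        + (v ∘ Sum.inr) ⬝ᵥ (v ∘ Sum.inr) := by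
  rw [noiseCov, Matrix.fromBlocks_mulVec, dotProduct_sum_type, Sum.elim_comp_inl,
    Sum.elim_comp_inr, Matrix.zero_mulVec, Matrix.zero_mulVec, Matrix.one_mulVec, add_zero,
    zero_add, Matrix.smul_mulVec, dotProduct_smul, smul_eq_mul, Matrix.sum_mulVec, dotProduct_sum]
  simp_rw [Matrix.sum_mulVec, dotProduct_sum, step_quadratic]

/-- The j = 0 terms alone give (t - 1)/t ≥ 1/2. As the input block is the identity, unscaled by σu,
positivity holds even for σu = 0. -/
theorem noiseCov_lower {t : ℕ} (ht : 2 ≤ t) (v : Fin n ⊕ Fin m → ℝ) :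
    1 / 2 * ((v ∘ Sum.inl) ⬝ᵥ (v ∘ Sum.inl)) + (v ∘ Sum.inr) ⬝ᵥ (v ∘ Sum.inr)
      ≤ v ⬝ᵥ noiseCov F B σu t *ᵥ v := by
  rw [noiseCov_quadratic]
  refine add_le_add ?_ le_rfl
  set a := v ∘ Sum.inl
  have ht0 : (0 : ℝ) < t := by exact_mod_cast (by omega : 0 < t)
  have h1 : ((t - 1 : ℕ) : ℝ) * (a ⬝ᵥ a) ≤ ∑ s ∈ Finset.range (t - 1), ∑ j ∈ Finset.range (s + 1),
      noiseGain B σu ((F ^ j)ᵀ *ᵥ a) := by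
    rw [← nsmul_eq_mul]
    conv_lhs => rw [← Finset.card_range (t - 1)]
    refine Finset.card_nsmul_le_sum _ _ _ fun s _ => ?_
    refine le_trans ?_ (Finset.single_le_sum
      (f := fun j => noiseGain B σu ((F ^ j)ᵀ *ᵥ a)) (fun _ _ => noiseGain_nonneg _)
      (Finset.mem_range.mpr (Nat.succ_pos s)))
    rw [pow_zero, Matrix.transpose_one, Matrix.one_mulVec, noiseGain]
    exact le_add_of_nonneg_right (mul_nonneg (sq_nonneg _) (dotProduct_self_nonneg' _))
  have h2 : (t : ℝ) ≤ 2 * ((t - 1 : ℕ) : ℝ) := by exact_mod_cast (by omega : t ≤ 2 * (t - 1))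
  rw [inv_mul_eq_div, le_div_iff₀ ht0]
  have := dotProduct_self_nonneg' a
  nlinarith

theorem noiseCov_isHermitian (t : ℕ) : (noiseCov F B σu t).IsHermitian := by
  refine Matrix.IsHermitian.fromBlocks ?_ (by simp) Matrix.isHermitian_one
  rw [Matrix.IsHermitian, Matrix.conjTranspose_eq_transpose_of_trivial, Matrix.transpose_smul,
    Matrix.transpose_sum]
  simp_rw [Matrix.transpose_sum]
  congr 1
  refine Finset.sum_congr rfl fun s _ => Finset.sum_congr rfl fun j _ => ?_
  simp [Matrix.transpose_mul, Matrix.mul_assoc]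

theorem noiseCov_posDef {t : ℕ} (ht : 2 ≤ t) : (noiseCov F B σu t).PosDef := by
  refine Matrix.PosDef.of_dotProduct_mulVec_pos (noiseCov_isHermitian t) fun v hv => ?_
  rw [star_trivial]
  have h := noiseCov_lower (F := F) (B := B) (σu := σu) ht v
  have h0 : 0 < v ⬝ᵥ v := by
    have := dotProduct_self_nonneg' v
    exact lt_of_le_of_ne this fun h => hv (dotProduct_self_eq_zero.mp h.symm)
  rw [dotProduct_sum_type] at h0
  have h1 := dotProduct_self_nonneg' (v ∘ Sum.inl)
  have h2 := dotProduct_self_nonneg' (v ∘ Sum.inr)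
  linarith

theorem sum_range_convolution {f : ℕ → ℝ} (t : ℕ) :
    ∑ s ∈ Finset.range t, ∑ r ∈ Finset.range s, f (s - 1 - r)
      = ∑ s ∈ Finset.range (t - 1), ∑ j ∈ Finset.range (s + 1), f j := by
  cases t with
  | zero => simp
  | succ t =>
    rw [Finset.sum_range_succ', Finset.sum_range_zero, add_zero, Nat.add_sub_cancel]
    exact Finset.sum_congr rfl fun s _ => Finset.sum_range_reflect f (s + 1)

/-- The squared entries of row s add up to the variance of its output; the state at time 0 contains
no noise, hence the range `t - 1` in `noiseCov`. -/
theorem respMat_trace {t : ℕ} (ht : 0 < t) (v : Fin n ⊕ Fin m → ℝ) :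
    ((respMat F B σu t v)ᵀ * respMat F B σu t v).trace = t * (v ⬝ᵥ noiseCov F B σu t *ᵥ v) := by
  have hrow : ∀ s r : Fin t, ∑ i, respMat F B σu t v s (r, i) ^ 2
      = (if (r : ℕ) < s then noiseGain B σu ((F ^ ((s : ℕ) - 1 - r))ᵀ *ᵥ (v ∘ Sum.inl)) else 0)
        + if r = s then (v ∘ Sum.inr) ⬝ᵥ (v ∘ Sum.inr) else 0 := fun s r => by
    rw [Fintype.sum_sum_type]
    simp only [respMat, Matrix.of_apply, Sum.elim_inl, Sum.elim_inr, respVec]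
    rcases lt_trichotomy (r : ℕ) (s : ℕ) with h | h | h
    · have hne : r ≠ s := fun e => by subst e; exact lt_irrefl _ h
      simp only [h, hne, if_true, if_false, add_zero, noiseGain, dotProduct,
        Finset.mul_sum, sq]
      congr 1
      exact Finset.sum_congr rfl fun _ _ => by ring
    · have he : r = s := Fin.ext h
      subst he
      simp [dotProduct, sq]
    · have hne : r ≠ s := fun e => by subst e; exact lt_irrefl _ h
      simp [h.not_gt, hne]
  have ht0 : (t : ℝ) ≠ 0 := by exact_mod_cast ht.ne'
  have e1 : ((respMat F B σu t v)ᵀ * respMat F B σu t v).trace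
      = ∑ s : Fin t, ∑ r : Fin t, ∑ i, respMat F B σu t v s (r, i) ^ 2 := by
    simp only [Matrix.trace, Matrix.diag, Matrix.mul_apply, Matrix.transpose_apply]
    rw [Finset.sum_comm]
    exact Finset.sum_congr rfl fun s _ => by
      rw [Fintype.sum_prod_type]
      exact Finset.sum_congr rfl fun r _ => Finset.sum_congr rfl fun i _ => (sq _).symm
  rw [e1, noiseCov_quadratic]
  simp_rw [hrow, Finset.sum_add_distrib]
  rw [mul_add, ← mul_assoc, mul_inv_cancel₀ ht0, one_mul,
    ← sum_range_convolution (f := fun j => noiseGain B σu ((F ^ j)ᵀ *ᵥ (v ∘ Sum.inl)))]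
  congr 1
  · rw [Finset.sum_range]
    refine Finset.sum_congr rfl fun s _ => ?_
    rw [Fin.sum_univ_eq_sum_range (fun r => if r < (s : ℕ) then
      noiseGain B σu ((F ^ ((s : ℕ) - 1 - r))ᵀ *ᵥ (v ∘ Sum.inl)) else 0) t, ← Finset.sum_filter]
    refine Finset.sum_congr ?_ fun _ _ => rfl
    ext r
    simp only [Finset.mem_filter, Finset.mem_range]
    have := s.2
    omega
  · simp

theorem respMat_mulVec (t : ℕ) (v : Fin n ⊕ Fin m → ℝ) (η : ℕ → Fin n ⊕ Fin m → ℝ) (s : Fin t) :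
    (respMat F B σu t v *ᵥ fun p => η p.1 p.2) s
      = (v ∘ Sum.inl) ⬝ᵥ noiseState F B σu η s + (v ∘ Sum.inr) ⬝ᵥ fun j => η s (Sum.inr j) := by
  have hr : ∀ r : Fin t, ∑ i, respMat F B σu t v s (r, i) * η r i
      = (if (r : ℕ) < s then (v ∘ Sum.inl) ⬝ᵥ F ^ ((s : ℕ) - 1 - r) *ᵥ
          ((fun i => η r (Sum.inl i)) + σu • B *ᵥ fun j => η r (Sum.inr j)) else 0)
        + if r = s then (v ∘ Sum.inr) ⬝ᵥ fun j => η s (Sum.inr j) else 0 := fun r => by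
    have e : respVec F (v ∘ Sum.inl) s r ⬝ᵥ
        ((fun i => η r (Sum.inl i)) + σu • B *ᵥ fun j => η r (Sum.inr j))
        = if (r : ℕ) < s then (v ∘ Sum.inl) ⬝ᵥ F ^ ((s : ℕ) - 1 - r) *ᵥ
          ((fun i => η r (Sum.inl i)) + σu • B *ᵥ fun j => η r (Sum.inr j)) else 0 := by
      rw [respVec]
      split_ifs
      · rw [dotProduct_mulVec_transpose]
      · rw [zero_dotProduct]
    rw [← e, dotProduct_add, dotProduct_smul, ← dotProduct_mulVec_transpose,
      Fintype.sum_sum_type]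
    simp only [respMat, Matrix.of_apply, Sum.elim_inl, Sum.elim_inr, add_mul,
      Finset.sum_add_distrib, smul_eq_mul]
    rw [add_assoc]
    congr 1
    congr 1
    · rw [dotProduct, Finset.mul_sum]
      exact Finset.sum_congr rfl fun _ _ => by ring
    · split_ifs with h
      · subst h; rfl
      · simp
  rw [Matrix.mulVec, dotProduct, Fintype.sum_prod_type]
  simp_rw [hr, Finset.sum_add_distrib]
  congr 1
  · rw [noiseState, dotProduct_sum, Fin.sum_univ_eq_sum_range (fun r => if r < (s : ℕ) then
      (v ∘ Sum.inl) ⬝ᵥ F ^ ((s : ℕ) - 1 - r) *ᵥ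
          ((fun i => η r (Sum.inl i)) + σu • B *ᵥ fun j => η r (Sum.inr j)) else 0) t,
      ← Finset.sum_filter]
    refine Finset.sum_congr ?_ fun _ _ => rfl
    ext r
    simp only [Finset.mem_filter, Finset.mem_range]
    have := s.2
    omega
  · simp

end Covariance

/-! ### Operator norm bounds. -/

section Bounds

variable {n m : ℕ} [NeZero n] {A : Matrix (Fin n) (Fin n) ℝ} {B : Matrix (Fin n) (Fin m) ℝ}
  {Q : Matrix (Fin n) (Fin n) ℝ} {K : Matrix (Fin m) (Fin n) ℝ} {σu : ℝ}

/-- Noise reaches the output through the kernel √(p(1 - 1/p)^j), so Young's convolution inequality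
gives 4p³. Splitting the state and input parts of the output costs a factor 2, and the energy
injected by the noise another 2Ψ². -/
theorem respMat_bound (hQ : (Q - 1).PosSemidef) (hst : IsStable (A + B * K)) (hσu : σu ^ 2 ≤ 1)
    (t : ℕ) (v : Fin n ⊕ Fin m → ℝ) (y : Fin t × (Fin n ⊕ Fin m) → ℝ) :
    (respMat (A + B * K) B σu t v *ᵥ y) ⬝ᵥ (respMat (A + B * K) B σu t v *ᵥ y)
      ≤ 16 * opNorm (lyapP A B Q K) ^ 3 * Psi B ^ 2 * (v ⬝ᵥ v) * (y ⬝ᵥ y) := by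
  set p := opNorm (lyapP A B Q K) with hp
  have hp1 : 1 ≤ p := one_le_opNorm_lyapP hQ hst
  have hρ : 0 ≤ 1 - 1 / p := by
    rw [sub_nonneg, div_le_one (by linarith)]; exact hp1
  -- Extension by zero beyond the horizon, to use the convolution form on all of ℕ.
  set η : ℕ → Fin n ⊕ Fin m → ℝ := fun r i => if h : r < t then y (⟨r, h⟩, i) else 0 with hη
  have hy : y = fun p => η p.1 p.2 := by
    funext p
    simp [hη]
  set a := v ∘ Sum.inl
  set b := v ∘ Sum.inr
  set e : ℕ → Fin n → ℝ := fun r =>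
    (fun i => η r (Sum.inl i)) + σu • B *ᵥ fun j => η r (Sum.inr j) with he
  set g : ℕ → Fin m → ℝ := fun r j => η r (Sum.inr j) with hg
  set k : ℕ → ℝ := fun j => √(p * (1 - 1 / p) ^ j) with hk
  have he_le : ∀ r, e r ⬝ᵥ e r ≤ 2 * Psi B ^ 2 * (η r ⬝ᵥ η r) := fun r => by
    have h1 : e r ⬝ᵥ e r ≤ 2 * ((fun i => η r (Sum.inl i)) ⬝ᵥ (fun i => η r (Sum.inl i)))
        + 2 * (σu ^ 2 * ((B *ᵥ g r) ⬝ᵥ (B *ᵥ g r))) := by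
      simp only [dotProduct, Finset.mul_sum, ← Finset.sum_add_distrib]
      refine Finset.sum_le_sum fun i _ => ?_
      simp only [he, Pi.add_apply, Pi.smul_apply, smul_eq_mul]
      nlinarith [sq_nonneg (η r (Sum.inl i) - σu * (B *ᵥ g r) i)]
    have h2 := mulVec_input_le (B := B) (g r)
    have h3 : 1 ≤ Psi B ^ 2 := one_le_pow₀ one_le_Psi
    have h4 := dotProduct_self_nonneg' (B *ᵥ g r)
    have h5 := dotProduct_self_nonneg' (fun i => η r (Sum.inl i))
    rw [dotProduct_sum_type (η r)]
    change _ ≤ 2 * Psi B ^ 2 * ((fun i => η r (Sum.inl i)) ⬝ᵥ (fun i => η r (Sum.inl i))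
      + g r ⬝ᵥ g r)
    nlinarith
  have hconv : ∀ s, (a ⬝ᵥ noiseState (A + B * K) B σu η s) ^ 2
      ≤ (a ⬝ᵥ a) * (∑ r ∈ Finset.range s, k (s - 1 - r) * √(e r ⬝ᵥ e r)) ^ 2 := fun s => by
    have h1 : ∀ r, |a ⬝ᵥ (A + B * K) ^ (s - 1 - r) *ᵥ e r|
        ≤ √(a ⬝ᵥ a) * (k (s - 1 - r) * √(e r ⬝ᵥ e r)) := fun r => by
      rw [hk, ← Real.sqrt_mul (mul_nonneg (by linarith) (pow_nonneg hρ _)),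
        ← Real.sqrt_mul (dotProduct_self_nonneg' a)]
      refine Real.abs_le_sqrt ((dotProduct_sq_le _ _).trans ?_)
      refine mul_le_mul_of_nonneg_left ?_ (dotProduct_self_nonneg' a)
      have := pow_mulVec_decay hQ hst (e r) (s - 1 - r)
      linarith [dotProduct_self_nonneg' (K *ᵥ ((A + B * K) ^ (s - 1 - r) *ᵥ e r))]
    rw [noiseState, dotProduct_sum]
    have h2 : |∑ r ∈ Finset.range s, a ⬝ᵥ (A + B * K) ^ (s - 1 - r) *ᵥ e r|
        ≤ √(a ⬝ᵥ a) * ∑ r ∈ Finset.range s, k (s - 1 - r) * √(e r ⬝ᵥ e r) := by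
      rw [Finset.mul_sum]
      exact (Finset.abs_sum_le_sum_abs _ _).trans (Finset.sum_le_sum fun r _ => h1 r)
    calc (∑ r ∈ Finset.range s, a ⬝ᵥ (A + B * K) ^ (s - 1 - r) *ᵥ e r) ^ 2
        = |∑ r ∈ Finset.range s, a ⬝ᵥ (A + B * K) ^ (s - 1 - r) *ᵥ e r| ^ 2 := (sq_abs _).symm
      _ ≤ (√(a ⬝ᵥ a) * ∑ r ∈ Finset.range s, k (s - 1 - r) * √(e r ⬝ᵥ e r)) ^ 2 := by
          gcongr
      _ = _ := by rw [mul_pow, Real.sq_sqrt (dotProduct_self_nonneg' a)]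
  have hyoung := sum_sq_convolution_le (k := k) (y := fun r => √(e r ⬝ᵥ e r))
    (fun _ => Real.sqrt_nonneg _) (sum_sqrt_geometric_le hp1) t
  have hc : (2 * p * √p) ^ 2 = 4 * p ^ 3 := by
    rw [mul_pow, Real.sq_sqrt (by linarith)]; ring
  rw [hc] at hyoung
  simp only [Real.sq_sqrt (dotProduct_self_nonneg' _)] at hyoung
  have hyy : y ⬝ᵥ y = ∑ r ∈ Finset.range t, η r ⬝ᵥ η r := by
    rw [Finset.sum_range, dotProduct, Fintype.sum_prod_type, hy]
    rfl
  have hMy : (respMat (A + B * K) B σu t v *ᵥ y) ⬝ᵥ (respMat (A + B * K) B σu t v *ᵥ y)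
      = ∑ s ∈ Finset.range t, (a ⬝ᵥ noiseState (A + B * K) B σu η s + b ⬝ᵥ g s) ^ 2 := by
    rw [Finset.sum_range, dotProduct]
    refine Finset.sum_congr rfl fun s _ => ?_
    rw [hy, respMat_mulVec, sq]
  rw [hMy, hyy]
  have hv := dotProduct_sum_type v v
  have ha0 := dotProduct_self_nonneg' a
  have hb0 := dotProduct_self_nonneg' b
  have hS0 : 0 ≤ ∑ r ∈ Finset.range t, η r ⬝ᵥ η r :=
    Finset.sum_nonneg fun _ _ => dotProduct_self_nonneg' _
  have hp3 : 1 ≤ p ^ 3 := one_le_pow₀ hp1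
  have hΨ : 1 ≤ Psi B ^ 2 := one_le_pow₀ one_le_Psi
  calc ∑ s ∈ Finset.range t, (a ⬝ᵥ noiseState (A + B * K) B σu η s + b ⬝ᵥ g s) ^ 2
      ≤ ∑ s ∈ Finset.range t, (2 * ((a ⬝ᵥ a) *
          (∑ r ∈ Finset.range s, k (s - 1 - r) * √(e r ⬝ᵥ e r)) ^ 2)
            + 2 * ((b ⬝ᵥ b) * (η s ⬝ᵥ η s))) := by
        refine Finset.sum_le_sum fun s _ => ?_
        have h1 := hconv s
        have h2 := dotProduct_sq_le b (g s)
        have h3 : g s ⬝ᵥ g s ≤ η s ⬝ᵥ η s := by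
          rw [dotProduct_sum_type (η s)]
          exact le_add_of_nonneg_left (dotProduct_self_nonneg' _)
        have h4 := mul_le_mul_of_nonneg_left h3 hb0
        nlinarith [sq_nonneg (a ⬝ᵥ noiseState (A + B * K) B σu η s - b ⬝ᵥ g s)]
    _ = 2 * ((a ⬝ᵥ a) * ∑ s ∈ Finset.range t,
          (∑ r ∈ Finset.range s, k (s - 1 - r) * √(e r ⬝ᵥ e r)) ^ 2)
            + 2 * ((b ⬝ᵥ b) * ∑ s ∈ Finset.range t, η s ⬝ᵥ η s) := by
        simp only [Finset.sum_add_distrib, Finset.mul_sum]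
    _ ≤ 2 * ((a ⬝ᵥ a) * (4 * p ^ 3 * ∑ r ∈ Finset.range t, 2 * Psi B ^ 2 * (η r ⬝ᵥ η r)))
            + 2 * ((b ⬝ᵥ b) * ∑ s ∈ Finset.range t, η s ⬝ᵥ η s) := by
        gcongr
        refine hyoung.trans ?_
        gcongr with r _
        exact he_le r
    _ = 16 * p ^ 3 * Psi B ^ 2 * (a ⬝ᵥ a) * (∑ s ∈ Finset.range t, η s ⬝ᵥ η s)
            + 2 * (b ⬝ᵥ b) * ∑ s ∈ Finset.range t, η s ⬝ᵥ η s := by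
        rw [← Finset.mul_sum]; ring
    _ ≤ 16 * p ^ 3 * Psi B ^ 2 * (v ⬝ᵥ v) * ∑ s ∈ Finset.range t, η s ⬝ᵥ η s := by
        rw [hv, ← add_mul]
        gcongr
        have h1 : 1 ≤ p ^ 3 * Psi B ^ 2 := one_le_mul_of_one_le_of_one_le hp3 hΨ
        have h2 : 2 * (b ⬝ᵥ b) ≤ 16 * (p ^ 3 * Psi B ^ 2) * (b ⬝ᵥ b) := by
          gcongr; linarith
        calc _ ≤ 16 * p ^ 3 * Psi B ^ 2 * (a ⬝ᵥ a) + 16 * (p ^ 3 * Psi B ^ 2) * (b ⬝ᵥ b) := by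
              linarith
          _ = 16 * p ^ 3 * Psi B ^ 2 * (a ⬝ᵥ a + b ⬝ᵥ b) := by ring

-- Since u = Kx + σu g, the functional v of (x, u) is a functional of (x, g) with components v₁ +
-- Kᵀv₂ and σu v₂. Concentration can thus be proved for `noiseCov`, which is always definite, and
-- transferred.
omit [NeZero n] in
theorem avgCov_quadratic (t : ℕ) (v : Fin n ⊕ Fin m → ℝ) :
    v ⬝ᵥ avgCov A B K σu t *ᵥ v
      = Sum.elim (v ∘ Sum.inl + Kᵀ *ᵥ (v ∘ Sum.inr)) (σu • (v ∘ Sum.inr)) ⬝ᵥ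
          noiseCov (A + B * K) B σu t *ᵥ
        Sum.elim (v ∘ Sum.inl + Kᵀ *ᵥ (v ∘ Sum.inr)) (σu • (v ∘ Sum.inr)) := by
  rw [noiseCov_quadratic, Sum.elim_comp_inl, Sum.elim_comp_inr, avgCov, Matrix.add_mulVec,
    dotProduct_add, Matrix.smul_mulVec, dotProduct_smul, smul_eq_mul, Matrix.sum_mulVec,
    dotProduct_sum]
  congr 1
  · congr 1
    refine Finset.sum_congr rfl fun s _ => ?_
    rw [Matrix.sum_mulVec, dotProduct_sum]
    refine Finset.sum_congr rfl fun j _ => ?_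
    have e : (fromRows (1 : Matrix (Fin n) (Fin n) ℝ) K)ᵀ *ᵥ v
        = v ∘ Sum.inl + Kᵀ *ᵥ (v ∘ Sum.inr) := by
      rw [Matrix.transpose_fromRows, Matrix.transpose_one, Matrix.fromCols_mulVec,
        Matrix.one_mulVec]
    rw [← step_quadratic, ← e, dotProduct_mulVec_transpose, Matrix.mulVec_mulVec,
      Matrix.mulVec_mulVec]
    simp only [Matrix.mul_assoc]
  · rw [Matrix.fromBlocks_mulVec, dotProduct_sum_type, Sum.elim_comp_inl, Sum.elim_comp_inr,
      Matrix.zero_mulVec, Matrix.zero_mulVec, Matrix.zero_mulVec, Matrix.smul_mulVec,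
      Matrix.one_mulVec]
    simp only [add_zero, dotProduct_zero, zero_add, smul_eq_mul, dotProduct_smul, smul_dotProduct]
    ring

theorem avgCov_upper (hQ : (Q - 1).PosSemidef) (hst : IsStable (A + B * K)) (hσu : σu ^ 2 ≤ 1)
    (t : ℕ) (v : Fin n ⊕ Fin m → ℝ) :
    v ⬝ᵥ avgCov A B K σu t *ᵥ v
      ≤ 3 * opNorm (lyapP A B Q K) ^ 2 * Psi B ^ 2 * (v ⬝ᵥ v) := by
  set p := opNorm (lyapP A B Q K) with hp
  have hp1 : 1 ≤ p := one_le_opNorm_lyapP hQ hst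
  have hρ : 0 ≤ 1 - 1 / p := by
    rw [sub_nonneg, div_le_one (by linarith)]; exact hp1
  have hv0 := dotProduct_self_nonneg' v
  set a := v ∘ Sum.inl + Kᵀ *ᵥ (v ∘ Sum.inr) with ha
  have hdec : ∀ j, (((A + B * K) ^ j)ᵀ *ᵥ a) ⬝ᵥ (((A + B * K) ^ j)ᵀ *ᵥ a)
      ≤ p * (1 - 1 / p) ^ j * (v ⬝ᵥ v) := fun j => by
    set y := ((A + B * K) ^ j)ᵀ *ᵥ a with hy
    -- Duality again: `pow_mulVec_decay` bounds [I; K]A_K^j, while the transpose is needed here.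
    refine le_of_sq_le_mul
      (mul_nonneg (mul_nonneg (by linarith) (pow_nonneg hρ _)) hv0) ?_
    have e : y ⬝ᵥ y = v ⬝ᵥ Sum.elim ((A + B * K) ^ j *ᵥ y) (K *ᵥ ((A + B * K) ^ j *ᵥ y)) := by
      conv_lhs => rw [hy, dotProduct_mulVec_transpose]
      rw [dotProduct_sum_type v, Sum.elim_comp_inl, Sum.elim_comp_inr, ha, add_dotProduct,
        dotProduct_mulVec_transpose]
    have h := dotProduct_sq_le v (Sum.elim ((A + B * K) ^ j *ᵥ y) (K *ᵥ ((A + B * K) ^ j *ᵥ y)))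
    rw [← e, dotProduct_sum_type (Sum.elim _ _), Sum.elim_comp_inl, Sum.elim_comp_inr] at h
    have h2 := mul_le_mul_of_nonneg_left (pow_mulVec_decay hQ hst y j) hv0
    calc (y ⬝ᵥ y) ^ 2 ≤ _ := h.trans h2
      _ = _ := by ring
  rw [avgCov_quadratic, noiseCov_quadratic, Sum.elim_comp_inl, Sum.elim_comp_inr]
  have hΨ : 1 ≤ Psi B ^ 2 := one_le_pow₀ one_le_Psi
  have hp2 : 1 ≤ p ^ 2 := one_le_pow₀ hp1
  have h1 : ∀ s ∈ Finset.range (t - 1), ∑ j ∈ Finset.range (s + 1),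
      noiseGain B σu (((A + B * K) ^ j)ᵀ *ᵥ a) ≤ 2 * p ^ 2 * Psi B ^ 2 * (v ⬝ᵥ v) := fun s _ => by
    calc ∑ j ∈ Finset.range (s + 1), noiseGain B σu (((A + B * K) ^ j)ᵀ *ᵥ a)
        ≤ ∑ j ∈ Finset.range (s + 1), 2 * Psi B ^ 2 * (p * (1 - 1 / p) ^ j * (v ⬝ᵥ v)) := by
          refine Finset.sum_le_sum fun j _ => (noiseGain_le hσu _).trans ?_
          gcongr
          exact hdec j
      _ = 2 * Psi B ^ 2 * p * (v ⬝ᵥ v) * ∑ j ∈ Finset.range (s + 1), (1 - 1 / p) ^ j := by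
          rw [Finset.mul_sum]
          exact Finset.sum_congr rfl fun _ _ => by ring
      _ ≤ 2 * Psi B ^ 2 * p * (v ⬝ᵥ v) * p := by
          gcongr
          exact sum_geometric_le hp1 _
      _ = _ := by ring
  have h2 : (t : ℝ)⁻¹ * ∑ s ∈ Finset.range (t - 1), ∑ j ∈ Finset.range (s + 1),
      noiseGain B σu (((A + B * K) ^ j)ᵀ *ᵥ a) ≤ 2 * p ^ 2 * Psi B ^ 2 * (v ⬝ᵥ v) := by
    have h3 := Finset.sum_le_card_nsmul _ _ _ h1
    rw [Finset.card_range, nsmul_eq_mul] at h3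
    have hD : 0 ≤ 2 * p ^ 2 * Psi B ^ 2 * (v ⬝ᵥ v) := by positivity
    rcases Nat.eq_zero_or_pos t with rfl | ht
    · simpa using hD
    · have ht0 : (0 : ℝ) < t := by exact_mod_cast ht
      rw [inv_mul_le_iff₀ ht0]
      refine h3.trans (mul_le_mul_of_nonneg_right ?_ hD)
      exact_mod_cast Nat.sub_le t 1
  have h4 : (σu • (v ∘ Sum.inr)) ⬝ᵥ (σu • (v ∘ Sum.inr)) ≤ p ^ 2 * Psi B ^ 2 * (v ⬝ᵥ v) := by
    have h5 : (v ∘ Sum.inr) ⬝ᵥ (v ∘ Sum.inr) ≤ v ⬝ᵥ v := by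
      rw [dotProduct_sum_type v]
      exact le_add_of_nonneg_left (dotProduct_self_nonneg' _)
    rw [smul_dotProduct, dotProduct_smul, smul_eq_mul, smul_eq_mul, ← mul_assoc, ← sq]
    refine mul_le_mul (hσu.trans (one_le_mul_of_one_le_of_one_le hp2 hΨ)) h5
      (dotProduct_self_nonneg' _) (by positivity)
  calc _ ≤ 2 * p ^ 2 * Psi B ^ 2 * (v ⬝ᵥ v) + p ^ 2 * Psi B ^ 2 * (v ⬝ᵥ v) := add_le_add h2 h4
    _ = _ := by ring

end Bounds

/-! ### Second moments and variance proxies. -/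

section Moments

variable {Ω : Type*} [MeasurableSpace Ω] {μ : Measure Ω} [IsProbabilityMeasure μ]

theorem one_add_half_sq_le_cosh (x : ℝ) : 1 + x ^ 2 / 2 ≤ Real.cosh x := by
  have h := (Real.hasSum_cosh x).summable.sum_le_tsum (Finset.range 2) fun i _ => by
    have : x ^ (2 * i) = (x ^ i) ^ 2 := by rw [← pow_mul, mul_comm]
    rw [this]; positivity
  rw [(Real.hasSum_cosh x).tsum_eq] at h
  simpa [Finset.sum_range_succ] using h

/-- The variance proxy of a sub-Gaussian variable is at least its second moment. -/
theorem one_le_of_hasSubgaussianMGF {X : Ω → ℝ} {k : ℝ≥0} (h : HasSubgaussianMGF X k μ)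
    (hvar : ∫ ω, X ω * X ω ∂μ = 1) : 1 ≤ k := by
  by_contra hlt
  push Not at hlt
  have hk1 : (k : ℝ) < 1 := by exact_mod_cast hlt
  have hk0 : (0 : ℝ) ≤ k := k.2
  -- Averaging cosh y ≥ 1 + y²/2 at y = √(2u)·X gives 1 + u ≤ exp(ku), so 1 ≤ k + 2k²u. For this u
  -- and k < 1 the right side is at most k + (1 - k)/2 < 1.
  set u : ℝ := (1 - k) / 4 with hu
  have hu0 : 0 < u := by rw [hu]; linarith
  set r : ℝ := √(2 * u) with hr
  have hr2 : r ^ 2 = 2 * u := Real.sq_sqrt (by linarith)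
  have hint2 : Integrable (fun ω => X ω * X ω) μ := by
    have h := (h.memLp 2).integrable_sq
    simpa [sq] using h
  have h1 := h.mgf_le r
  have h2 := h.mgf_le (-r)
  have i1 := h.integrable_exp_mul r
  have i2 := h.integrable_exp_mul (-r)
  rw [mgf] at h1 h2
  rw [neg_sq] at h2
  have h3 : ∫ ω, (2 + r ^ 2 * (X ω * X ω)) ∂μ
      ≤ ∫ ω, (Real.exp (r * X ω) + Real.exp (-r * X ω)) ∂μ := by
    refine integral_mono ((integrable_const 2).add (hint2.const_mul _)) (i1.add i2) fun ω => ?_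
    have := one_add_half_sq_le_cosh (r * X ω)
    rw [Real.cosh_eq, ← neg_mul] at this
    simp only
    nlinarith
  rw [integral_add (integrable_const 2) (hint2.const_mul _), integral_const_mul, hvar,
    integral_add i1 i2, integral_const, probReal_univ, one_smul, mul_one, hr2] at h3
  have h4 : (k : ℝ) * r ^ 2 / 2 = k * u := by rw [hr2]; ring
  rw [h4] at h1 h2
  have h5 := exp_le_one_add_add_sq_mul_exp_abs (k * u)
  have hku : 0 ≤ k * u := mul_nonneg hk0 hu0.le
  have h6 : Real.exp |k * u| ≤ 2 := by
    rw [abs_of_nonneg hku]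
    have h7 : k * u ≤ 5 / 8 := by nlinarith
    have := (Real.exp_le_exp.mpr h7).trans exp_half_le
    linarith
  have h8 : (k * u) ^ 2 * Real.exp |k * u| ≤ (k * u) ^ 2 * 2 := by gcongr
  have h9 : u ≤ k * u + (k * u) ^ 2 * 2 := by linarith
  have h10 : 1 ≤ k + k ^ 2 * u * 2 := by
    have : u * 1 ≤ u * (k + k ^ 2 * u * 2) := by linarith
    exact le_of_mul_le_mul_left this hu0
  have h11 : (k : ℝ) ^ 2 ≤ 1 := pow_le_one₀ hk0 hk1.le
  nlinarith

-- Applied with k = σ² ≥ 1, this gives process and exploration noise a common variance proxy.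
omit [IsProbabilityMeasure μ] in
theorem hasSubgaussianMGF_of_map_eq_gaussian {X : Ω → ℝ} {k : ℝ≥0} (hX : Measurable X)
    (h : μ.map X = gaussianReal 0 1) (hk : 1 ≤ k) : HasSubgaussianMGF X k μ := by
  rw [← HasSubgaussianMGF.id_map_iff hX.aemeasurable, h]
  refine ⟨fun r => integrable_exp_mul_gaussianReal r, fun r => ?_⟩
  rw [mgf_id_gaussianReal]
  refine Real.exp_le_exp.mpr ?_
  have hk1 : (1 : ℝ) ≤ k := by exact_mod_cast hk
  simp only [zero_mul, zero_add, NNReal.coe_one]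
  gcongr

omit [IsProbabilityMeasure μ] in
theorem integral_mul_self_of_map_eq_gaussian {X : Ω → ℝ} (hX : Measurable X)
    (h : μ.map X = gaussianReal 0 1) : ∫ ω, X ω * X ω ∂μ = 1 := by
  have h1 : ∫ ω, X ω * X ω ∂μ = ∫ y, y * y ∂(μ.map X) :=
    (integral_map (f := fun y : ℝ => y * y) hX.aemeasurable
      (measurable_id.mul measurable_id).aestronglyMeasurable).symm
  have h2 := variance_eq_integral (μ := gaussianReal 0 1) (X := fun y : ℝ => y) (by fun_prop)
  rw [variance_fun_id_gaussianReal] at h2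
  rw [h1, h]
  simpa [sq] using h2.symm

end Moments

/-! ### The exponential supermartingale. -/

section Martingale

variable {Ω : Type*} [MeasurableSpace Ω] {μ : Measure Ω} [IsProbabilityMeasure μ] {n m : ℕ}

/-- `H s` depends only on the noise before time `s` and on the exploration noise at time `s`. -/
def IsCausal (H : ℕ → (ℕ × (Fin n ⊕ Fin m) → ℝ) → Fin n → ℝ) : Prop :=
  ∀ s η η', (∀ r < s, ∀ i, η (r, i) = η' (r, i)) →
    (∀ j, η (s, Sum.inr j) = η' (s, Sum.inr j)) → H s η = H s η'

/-- Exponential supermartingale bound for the transform of sub-Gaussian noise by a predictable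
sequence. -/
theorem lintegral_exp_martingale_le {η : ℕ × (Fin n ⊕ Fin m) → Ω → ℝ} {k : ℝ≥0}
    (hη : ∀ p, Measurable (η p)) (hind : iIndepFun η μ)
    (hsub : ∀ s i, HasSubgaussianMGF (η (s, Sum.inl i)) k μ)
    {H : ℕ → (ℕ × (Fin n ⊕ Fin m) → ℝ) → Fin n → ℝ} (hH : ∀ s, Measurable (H s))
    (hcausal : IsCausal H) (t : ℕ) :
    ∫⁻ ω, ENNReal.ofReal (Real.exp (∑ s ∈ Finset.range t,
      (∑ i, H s (fun p => η p ω) i * η (s, Sum.inl i) ω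
        - k / 2 * ∑ i, H s (fun p => η p ω) i ^ 2))) ∂μ ≤ 1 := by
  classical
  have hHi : ∀ s i, Measurable fun e => H s e i := fun s i => (measurable_pi_apply i).comp (hH s)
  induction t with
  | zero => simp
  | succ t ih =>
    -- T indexes what is known before the process noise at time t acts: all earlier noise, and the
    -- exploration noise at time t, since the input at time t uses it. S indexes the fresh process
    -- noise.
    set T : Finset (ℕ × (Fin n ⊕ Fin m)) :=
      Finset.range t ×ˢ Finset.univ ∪ {t} ×ˢ Finset.univ.image Sum.inr with hT
    set S : Finset (ℕ × (Fin n ⊕ Fin m)) := {t} ×ˢ Finset.univ.image Sum.inl with hS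
    have hdis : Disjoint T S := by
      rw [Finset.disjoint_left]
      rintro ⟨r, i⟩ h1 h2
      simp only [hT, hS, Finset.mem_union, Finset.mem_product, Finset.mem_range, Finset.mem_univ,
        and_true, Finset.mem_singleton, Finset.mem_image, true_and] at h1 h2
      obtain ⟨rfl, a, rfl⟩ := h2
      rcases h1 with h1 | ⟨-, b, hb⟩
      · exact lt_irrefl _ h1
      · exact absurd hb (by simp)
    have hmemS : ∀ i, (t, Sum.inl i) ∈ S := fun i => by simp [hS]
    -- The value 0 off T is immaterial: by causality the transform up to time t reads only
    -- coordinates in T.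
    let mask : (↥T → ℝ) → ℕ × (Fin n ⊕ Fin m) → ℝ := fun y p => if h : p ∈ T then y ⟨p, h⟩ else 0
    have hmask : Measurable mask := by
      refine measurable_pi_lambda _ fun p => ?_
      by_cases h : p ∈ T
      · simp only [mask, h, dif_pos]; exact measurable_pi_apply _
      · simp only [mask, h, dif_neg, not_false_eq_true]; exact measurable_const
    let pick : (↥S → ℝ) → Fin n → ℝ := fun y i => y ⟨(t, Sum.inl i), hmemS i⟩
    have hpick : Measurable pick := measurable_pi_lambda _ fun i => measurable_pi_apply _
    have hUW := (hind.indepFun_finset T S hdis hη).comp hmask hpick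
    set U : Ω → ℕ × (Fin n ⊕ Fin m) → ℝ := mask ∘ fun ω (i : ↥T) => η i ω with hU
    set W : Ω → Fin n → ℝ := pick ∘ fun ω (i : ↥S) => η i ω with hW
    have hUm : Measurable U := hmask.comp (measurable_pi_lambda _ fun p => hη p)
    have hWm : Measurable W := hpick.comp (measurable_pi_lambda _ fun p => hη p)
    have hUT : ∀ ω, ∀ p ∈ T, U ω p = η p ω := fun ω p hp => by
      simp only [hU, Function.comp_apply, mask, hp, dif_pos]
    have hUpast : ∀ ω, ∀ r < t, ∀ i, η (r, i) ω = U ω (r, i) := fun ω r hr i =>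
      (hUT ω _ (by simp [hT, hr])).symm
    have hUnow : ∀ ω, ∀ j, η (t, Sum.inr j) ω = U ω (t, Sum.inr j) := fun ω j =>
      (hUT ω _ (by simp [hT])).symm
    have hHt : ∀ ω, H t (fun p => η p ω) = H t (U ω) := fun ω =>
      hcausal t _ _ (hUpast ω) (hUnow ω)
    have hHs : ∀ ω, ∀ s < t, H s (fun p => η p ω) = H s (U ω) := fun ω s hs =>
      hcausal s _ _ (fun r hr i => hUpast ω r (hr.trans hs) i) (fun j => hUpast ω s hs _)
    let G : (ℕ × (Fin n ⊕ Fin m) → ℝ) → ℝ := fun e => ∑ s ∈ Finset.range t,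
      (∑ i, H s e i * e (s, Sum.inl i) - k / 2 * ∑ i, H s e i ^ 2)
    have hG : Measurable G := by fun_prop
    have hGU : ∀ ω, ∑ s ∈ Finset.range t,
      (∑ i, H s (fun p => η p ω) i * η (s, Sum.inl i) ω
        - k / 2 * ∑ i, H s (fun p => η p ω) i ^ 2) = G (U ω) := fun ω => by
      refine Finset.sum_congr rfl fun s hs => ?_
      have hs' := Finset.mem_range.mp hs
      rw [hHs ω s hs']
      simp_rw [hUpast ω s hs']
    have hMGF := lintegral_exp_sum_le (μ := μ) (η := fun i : Fin n => η (t, Sum.inl i))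
      (hind.precomp (g := fun i : Fin n => (t, Sum.inl i)) fun a b hab => by simpa using hab)
      (hsub t)
    -- The compensator of step t is put into F, where it cancels exactly the factor produced by
    -- integrating out W.
    have key := lintegral_mul_exp_le hUW hUm hWm hMGF
      (F := fun e => ENNReal.ofReal (Real.exp (G e - k / 2 * ∑ i, H t e i ^ 2)))
      (by fun_prop) (hH t)
    simp_rw [hGU] at ih
    refine le_trans (le_of_eq (lintegral_congr fun ω => ?_)) (key.trans
      (le_trans (le_of_eq (lintegral_congr fun ω => ?_)) ih))
    · rw [Finset.sum_range_succ, hGU, hHt, ← ENNReal.ofReal_mul (Real.exp_pos _).le,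
        ← Real.exp_add]
      congr 2
      have : ∀ i, W ω i = η (t, Sum.inl i) ω := fun i => rfl
      simp_rw [this]
      ring
    · rw [← ENNReal.ofReal_mul (Real.exp_pos _).le, ← Real.exp_add]
      congr 2
      ring

end Martingale

/-! ### The rollout as a function of initial state and noise. -/

section Rollout

variable {Ω : Type*} [MeasurableSpace Ω] {μ : Measure Ω} [IsProbabilityMeasure μ] {n m : ℕ}
  {A : Matrix (Fin n) (Fin n) ℝ} {B : Matrix (Fin n) (Fin m) ℝ} {K : Matrix (Fin m) (Fin n) ℝ}
  {σu : ℝ} {σ : ℝ≥0} {x : ℕ → Ω → Fin n → ℝ} {u : ℕ → Ω → Fin m → ℝ}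
  {w : ℕ → Ω → Fin n → ℝ} {g : ℕ → Ω → Fin m → ℝ}

/-- All noise coordinates as one family. -/
def noise (w : ℕ → Ω → Fin n → ℝ) (g : ℕ → Ω → Fin m → ℝ) (p : ℕ × (Fin n ⊕ Fin m)) (ω : Ω) : ℝ :=
  Sum.elim (w p.1 ω) (g p.1 ω) p.2

/-- The regressor `[x_s; u_s]` as a function of the initial state and the noise. -/
def regressor (A : Matrix (Fin n) (Fin n) ℝ) (B : Matrix (Fin n) (Fin m) ℝ)
    (K : Matrix (Fin m) (Fin n) ℝ) (σu : ℝ) (s : ℕ) (x₀ : Fin n → ℝ)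
    (e : ℕ × (Fin n ⊕ Fin m) → ℝ) : Fin n ⊕ Fin m → ℝ :=
  Sum.elim ((A + B * K) ^ s *ᵥ x₀ + noiseState (A + B * K) B σu (fun r i => e (r, i)) s)
    (K *ᵥ ((A + B * K) ^ s *ᵥ x₀ + noiseState (A + B * K) B σu (fun r i => e (r, i)) s)
      + σu • fun j => e (s, Sum.inr j))

theorem noiseState_succ (F : Matrix (Fin n) (Fin n) ℝ) (η : ℕ → Fin n ⊕ Fin m → ℝ) (s : ℕ) :
    noiseState F B σu η (s + 1) = F *ᵥ noiseState F B σu η s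
      + ((fun i => η s (Sum.inl i)) + σu • B *ᵥ fun j => η s (Sum.inr j)) := by
  rw [noiseState, Finset.sum_range_succ, noiseState, Matrix.mulVec_sum]
  congr 1
  · refine Finset.sum_congr rfl fun r hr => ?_
    have := Finset.mem_range.mp hr
    rw [Matrix.mulVec_mulVec, ← pow_succ', show s + 1 - 1 - r = s - 1 - r + 1 by omega]
  · simp

theorem continuous_regressor (s : ℕ) :
    Continuous fun p : (Fin n → ℝ) × (ℕ × (Fin n ⊕ Fin m) → ℝ) =>
      regressor A B K σu s p.1 p.2 := by
  have h1 : Continuous fun p : (Fin n → ℝ) × (ℕ × (Fin n ⊕ Fin m) → ℝ) =>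
      (A + B * K) ^ s *ᵥ p.1 + noiseState (A + B * K) B σu (fun r i => p.2 (r, i)) s := by
    unfold noiseState
    fun_prop
  refine continuous_pi fun i => ?_
  rcases i with i | j
  · simp only [regressor, Sum.elim_inl]
    exact (continuous_apply i).comp h1
  · simp only [regressor, Sum.elim_inr]
    fun_prop

omit [IsProbabilityMeasure μ] in
theorem IsRollout.state_formula (h : IsRollout μ A B K σu σ x u w g) (s : ℕ) (ω : Ω) :
    x s ω = (A + B * K) ^ s *ᵥ x 0 ω
      + noiseState (A + B * K) B σu (fun r i => noise w g (r, i) ω) s := by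
  induction s with
  | zero => simp [noiseState]
  | succ s ih =>
    rw [h.state_eq, h.input_eq, noiseState_succ, pow_succ', ← Matrix.mulVec_mulVec]
    have e : ∀ y : Fin n → ℝ, A *ᵥ y + B *ᵥ (K *ᵥ y + σu • g s ω) + w s ω
        = (A + B * K) *ᵥ y + (w s ω + σu • B *ᵥ g s ω) := fun y => by
      rw [Matrix.mulVec_add, Matrix.add_mulVec, Matrix.mulVec_mulVec, Matrix.mulVec_smul]
      abel
    rw [e, ih, Matrix.mulVec_add, add_assoc]
    rfl

omit [IsProbabilityMeasure μ] in
theorem IsRollout.regressor_eq (h : IsRollout μ A B K σu σ x u w g) (s : ℕ) (ω : Ω) :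
    Sum.elim (x s ω) (u s ω) = regressor A B K σu s (x 0 ω) (fun p => noise w g p ω) := by
  rw [regressor, ← h.state_formula, h.input_eq]
  rfl

omit [IsProbabilityMeasure μ] in
theorem IsRollout.measurable_noise (h : IsRollout μ A B K σu σ x u w g)
    (p : ℕ × (Fin n ⊕ Fin m)) : Measurable (noise w g p) := by
  rcases p with ⟨s, i | j⟩
  · exact (measurable_pi_apply i).comp (h.measurable_w s)
  · exact (measurable_pi_apply j).comp (h.measurable_g s)

omit [IsProbabilityMeasure μ] in
theorem IsRollout.measurable_regressor (h : IsRollout μ A B K σu σ x u w g) (s : ℕ) :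
    Measurable fun ω => Sum.elim (x s ω) (u s ω) := by
  simp_rw [h.regressor_eq]
  exact (continuous_regressor s).measurable.comp
    (h.measurable_init.prodMk (measurable_pi_lambda _ fun p => h.measurable_noise p))

theorem IsRollout.one_le_sigma [NeZero n] (h : IsRollout μ A B K σu σ x u w g) : 1 ≤ σ ^ 2 :=
  one_le_of_hasSubgaussianMGF (h.subgaussian_w 0 0) (by simpa using h.cov_w 0 0 0)

theorem IsRollout.subgaussian_noise [NeZero n] (h : IsRollout μ A B K σu σ x u w g)
    (p : ℕ × (Fin n ⊕ Fin m)) : HasSubgaussianMGF (noise w g p) (σ ^ 2) μ := by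
  rcases p with ⟨s, i | j⟩
  · exact h.subgaussian_w s i
  · exact hasSubgaussianMGF_of_map_eq_gaussian (h.measurable_noise (s, Sum.inr j))
      (h.gaussian_g s j) h.one_le_sigma

omit [IsProbabilityMeasure μ] in
theorem IsRollout.variance_noise (h : IsRollout μ A B K σu σ x u w g)
    (p : ℕ × (Fin n ⊕ Fin m)) : ∫ ω, noise w g p ω * noise w g p ω ∂μ = 1 := by
  rcases p with ⟨s, i | j⟩
  · have := h.cov_w s i i
    rwa [if_pos rfl] at this
  · exact integral_mul_self_of_map_eq_gaussian (h.measurable_noise (s, Sum.inr j))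
      (h.gaussian_g s j)

theorem continuous_kronId_transpose (q : (Fin n ⊕ Fin m) × Fin n → ℝ) :
    Continuous fun z : Fin n ⊕ Fin m → ℝ => (kronId n z)ᵀ *ᵥ q := by
  refine continuous_pi fun i => ?_
  simp only [Matrix.mulVec, dotProduct, Matrix.transpose_apply, kronId, Matrix.of_apply]
  fun_prop

/-- The initial state is independent of the noise, so by Fubini it may be frozen; the regressors are
then causal functions of the noise alone. No moment of the initial state is needed. -/
theorem IsRollout.lintegral_exp_le (h : IsRollout μ A B K σu σ x u w g)
    (q : (Fin n ⊕ Fin m) × Fin n → ℝ) (t : ℕ) :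
    ∫⁻ ω, ENNReal.ofReal (Real.exp (∑ s ∈ Finset.range t,
      (((kronId n (Sum.elim (x s ω) (u s ω)))ᵀ *ᵥ q) ⬝ᵥ w s ω
        - (σ : ℝ) ^ 2 / 2 * (((kronId n (Sum.elim (x s ω) (u s ω)))ᵀ *ᵥ q) ⬝ᵥ
          ((kronId n (Sum.elim (x s ω) (u s ω)))ᵀ *ᵥ q))))) ∂μ ≤ 1 := by
  set N : Ω → ℕ × (Fin n ⊕ Fin m) → ℝ := fun ω p => noise w g p ω with hN
  have hNm : Measurable N := measurable_pi_lambda _ fun p => h.measurable_noise p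
  let H : (Fin n → ℝ) → ℕ → (ℕ × (Fin n ⊕ Fin m) → ℝ) → Fin n → ℝ := fun x₀ s e =>
    (kronId n (regressor A B K σu s x₀ e))ᵀ *ᵥ q
  have hHc : ∀ s, Continuous fun p : (Fin n → ℝ) × (ℕ × (Fin n ⊕ Fin m) → ℝ) => H p.1 s p.2 :=
    fun s => (continuous_kronId_transpose q).comp (continuous_regressor s)
  have hcausal : ∀ x₀, IsCausal (H x₀) := fun x₀ s e e' h1 h2 => by
    have hs : noiseState (A + B * K) B σu (fun r i => e (r, i)) s
        = noiseState (A + B * K) B σu (fun r i => e' (r, i)) s := by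
      refine Finset.sum_congr rfl fun r hr => ?_
      simp only [h1 r (Finset.mem_range.mp hr)]
    simp only [H, regressor, hs, h2]
  let G : (Fin n → ℝ) × (ℕ × (Fin n ⊕ Fin m) → ℝ) → ENNReal := fun p =>
    ENNReal.ofReal (Real.exp (∑ s ∈ Finset.range t,
      (∑ i, H p.1 s p.2 i * p.2 (s, Sum.inl i)
        - ((σ ^ 2 : ℝ≥0) : ℝ) / 2 * ∑ i, H p.1 s p.2 i ^ 2)))
  have hG : Measurable G := by
    have hHi : ∀ s i, Continuous fun p : (Fin n → ℝ) × (ℕ × (Fin n ⊕ Fin m) → ℝ) =>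
        H p.1 s p.2 i := fun s i => (continuous_apply i).comp (hHc s)
    refine ENNReal.measurable_ofReal.comp (Continuous.measurable ?_)
    fun_prop
  have hlaw := (indepFun_iff_map_prod_eq_prod_map_map h.measurable_init.aemeasurable
    hNm.aemeasurable).mp h.indep_init
  have := Measure.isProbabilityMeasure_map (μ := μ) h.measurable_init.aemeasurable
  have := Measure.isProbabilityMeasure_map (μ := μ) hNm.aemeasurable
  have hfix : ∀ x₀, ∫⁻ e, G (x₀, e) ∂(μ.map N) ≤ 1 := fun x₀ => by
    rw [lintegral_map (f := fun e => G (x₀, e)) (hG.comp measurable_prodMk_left) hNm]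
    exact lintegral_exp_martingale_le (fun p => h.measurable_noise p) h.indep_noise
      (fun s i => h.subgaussian_w s i)
      (fun s => ((hHc s).comp (Continuous.prodMk_right x₀)).measurable) (hcausal x₀) t
  calc _ = ∫⁻ ω, G (x 0 ω, N ω) ∂μ := by
        refine lintegral_congr fun ω => ?_
        simp only [G]
        congr 2
        refine Finset.sum_congr rfl fun s _ => ?_
        rw [h.regressor_eq]
        simp only [H, hN, dotProduct, sq]
        rfl
    _ = ∫⁻ p, G p ∂(μ.map fun ω => (x 0 ω, N ω)) :=
        (lintegral_map hG (h.measurable_init.prodMk hNm)).symm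
    _ = ∫⁻ x₀, ∫⁻ e, G (x₀, e) ∂(μ.map N) ∂(μ.map (x 0)) := by
        rw [hlaw, lintegral_prod _ hG.aemeasurable]
    _ ≤ ∫⁻ _, 1 ∂(μ.map (x 0)) := lintegral_mono fun x₀ => hfix x₀
    _ = 1 := by simp

/-- Tail bound for the noise term in a fixed direction, on the event that the quadratic
variation is at most `4 t`. -/
theorem IsRollout.measure_noise_gt_le [NeZero n] (h : IsRollout μ A B K σu σ x u w g)
    (q : (Fin n ⊕ Fin m) × Fin n → ℝ) {t : ℕ} (ht : 0 < t) {r : ℝ} (hr : 0 ≤ r) :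
    μ {ω | ∑ s ∈ Finset.range t, ((kronId n (Sum.elim (x s ω) (u s ω)))ᵀ *ᵥ q) ⬝ᵥ
        ((kronId n (Sum.elim (x s ω) (u s ω)))ᵀ *ᵥ q) ≤ 4 * t ∧
      r < |∑ s ∈ Finset.range t, ((kronId n (Sum.elim (x s ω) (u s ω)))ᵀ *ᵥ q) ⬝ᵥ w s ω|}
      ≤ ENNReal.ofReal (2 * Real.exp (-(r ^ 2 / (8 * (σ : ℝ) ^ 2 * t)))) := by
  have ht0 : (0 : ℝ) < t := by exact_mod_cast ht
  have hσ : (0 : ℝ) < (σ : ℝ) ^ 2 := by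
    have h1 := h.one_le_sigma
    have : (1 : ℝ) ≤ (σ : ℝ) ^ 2 := by exact_mod_cast h1
    linarith
  set D : Ω → ℕ → Fin n → ℝ := fun ω s => (kronId n (Sum.elim (x s ω) (u s ω)))ᵀ *ᵥ q with hD
  -- The maximiser of lr - 2σ²l²t, the exponent remaining once the quadratic variation is at most
  -- 4t.
  set l : ℝ := r / (4 * (σ : ℝ) ^ 2 * t) with hl
  have hl0 : 0 ≤ l := by positivity
  have hone : ∀ e : ℝ, e ^ 2 = 1 →
      μ {ω | ∑ s ∈ Finset.range t, D ω s ⬝ᵥ D ω s ≤ 4 * t ∧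
        r < e * ∑ s ∈ Finset.range t, D ω s ⬝ᵥ w s ω}
      ≤ ENNReal.ofReal (Real.exp (-(r ^ 2 / (8 * (σ : ℝ) ^ 2 * t)))) := fun e he => by
    have hb := h.lintegral_exp_le ((e * l) • q) t
    have e1 : ∀ ω s, (kronId n (Sum.elim (x s ω) (u s ω)))ᵀ *ᵥ ((e * l) • q)
        = (e * l) • D ω s := fun ω s => Matrix.mulVec_smul _ _ _
    simp_rw [e1] at hb
    set f : Ω → ENNReal := fun ω => ENNReal.ofReal (Real.exp (∑ s ∈ Finset.range t,
      (((e * l) • D ω s) ⬝ᵥ w s ω - (σ : ℝ) ^ 2 / 2 * (((e * l) • D ω s) ⬝ᵥ ((e * l) • D ω s)))))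
      with hf
    have hfm : Measurable f := by
      have hD : ∀ s, Measurable fun ω => D ω s := fun s =>
        (continuous_kronId_transpose q).measurable.comp (h.measurable_regressor s)
      have hDi : ∀ s i, Measurable fun ω => D ω s i := fun s i =>
        (measurable_pi_apply i).comp (hD s)
      have hwi : ∀ s i, Measurable fun ω => w s ω i := fun s i =>
        (measurable_pi_apply i).comp (h.measurable_w s)
      simp only [hf, dotProduct, Pi.smul_apply]
      fun_prop
    have hsub : {ω | ∑ s ∈ Finset.range t, D ω s ⬝ᵥ D ω s ≤ 4 * t ∧
        r < e * ∑ s ∈ Finset.range t, D ω s ⬝ᵥ w s ω}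
        ⊆ {ω | ENNReal.ofReal (Real.exp (r ^ 2 / (8 * (σ : ℝ) ^ 2 * t))) ≤ f ω} := fun ω hω => by
      obtain ⟨h1, h2⟩ := hω
      refine ENNReal.ofReal_le_ofReal (Real.exp_le_exp.mpr ?_)
      have e2 : ∑ s ∈ Finset.range t, (((e * l) • D ω s) ⬝ᵥ w s ω
          - (σ : ℝ) ^ 2 / 2 * (((e * l) • D ω s) ⬝ᵥ ((e * l) • D ω s)))
          = l * (e * ∑ s ∈ Finset.range t, D ω s ⬝ᵥ w s ω)
            - (σ : ℝ) ^ 2 / 2 * l ^ 2 * ∑ s ∈ Finset.range t, D ω s ⬝ᵥ D ω s := by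
        rw [Finset.sum_sub_distrib, Finset.mul_sum, Finset.mul_sum, Finset.mul_sum]
        congr 1
        · exact Finset.sum_congr rfl fun s _ => by rw [smul_dotProduct, smul_eq_mul]; ring
        · refine Finset.sum_congr rfl fun s _ => ?_
          rw [smul_dotProduct, dotProduct_smul, smul_eq_mul, smul_eq_mul]
          linear_combination (σ : ℝ) ^ 2 / 2 * l ^ 2 * (D ω s ⬝ᵥ D ω s) * he
      rw [e2]
      have h3 := mul_le_mul_of_nonneg_left h2.le hl0
      have h4 : (σ : ℝ) ^ 2 / 2 * l ^ 2 * ∑ s ∈ Finset.range t, D ω s ⬝ᵥ D ω s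
          ≤ (σ : ℝ) ^ 2 / 2 * l ^ 2 * (4 * t) := by gcongr
      have h5 : l * r - (σ : ℝ) ^ 2 / 2 * l ^ 2 * (4 * t) = r ^ 2 / (8 * (σ : ℝ) ^ 2 * t) := by
        rw [hl]; field_simp; ring
      linarith
    have hlt : μ {ω | ENNReal.ofReal (Real.exp (r ^ 2 / (8 * (σ : ℝ) ^ 2 * t))) ≤ f ω}
        ≤ (∫⁻ ω, f ω ∂μ) / ENNReal.ofReal (Real.exp (r ^ 2 / (8 * (σ : ℝ) ^ 2 * t))) :=
      meas_ge_le_lintegral_div hfm.aemeasurable (by simp [Real.exp_pos]) ENNReal.ofReal_ne_top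
    refine (measure_mono hsub).trans (hlt.trans ?_)
    rw [Real.exp_neg, ENNReal.ofReal_inv_of_pos (Real.exp_pos _), ENNReal.div_eq_inv_mul]
    exact mul_le_of_le_one_right' hb
  have hsplit : {ω | ∑ s ∈ Finset.range t, D ω s ⬝ᵥ D ω s ≤ 4 * t ∧
      r < |∑ s ∈ Finset.range t, D ω s ⬝ᵥ w s ω|}
      ⊆ {ω | ∑ s ∈ Finset.range t, D ω s ⬝ᵥ D ω s ≤ 4 * t ∧
          r < 1 * ∑ s ∈ Finset.range t, D ω s ⬝ᵥ w s ω}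
        ∪ {ω | ∑ s ∈ Finset.range t, D ω s ⬝ᵥ D ω s ≤ 4 * t ∧
          r < (-1) * ∑ s ∈ Finset.range t, D ω s ⬝ᵥ w s ω} := fun ω hω => by
    obtain ⟨h1, h2⟩ := hω
    rcases lt_abs.mp h2 with h3 | h3
    · exact Or.inl ⟨h1, by linarith⟩
    · exact Or.inr ⟨h1, by linarith⟩
  refine (measure_mono hsplit).trans ((measure_union_le _ _).trans ?_)
  rw [two_mul, ENNReal.ofReal_add (Real.exp_pos _).le (Real.exp_pos _).le]
  exact add_le_add (hone 1 (by norm_num)) (hone (-1) (by norm_num))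

end Rollout

/-! ### Uniform two-sided covariance bounds. -/

section Excitation

variable {Ω : Type*} [MeasurableSpace Ω] {μ : Measure Ω} [IsProbabilityMeasure μ] {n m : ℕ}
  {A : Matrix (Fin n) (Fin n) ℝ} {B : Matrix (Fin n) (Fin m) ℝ} {K : Matrix (Fin m) (Fin n) ℝ}
  {Q : Matrix (Fin n) (Fin n) ℝ}
  {σu : ℝ} {σ : ℝ≥0} {x : ℕ → Ω → Fin n → ℝ} {u : ℕ → Ω → Fin m → ℝ}
  {w : ℕ → Ω → Fin n → ℝ} {g : ℕ → Ω → Fin m → ℝ}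

/-- The noise-driven part of the state, together with the exploration noise. -/
def noiseRegressor (F : Matrix (Fin n) (Fin n) ℝ) (B : Matrix (Fin n) (Fin m) ℝ) (σu : ℝ)
    (w : ℕ → Ω → Fin n → ℝ) (g : ℕ → Ω → Fin m → ℝ) (s : ℕ) (ω : Ω) : Fin n ⊕ Fin m → ℝ :=
  Sum.elim (noiseState F B σu (fun r i => noise w g (r, i) ω) s) (g s ω)

theorem exp_neg_log_one_div {δ : ℝ} (hδ : 0 < δ) : Real.exp (-Real.log (1 / δ)) = δ := by
  rw [one_div, Real.log_inv, neg_neg, Real.exp_log hδ]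

/-- 25 ≤ exp 5 absorbs the pairs of net points, and 4δ⁴ ≤ 1/4 handles the prefactor; the 4 counts
two directions c ± d times two tails. -/
theorem covering_card_mul_exp_le {δ : ℝ} (hδ : 0 < δ) (hδ2 : δ < 1 / 2) (N : ℕ) :
    4 * (25 : ℝ) ^ N * Real.exp (-(5 * (N + Real.log (1 / δ)))) ≤ δ / 2 := by
  have h1 : Real.exp (-(5 * (N + Real.log (1 / δ)))) = Real.exp (-5) ^ N * δ ^ 5 := by
    rw [← Real.exp_nat_mul]
    conv_rhs => rw [← exp_neg_log_one_div hδ, ← Real.exp_nat_mul, ← Real.exp_add]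
    congr 1
    push_cast
    ring
  have h2 : 25 * Real.exp (-5) ≤ 1 := by
    have h3 : (2 : ℝ) ≤ Real.exp 1 := by linarith [Real.add_one_le_exp (1 : ℝ)]
    have h4 : (25 : ℝ) ≤ Real.exp 5 := by
      have : Real.exp 5 = Real.exp 1 ^ 5 := by rw [← Real.exp_nat_mul]; norm_num
      rw [this]
      calc (25 : ℝ) ≤ 2 ^ 5 := by norm_num
        _ ≤ _ := by gcongr
    rw [Real.exp_neg, ← div_eq_mul_inv, div_le_one (Real.exp_pos _)]
    exact h4
  have h5 : (25 : ℝ) ^ N * Real.exp (-5) ^ N ≤ 1 := by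
    rw [← mul_pow]; exact pow_le_one₀ (by positivity) h2
  have h6 : δ ^ 4 ≤ 1 / 16 := by
    calc δ ^ 4 ≤ (1 / 2) ^ 4 := by gcongr
      _ = 1 / 16 := by norm_num
  rw [h1]
  calc 4 * (25 : ℝ) ^ N * (Real.exp (-5) ^ N * δ ^ 5)
      = ((25 : ℝ) ^ N * Real.exp (-5) ^ N) * (4 * δ ^ 4 * δ) := by ring
    _ ≤ 1 * (4 * (1 / 16) * δ) := by gcongr
    _ ≤ δ / 2 := by linarith

/-- With probability at least `1 - δ / 2`, the empirical covariance of the noise-driven regressor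
is within a factor of its expectation. -/
theorem IsRollout.measure_cov_deviation_le [NeZero n] (h : IsRollout μ A B K σu σ x u w g)
    (hQ : (Q - 1).PosSemidef) (hst : IsStable (A + B * K)) (hσu : σu ^ 2 ≤ 1) {δ : ℝ}
    (hδ : 0 < δ) (hδ2 : δ < 1 / 2) {t : ℕ} (ht : 2 ≤ t)
    (hT : 89128960 * ((σ : ℝ) ^ 4 * opNorm (lyapP A B Q K) ^ 3 * Psi B ^ 2
      * ((n : ℝ) + (m : ℝ) + Real.log (1 / δ))) ≤ t) :
    μ {ω | ¬ ∀ v, |∑ s ∈ Finset.range t, (v ⬝ᵥ noiseRegressor (A + B * K) B σu w g s ω) ^ 2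
        - t * (v ⬝ᵥ noiseCov (A + B * K) B σu t *ᵥ v)|
        ≤ t / 2 * (v ⬝ᵥ noiseCov (A + B * K) B σu t *ᵥ v)} ≤ ENNReal.ofReal (δ / 2) := by
  classical
  set V := noiseCov (A + B * K) B σu t with hV
  have hVpd : V.PosDef := noiseCov_posDef ht
  have hV0 : ∀ v, 0 ≤ v ⬝ᵥ V *ᵥ v := fun v => by
    simpa using hVpd.posSemidef.dotProduct_mulVec_nonneg v
  set p := opNorm (lyapP A B Q K) with hp
  have hp1 : 1 ≤ p := one_le_opNorm_lyapP hQ hst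
  have hΨ : 1 ≤ Psi B := one_le_Psi
  have hσ1 : 1 ≤ σ ^ 2 := h.one_le_sigma
  have hσ : (1 : ℝ) ≤ (σ : ℝ) ^ 2 := by exact_mod_cast hσ1
  have hσ0 : (0 : ℝ) < (σ : ℝ) ^ 2 := one_pos.trans_le hσ
  have hσ4 : (0 : ℝ) < (σ : ℝ) ^ 4 := by
    rw [show (σ : ℝ) ^ 4 = ((σ : ℝ) ^ 2) ^ 2 by ring]; positivity
  obtain ⟨N, hcard, hball, hnorm⟩ := exists_norming_finset_posDef hVpd
  set ζ := noiseRegressor (A + B * K) B σu w g with hζ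
  -- Sums and differences of net points have V-norm squared at most 4, hence Euclidean norm squared
  -- at most 8 because V ≥ I/2. The burn-in constant is 5 · 139264 · 16 · 8 = 89128960.
  set β : ℝ := 16 * p ^ 3 * Psi B ^ 2 * 8 with hβ
  have hβ0 : 0 < β := by positivity
  set b : ENNReal := ENNReal.ofReal (2 * Real.exp (-((t : ℝ) / (139264 * ((σ : ℝ) ^ 2) ^ 2 * β))))
    with hb
  let Dev : (Fin n ⊕ Fin m → ℝ) → Set Ω := fun v =>
    {ω | (t : ℝ) / 4 < |∑ s ∈ Finset.range t, (v ⬝ᵥ ζ s ω) ^ 2 - t * (v ⬝ᵥ V *ᵥ v)|}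
  have hDev : ∀ v, v ⬝ᵥ V *ᵥ v ≤ 4 → μ (Dev v) ≤ b := fun v hv => by
    have hvv : v ⬝ᵥ v ≤ 8 := by
      have h1 := noiseCov_lower (F := A + B * K) (B := B) (σu := σu) ht v
      have h2 := dotProduct_sum_type v v
      linarith [dotProduct_self_nonneg' (v ∘ Sum.inr)]
    have hM : ∀ y, (respMat (A + B * K) B σu t v *ᵥ y) ⬝ᵥ (respMat (A + B * K) B σu t v *ᵥ y)
        ≤ β * (y ⬝ᵥ y) := fun y => by
      refine (respMat_bound hQ hst hσu t v y).trans ?_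
      have := dotProduct_self_nonneg' y
      rw [hβ]
      gcongr
    have htr := respMat_trace (F := A + B * K) (B := B) (σu := σu) (by omega : 0 < t) v
    have hHW := measure_hansonWright_le (μ := μ) (k := σ ^ 2) (τ := t)
      (η := fun p : Fin t × (Fin n ⊕ Fin m) => noise w g ((p.1 : ℕ), p.2))
      (fun p => h.measurable_noise _)
      (h.indep_noise.precomp (g := fun p : Fin t × (Fin n ⊕ Fin m) => ((p.1 : ℕ), p.2))
        fun p q hpq => by
          simp only [Prod.mk.injEq] at hpq
          exact Prod.ext (Fin.ext hpq.1) hpq.2)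
      (fun p => h.subgaussian_noise _) (fun p => h.variance_noise _) hσ1 hβ0 hM (by
        rw [htr]
        have : (0 : ℝ) ≤ t := Nat.cast_nonneg t
        nlinarith)
    rw [htr, NNReal.coe_pow] at hHW
    refine le_trans (measure_mono fun ω hω => ?_) hHW
    have e : (respMat (A + B * K) B σu t v *ᵥ fun p => noise w g ((p.1 : ℕ), p.2) ω) ⬝ᵥ
        (respMat (A + B * K) B σu t v *ᵥ fun p => noise w g ((p.1 : ℕ), p.2) ω)
        = ∑ s ∈ Finset.range t, (v ⬝ᵥ ζ s ω) ^ 2 := by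
      rw [Finset.sum_range, dotProduct]
      refine Finset.sum_congr rfl fun s _ => ?_
      rw [respMat_mulVec t v (fun r i => noise w g (r, i) ω) s, ← sq, dotProduct_sum_type v]
      rfl
    change (t : ℝ) / 4 < |_ - _|
    rw [e]
    exact hω
  -- Parallelogram law.
  have hpar : ∀ c ∈ N, ∀ d ∈ N, (c + d) ⬝ᵥ V *ᵥ (c + d) ≤ 4 ∧ (c - d) ⬝ᵥ V *ᵥ (c - d) ≤ 4 :=
    fun c hc d hd => by
      have e : (c + d) ⬝ᵥ V *ᵥ (c + d) + (c - d) ⬝ᵥ V *ᵥ (c - d)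
          = 2 * (c ⬝ᵥ V *ᵥ c) + 2 * (d ⬝ᵥ V *ᵥ d) := by
        simp only [Matrix.mulVec_add, Matrix.mulVec_sub, dotProduct_add, dotProduct_sub,
          add_dotProduct, sub_dotProduct]
        ring
      have h1 := hV0 (c + d)
      have h2 := hV0 (c - d)
      have h3 := hball c hc
      have h4 := hball d hd
      constructor <;> linarith
  have hcover : {ω | ¬ ∀ v, |∑ s ∈ Finset.range t, (v ⬝ᵥ ζ s ω) ^ 2 - t * (v ⬝ᵥ V *ᵥ v)|
      ≤ t / 2 * (v ⬝ᵥ V *ᵥ v)} ⊆ ⋃ c ∈ N, ⋃ d ∈ N, (Dev (c + d) ∪ Dev (c - d)) := fun ω hω => by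
    by_contra hne
    simp only [Set.mem_iUnion, Set.mem_union, not_exists, not_or] at hne
    apply hω
    set S : Matrix (Fin n ⊕ Fin m) (Fin n ⊕ Fin m) ℝ :=
      ∑ s ∈ Finset.range t, vecMulVec (ζ s ω) (ζ s ω) - (t : ℝ) • V with hS
    have hSq : ∀ v, v ⬝ᵥ S *ᵥ v
        = ∑ s ∈ Finset.range t, (v ⬝ᵥ ζ s ω) ^ 2 - t * (v ⬝ᵥ V *ᵥ v) := fun v => by
      rw [hS, Matrix.sub_mulVec, dotProduct_sub, Matrix.sum_mulVec, dotProduct_sum,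
        Matrix.smul_mulVec, dotProduct_smul, smul_eq_mul]
      congr 1
      refine Finset.sum_congr rfl fun s _ => ?_
      rw [Matrix.vecMulVec_mulVec, dotProduct_smul, dotProduct_comm (ζ s ω) v, sq]
      simp
    have hST : Sᵀ = S := by
      have h1 := noiseCov_isHermitian (F := A + B * K) (B := B) (σu := σu) t
      rw [Matrix.IsHermitian, Matrix.conjTranspose_eq_transpose_of_trivial] at h1
      rw [hS, Matrix.transpose_sub, Matrix.transpose_smul, hV, h1, Matrix.transpose_sum]
      congr 1
      exact Finset.sum_congr rfl fun s _ => Matrix.transpose_vecMulVec _ _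
    intro v
    -- A deviation of t/4 on the net becomes t/2 in every direction.
    have h1 := quadratic_le_of_norming hnorm hV0 hST (m := t / 4) (fun c hc d hd => by
      have h2 := hne c hc d hd
      rw [hSq, hSq]
      exact ⟨not_lt.mp h2.1, not_lt.mp h2.2⟩) v
    rw [hSq] at h1
    linarith
  have hcardR : (N.card : ENNReal) ≤ ENNReal.ofReal (5 ^ (n + m)) := by
    rw [← ENNReal.ofReal_natCast]
    refine ENNReal.ofReal_le_ofReal ?_
    rw [Fintype.card_sum, Fintype.card_fin, Fintype.card_fin] at hcard
    exact_mod_cast hcard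
  calc _ ≤ μ (⋃ c ∈ N, ⋃ d ∈ N, (Dev (c + d) ∪ Dev (c - d))) := measure_mono hcover
    _ ≤ ∑ c ∈ N, ∑ d ∈ N, (b + b) := by
        refine (measure_biUnion_finset_le _ _).trans (Finset.sum_le_sum fun c hc => ?_)
        refine (measure_biUnion_finset_le _ _).trans (Finset.sum_le_sum fun d hd => ?_)
        refine (measure_union_le _ _).trans ?_
        exact add_le_add (hDev _ (hpar c hc d hd).1) (hDev _ (hpar c hc d hd).2)
    _ = N.card * (N.card * (b + b)) := by
        rw [Finset.sum_const, Finset.sum_const, nsmul_eq_mul, nsmul_eq_mul]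
    _ ≤ ENNReal.ofReal (5 ^ (n + m)) * (ENNReal.ofReal (5 ^ (n + m)) * (b + b)) := by gcongr
    _ ≤ ENNReal.ofReal (δ / 2) := by
        rw [hb, ← ENNReal.ofReal_add (by positivity) (by positivity),
          ← ENNReal.ofReal_mul (by positivity), ← ENNReal.ofReal_mul (by positivity)]
        refine ENNReal.ofReal_le_ofReal (le_trans ?_ (covering_card_mul_exp_le hδ hδ2 (n + m)))
        have h1 : -((t : ℝ) / (139264 * ((σ : ℝ) ^ 2) ^ 2 * β))
            ≤ -(5 * (((n + m : ℕ) : ℝ) + Real.log (1 / δ))) := by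
          rw [neg_le_neg_iff, le_div_iff₀ (by positivity), hβ]
          push_cast
          exact le_trans (le_of_eq (by ring)) hT
        have h2 := Real.exp_le_exp.mpr h1
        have h3 : (5 : ℝ) ^ (n + m) * 5 ^ (n + m) = 25 ^ (n + m) := by
          rw [← mul_pow]; norm_num
        calc _ = 4 * ((5 : ℝ) ^ (n + m) * 5 ^ (n + m))
              * Real.exp (-((t : ℝ) / (139264 * ((σ : ℝ) ^ 2) ^ 2 * β))) := by ring
          _ ≤ _ := by rw [h3]; gcongr

omit [IsProbabilityMeasure μ] in
/-- Two-sided bound on the empirical covariance of the regressors, when the burn-in time is long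
with respect to the initial state. -/
theorem IsRollout.excitation_bounds [NeZero n] (h : IsRollout μ A B K σu σ x u w g)
    (hQ : (Q - 1).PosSemidef) (hst : IsStable (A + B * K)) {t : ℕ} (ht : 2 ≤ t) {ω : Ω}
    (hgood : ∀ v, |∑ s ∈ Finset.range t, (v ⬝ᵥ noiseRegressor (A + B * K) B σu w g s ω) ^ 2
        - t * (v ⬝ᵥ noiseCov (A + B * K) B σu t *ᵥ v)|
        ≤ t / 2 * (v ⬝ᵥ noiseCov (A + B * K) B σu t *ᵥ v))
    (hx : 16 * ((x 0 ω ⬝ᵥ x 0 ω) * opNorm (lyapP A B Q K)) ≤ t) (v : Fin n ⊕ Fin m → ℝ) :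
    t / 8 * (v ⬝ᵥ avgCov A B K σu t *ᵥ v)
        ≤ ∑ s ∈ Finset.range t, (v ⬝ᵥ Sum.elim (x s ω) (u s ω)) ^ 2 ∧
      ∑ s ∈ Finset.range t, (v ⬝ᵥ Sum.elim (x s ω) (u s ω)) ^ 2
        ≤ 4 * t * (v ⬝ᵥ avgCov A B K σu t *ᵥ v) := by
  set a := v ∘ Sum.inl + Kᵀ *ᵥ (v ∘ Sum.inr) with ha
  set v' : Fin n ⊕ Fin m → ℝ := Sum.elim a (σu • (v ∘ Sum.inr)) with hv'
  have hq : v ⬝ᵥ avgCov A B K σu t *ᵥ v = v' ⬝ᵥ noiseCov (A + B * K) B σu t *ᵥ v' :=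
    avgCov_quadratic t v
  rw [hq]
  set q := v' ⬝ᵥ noiseCov (A + B * K) B σu t *ᵥ v' with hqdef
  set Y : ℕ → ℝ := fun s => v' ⬝ᵥ noiseRegressor (A + B * K) B σu w g s ω with hY
  set f : ℕ → ℝ := fun s => a ⬝ᵥ (A + B * K) ^ s *ᵥ x 0 ω with hf
  have hz : ∀ s, v ⬝ᵥ Sum.elim (x s ω) (u s ω) = Y s + f s := fun s => by
    have h1 : v ⬝ᵥ Sum.elim (x s ω) (u s ω)
        = a ⬝ᵥ x s ω + (σu • (v ∘ Sum.inr)) ⬝ᵥ g s ω := by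
      rw [dotProduct_sum_type v, Sum.elim_comp_inl, Sum.elim_comp_inr, h.input_eq, ha,
        dotProduct_add, add_dotProduct, dotProduct_mulVec_transpose, dotProduct_smul,
        smul_dotProduct, add_assoc]
    rw [h1, h.state_formula, hY, hf]
    simp only [hv', dotProduct_sum_type (Sum.elim a _), noiseRegressor, Sum.elim_comp_inl,
      Sum.elim_comp_inr, dotProduct_add]
    ring
  -- The free response is summable with total energy at most ‖P‖ times that of the initial state,
  -- and a·a ≤ 2q because `noiseCov` is at least 1/2 on states.
  have hf2 : ∑ s ∈ Finset.range t, f s ^ 2 ≤ t / 8 * q := by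
    have h1 : ∑ s ∈ Finset.range t, f s ^ 2 ≤ (a ⬝ᵥ a) * (opNorm (lyapP A B Q K)
        * (x 0 ω ⬝ᵥ x 0 ω)) := by
      refine le_trans ?_ (mul_le_mul_of_nonneg_left (sum_pow_mulVec_le hQ hst (x 0 ω) t)
        (dotProduct_self_nonneg' a))
      rw [Finset.mul_sum]
      exact Finset.sum_le_sum fun s _ => dotProduct_sq_le _ _
    have h2 := noiseCov_lower (F := A + B * K) (B := B) (σu := σu) ht v'
    rw [← hqdef, hv', Sum.elim_comp_inl, Sum.elim_comp_inr] at h2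
    have h3 : a ⬝ᵥ a ≤ 2 * q := by
      linarith [dotProduct_self_nonneg' (σu • (v ∘ Sum.inr))]
    have h4 := dotProduct_self_nonneg' a
    have h5 : (a ⬝ᵥ a) * (opNorm (lyapP A B Q K) * (x 0 ω ⬝ᵥ x 0 ω)) ≤ (a ⬝ᵥ a) * (t / 16) := by
      gcongr; linarith
    have h6 : (0 : ℝ) ≤ t / 16 := by positivity
    nlinarith [mul_le_mul_of_nonneg_right h3 h6]
  have hYg := abs_le.mp (hgood v')
  simp only [← hqdef] at hYg
  change -(t / 2 * q) ≤ ∑ s ∈ Finset.range t, Y s ^ 2 - t * q ∧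
    ∑ s ∈ Finset.range t, Y s ^ 2 - t * q ≤ t / 2 * q at hYg
  simp_rw [hz]
  have hlo : 1 / 2 * ∑ s ∈ Finset.range t, Y s ^ 2 - ∑ s ∈ Finset.range t, f s ^ 2
      ≤ ∑ s ∈ Finset.range t, (Y s + f s) ^ 2 := by
    rw [Finset.mul_sum, ← Finset.sum_sub_distrib]
    exact Finset.sum_le_sum fun s _ => by nlinarith [sq_nonneg (Y s + 2 * f s)]
  have hup : ∑ s ∈ Finset.range t, (Y s + f s) ^ 2
      ≤ 2 * ∑ s ∈ Finset.range t, Y s ^ 2 + 2 * ∑ s ∈ Finset.range t, f s ^ 2 := by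
    rw [Finset.mul_sum, Finset.mul_sum, ← Finset.sum_add_distrib]
    exact Finset.sum_le_sum fun s _ => by nlinarith [sq_nonneg (Y s - f s)]
  have hq0 : 0 ≤ t * q := by
    have := (noiseCov_posDef (F := A + B * K) (B := B) (σu := σu)
      ht).posSemidef.dotProduct_mulVec_nonneg v'
    rw [star_trivial] at this
    positivity
  -- Lower: (1/2)(1/2) - 1/8 = 1/8. Upper: 2 · 3/2 + 2/8 ≤ 4.
  constructor <;> linarith

end Excitation

/-! ### Kronecker structure and the deterministic error analysis. -/

section Projection

variable {n m d : ℕ} {A : Matrix (Fin n) (Fin n) ℝ} {B : Matrix (Fin n) (Fin m) ℝ}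
  {K : Matrix (Fin m) (Fin n) ℝ} {σu : ℝ}

theorem lambdaMin_mul_le {ι : Type*} [Fintype ι] [DecidableEq ι] {S : Matrix ι ι ℝ}
    (hS : S.IsHermitian) (x : ι → ℝ) : lambdaMin S * (x ⬝ᵥ x) ≤ x ⬝ᵥ S *ᵥ x := by
  obtain ⟨U, hU, hq⟩ := exists_diagonalization_of_isHermitian hS
  have hU' : U * Uᵀ = 1 := mul_eq_one_comm.mp hU
  have hx : x ⬝ᵥ x = ∑ i, (Uᵀ *ᵥ x) i ^ 2 := by
    have h : (Uᵀ *ᵥ x) ⬝ᵥ (Uᵀ *ᵥ x) = x ⬝ᵥ x := by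
      rw [dotProduct_mulVec_transpose, Matrix.mulVec_mulVec, hU', Matrix.one_mulVec]
    rw [← h, dotProduct]
    exact Finset.sum_congr rfl fun _ _ => (sq _).symm
  rw [hq, hx, Finset.mul_sum]
  refine Finset.sum_le_sum fun i _ => mul_le_mul_of_nonneg_right ?_ (sq_nonneg _)
  exact csInf_le (Matrix.finite_real_spectrum (A := S)).bddBelow
    (hS.eigenvalues_mem_spectrum_real i)

/-- Tensoring with the identity decouples the output coordinates, so bounds for the covariance in
every direction transfer to `Delta` and to the Gram matrix. -/
theorem kronecker_one_quadratic {ι : Type*} [Fintype ι] (S : Matrix ι ι ℝ)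
    (q : ι × Fin n → ℝ) :
    q ⬝ᵥ (S ⊗ₖ (1 : Matrix (Fin n) (Fin n) ℝ)) *ᵥ q
      = ∑ i, (fun j => q (j, i)) ⬝ᵥ S *ᵥ fun j => q (j, i) := by
  have h : ∀ j i, ((S ⊗ₖ (1 : Matrix (Fin n) (Fin n) ℝ)) *ᵥ q) (j, i)
      = (S *ᵥ fun l => q (l, i)) j := fun j i => by
    rw [Matrix.mulVec, dotProduct, Fintype.sum_prod_type]
    simp [Matrix.mulVec, dotProduct, Matrix.one_apply]
  simp only [dotProduct, Fintype.sum_prod_type, h]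
  exact Finset.sum_comm

theorem Delta_quadratic (t : ℕ) (Φ : Matrix ((Fin n ⊕ Fin m) × Fin n) (Fin d) ℝ)
    (y : Fin d → ℝ) :
    y ⬝ᵥ Delta A B K σu t Φ *ᵥ y = ∑ i, (fun j => (Φ *ᵥ y) (j, i)) ⬝ᵥ
      avgCov A B K σu t *ᵥ fun j => (Φ *ᵥ y) (j, i) := by
  rw [Delta, ← Matrix.mulVec_mulVec, ← Matrix.mulVec_mulVec, dotProduct_comm,
    dotProduct_mulVec_transpose, dotProduct_comm, kronecker_one_quadratic]

theorem avgCov_isHermitian (t : ℕ) : (avgCov A B K σu t).IsHermitian := by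
  rw [avgCov]
  refine Matrix.IsHermitian.add ?_
    (Matrix.IsHermitian.fromBlocks Matrix.isHermitian_zero (by simp) ?_)
  · rw [Matrix.IsHermitian, Matrix.conjTranspose_eq_transpose_of_trivial, Matrix.transpose_smul,
      Matrix.transpose_sum]
    simp_rw [Matrix.transpose_sum]
    congr 1
    refine Finset.sum_congr rfl fun s _ => Finset.sum_congr rfl fun j _ => ?_
    simp only [Matrix.transpose_mul, Matrix.transpose_transpose, Matrix.transpose_add,
      Matrix.transpose_smul, Matrix.transpose_one, Matrix.mul_assoc]
  · rw [Matrix.IsHermitian, Matrix.conjTranspose_eq_transpose_of_trivial]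
    simp

theorem Delta_isHermitian (t : ℕ) (Φ : Matrix ((Fin n ⊕ Fin m) × Fin n) (Fin d) ℝ) :
    (Delta A B K σu t Φ).IsHermitian := by
  have h := avgCov_isHermitian (A := A) (B := B) (K := K) (σu := σu) t
  rw [Matrix.IsHermitian, Matrix.conjTranspose_eq_transpose_of_trivial] at h
  rw [Matrix.IsHermitian, Matrix.conjTranspose_eq_transpose_of_trivial, Delta]
  rw [Matrix.transpose_mul, Matrix.transpose_mul, Matrix.transpose_transpose, Matrix.mul_assoc,
    ← Matrix.kroneckerMap_transpose, h, Matrix.transpose_one]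

theorem Delta_posDef {t : ℕ} {Φ : Matrix ((Fin n ⊕ Fin m) × Fin n) (Fin d) ℝ}
    (h : 0 < lambdaMin (Delta A B K σu t Φ)) : (Delta A B K σu t Φ).PosDef := by
  refine Matrix.PosDef.of_dotProduct_mulVec_pos (Delta_isHermitian t Φ) fun v hv => ?_
  rw [star_trivial]
  have h0 : 0 < v ⬝ᵥ v := lt_of_le_of_ne (dotProduct_self_nonneg' v)
    fun h => hv (dotProduct_self_eq_zero.mp h.symm)
  exact (mul_pos h h0).trans_le (lambdaMin_mul_le (Delta_isHermitian t Φ) v)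

theorem kronId_transpose_mulVec (z : Fin n ⊕ Fin m → ℝ) (q : (Fin n ⊕ Fin m) × Fin n → ℝ)
    (i : Fin n) : ((kronId n z)ᵀ *ᵥ q) i = (fun j => q (j, i)) ⬝ᵥ z := by
  simp only [Matrix.mulVec, dotProduct, Matrix.transpose_apply, kronId, Matrix.of_apply,
    Fintype.sum_prod_type, Matrix.one_apply]
  refine Finset.sum_congr rfl fun j _ => ?_
  simp [mul_comm]

theorem kronId_transpose_mulVec_vec (z : Fin n ⊕ Fin m → ℝ) :
    (kronId n z)ᵀ *ᵥ Matrix.vec (Matrix.fromCols A B) = Matrix.fromCols A B *ᵥ z := by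
  funext i
  rw [kronId_transpose_mulVec]
  rfl

theorem kronId_mul_transpose (z : Fin n ⊕ Fin m → ℝ) :
    vecMulVec z z ⊗ₖ (1 : Matrix (Fin n) (Fin n) ℝ) = kronId n z * (kronId n z)ᵀ := by
  ext ⟨i, k⟩ ⟨j, l⟩
  simp only [Matrix.kroneckerMap_apply, Matrix.vecMulVec_apply, Matrix.mul_apply,
    Matrix.transpose_apply, kronId, Matrix.of_apply, Matrix.one_apply]
  simp [mul_comm]

theorem sum_kronId_transpose_sq (t : ℕ) (z : ℕ → Fin n ⊕ Fin m → ℝ)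
    (q : (Fin n ⊕ Fin m) × Fin n → ℝ) :
    ∑ s ∈ Finset.range t, ((kronId n (z s))ᵀ *ᵥ q) ⬝ᵥ ((kronId n (z s))ᵀ *ᵥ q)
      = ∑ i, ∑ s ∈ Finset.range t, ((fun j => q (j, i)) ⬝ᵥ z s) ^ 2 := by
  rw [Finset.sum_comm]
  refine Finset.sum_congr rfl fun s _ => ?_
  rw [dotProduct]
  exact Finset.sum_congr rfl fun i _ => by rw [kronId_transpose_mulVec, sq]

theorem lsGram_bilinear (Φ : Matrix ((Fin n ⊕ Fin m) × Fin n) (Fin d) ℝ) (t : ℕ)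
    (x : ℕ → Fin n → ℝ) (u : ℕ → Fin m → ℝ) (y y' : Fin d → ℝ) :
    y ⬝ᵥ lsGram Φ t x u *ᵥ y' = ∑ s ∈ Finset.range t,
      ((kronId n (Sum.elim (x s) (u s)))ᵀ *ᵥ (Φ *ᵥ y)) ⬝ᵥ
        ((kronId n (Sum.elim (x s) (u s)))ᵀ *ᵥ (Φ *ᵥ y')) := by
  rw [lsGram, Matrix.sum_mulVec, dotProduct_sum]
  refine Finset.sum_congr rfl fun s _ => ?_
  rw [kronId_mul_transpose, dotProduct_mulVec_transpose, ← Matrix.mulVec_mulVec,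
    ← Matrix.mulVec_mulVec, ← Matrix.mulVec_mulVec, dotProduct_comm y,
    dotProduct_mulVec_transpose, dotProduct_comm]

/-- The normal equations, when the Gram matrix is positive definite. -/
theorem lsGram_mulVec_lsEstimate {Φ : Matrix ((Fin n ⊕ Fin m) × Fin n) (Fin d) ℝ} {t : ℕ}
    {x : ℕ → Fin n → ℝ} {u : ℕ → Fin m → ℝ}
    (hpos : ∀ y, y ≠ 0 → 0 < y ⬝ᵥ lsGram Φ t x u *ᵥ y) :
    lsGram Φ t x u *ᵥ lsEstimate Φ t x u
      = ∑ s ∈ Finset.range t, Φᵀ *ᵥ (kronId n (Sum.elim (x s) (u s)) *ᵥ x (s + 1)) := by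
  set L := lsGram Φ t x u with hL
  have hsymm : L.IsHermitian := by
    rw [Matrix.IsHermitian, Matrix.conjTranspose_eq_transpose_of_trivial, hL, lsGram,
      Matrix.transpose_sum]
    refine Finset.sum_congr rfl fun s _ => ?_
    rw [Matrix.transpose_mul, Matrix.transpose_mul, Matrix.transpose_transpose, Matrix.mul_assoc,
      ← Matrix.kroneckerMap_transpose, Matrix.transpose_vecMulVec, Matrix.transpose_one]
  have hpd : L.PosDef := Matrix.PosDef.of_dotProduct_mulVec_pos hsymm fun y hy => by
    rw [star_trivial]; exact hpos y hy
  have h1 : L * symPinv L = 1 := by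
    have h := (symPinv_spec L hsymm).1
    exact hpd.isUnit.mul_right_cancel (by rw [h, Matrix.one_mul])
  rw [lsEstimate, Matrix.mulVec_mulVec, ← hL, h1, Matrix.one_mulVec]

/-- Deterministic error analysis of least squares. -/
theorem lsEstimate_error_le {Φstar Φhat : Matrix ((Fin n ⊕ Fin m) × Fin n) (Fin d) ℝ}
    {θstar : Fin d → ℝ} (hvec : Matrix.vec (Matrix.fromCols A B) = Φstar *ᵥ θstar)
    (horth : Φhatᵀ * Φhat = 1) {t : ℕ} (ht : 0 < t)
    {x : ℕ → Fin n → ℝ} {u : ℕ → Fin m → ℝ} {w : ℕ → Fin n → ℝ}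
    (hstate : ∀ s, x (s + 1) = A *ᵥ x s + B *ᵥ u s + w s)
    {D : Matrix (Fin d) (Fin d) ℝ} {lam r M : ℝ} (hlam : 0 < lam) (hM : 0 ≤ M)
    (hD : ∀ y, lam * (y ⬝ᵥ y) ≤ y ⬝ᵥ D *ᵥ y)
    (hlow : ∀ y, t / 8 * (y ⬝ᵥ D *ᵥ y) ≤ ∑ s ∈ Finset.range t,
      ((kronId n (Sum.elim (x s) (u s)))ᵀ *ᵥ (Φhat *ᵥ y)) ⬝ᵥ
        ((kronId n (Sum.elim (x s) (u s)))ᵀ *ᵥ (Φhat *ᵥ y)))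
    (hup : ∀ q, ∑ s ∈ Finset.range t, ((kronId n (Sum.elim (x s) (u s)))ᵀ *ᵥ q) ⬝ᵥ
        ((kronId n (Sum.elim (x s) (u s)))ᵀ *ᵥ q) ≤ t * M * (q ⬝ᵥ q))
    (hnoise : ∀ y, |∑ s ∈ Finset.range t,
      ((kronId n (Sum.elim (x s) (u s)))ᵀ *ᵥ (Φhat *ᵥ y)) ⬝ᵥ w s|
        ≤ 2 * r * √(y ⬝ᵥ D *ᵥ y)) :
    vnorm (Φhat *ᵥ lsEstimate Φhat t x u - Φstar *ᵥ θstar) ^ 2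
      ≤ 32 * (M * (subspaceDist Φhat Φstar ^ 2 * vnorm θstar ^ 2) + 32 * r ^ 2 / t ^ 2) / lam
        + 2 * (subspaceDist Φhat Φstar ^ 2 * vnorm θstar ^ 2) := by
  have ht0 : (0 : ℝ) < t := by exact_mod_cast ht
  set q := Φstar *ᵥ θstar with hq
  set E : ℕ → Matrix (Fin n) ((Fin n ⊕ Fin m) × Fin n) ℝ := fun s =>
    (kronId n (Sum.elim (x s) (u s)))ᵀ with hE
  set v := (1 - Φhat * Φhatᵀ) *ᵥ q with hv
  have hv2 : v ⬝ᵥ v ≤ subspaceDist Φhat Φstar ^ 2 * vnorm θstar ^ 2 := by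
    rw [hv, hq, Matrix.mulVec_mulVec, vnorm_sq]
    exact mulVec_dotProduct_self_le _ _
  have hpos : ∀ y, y ≠ 0 → 0 < y ⬝ᵥ lsGram Φhat t x u *ᵥ y := fun y hy => by
    rw [lsGram_bilinear]
    have h0 : 0 < y ⬝ᵥ y := lt_of_le_of_ne (dotProduct_self_nonneg' y)
      fun h => hy (dotProduct_self_eq_zero.mp h.symm)
    have h1 := mul_pos hlam h0
    have h2 := mul_le_mul_of_nonneg_left (hD y) (by positivity : (0 : ℝ) ≤ t / 8)
    exact lt_of_lt_of_le (by positivity) (h2.trans (hlow y))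
  have hnormal := lsGram_mulVec_lsEstimate hpos
  set θ := lsEstimate Φhat t x u with hθ
  set e := θ - Φhatᵀ *ᵥ q with he
  have hx : ∀ s, x (s + 1) = E s *ᵥ q + w s := fun s => by
    rw [hstate, hE, ← hvec]
    simp only
    rw [kronId_transpose_mulVec_vec, Matrix.fromCols_mulVec, Sum.elim_comp_inl,
      Sum.elim_comp_inr]
  have hvq : q - Φhat *ᵥ (Φhatᵀ *ᵥ q) = v := by
    rw [hv, Matrix.sub_mulVec, Matrix.one_mulVec, Matrix.mulVec_mulVec]
  -- The energy identity: the normal equations tested against e, with the target split into its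
  -- projection on the range of Φ̂ and v.
  have hkey : e ⬝ᵥ lsGram Φhat t x u *ᵥ e
      = ∑ s ∈ Finset.range t, (E s *ᵥ (Φhat *ᵥ e)) ⬝ᵥ (E s *ᵥ v)
        + ∑ s ∈ Finset.range t, (E s *ᵥ (Φhat *ᵥ e)) ⬝ᵥ w s := by
    have h1 : e ⬝ᵥ lsGram Φhat t x u *ᵥ θ
        = ∑ s ∈ Finset.range t, (E s *ᵥ (Φhat *ᵥ e)) ⬝ᵥ (E s *ᵥ q + w s) := by
      rw [hnormal, dotProduct_sum]
      refine Finset.sum_congr rfl fun s _ => ?_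
      rw [hx s, dotProduct_comm e, dotProduct_mulVec_transpose, dotProduct_comm, hE]
      simp only
      rw [dotProduct_mulVec_transpose]
    have h2 : lsGram Φhat t x u *ᵥ e
        = lsGram Φhat t x u *ᵥ θ - lsGram Φhat t x u *ᵥ (Φhatᵀ *ᵥ q) := by
      rw [he, Matrix.mulVec_sub]
    rw [h2, dotProduct_sub, h1, lsGram_bilinear, ← Finset.sum_sub_distrib,
      ← Finset.sum_add_distrib]
    refine Finset.sum_congr rfl fun s _ => ?_
    have h3 : E s *ᵥ v = E s *ᵥ q - E s *ᵥ (Φhat *ᵥ (Φhatᵀ *ᵥ q)) := by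
      rw [← Matrix.mulVec_sub, hvq]
    change (E s *ᵥ (Φhat *ᵥ e)) ⬝ᵥ (E s *ᵥ q + w s) - (E s *ᵥ (Φhat *ᵥ e)) ⬝ᵥ
      (E s *ᵥ (Φhat *ᵥ (Φhatᵀ *ᵥ q))) = _
    rw [h3, dotProduct_add, dotProduct_sub]
    ring
  rw [lsGram_bilinear] at hkey
  change ∑ s ∈ Finset.range t, (E s *ᵥ (Φhat *ᵥ e)) ⬝ᵥ (E s *ᵥ (Φhat *ᵥ e)) = _ at hkey
  set X := ∑ s ∈ Finset.range t, (E s *ᵥ (Φhat *ᵥ e)) ⬝ᵥ (E s *ᵥ (Φhat *ᵥ e)) with hX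
  have hcross : ∑ s ∈ Finset.range t, (E s *ᵥ (Φhat *ᵥ e)) ⬝ᵥ (E s *ᵥ v)
      ≤ 1 / 4 * X + t * M * (v ⬝ᵥ v) := by
    refine le_trans ?_ (add_le_add le_rfl (hup v))
    rw [hX, Finset.mul_sum, ← Finset.sum_add_distrib]
    refine Finset.sum_le_sum fun s _ => ?_
    simp only [dotProduct, Finset.mul_sum, ← Finset.sum_add_distrib]
    refine Finset.sum_le_sum fun i _ => ?_
    nlinarith [sq_nonneg (1 / 2 * (E s *ᵥ (Φhat *ᵥ e)) i - (E s *ᵥ v) i)]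
  have hDe := hD e
  have hlowe : t / 8 * (e ⬝ᵥ D *ᵥ e) ≤ X := hlow e
  set qe := e ⬝ᵥ D *ᵥ e with hqe
  have hqe0 : 0 ≤ qe := (mul_nonneg hlam.le (dotProduct_self_nonneg' e)).trans hDe
  -- Young with weight t/32, so that the excitation bound (t/8)·eᵀDe ≤ X turns the quadratic part
  -- into X/4.
  have hns : ∑ s ∈ Finset.range t, (E s *ᵥ (Φhat *ᵥ e)) ⬝ᵥ w s
      ≤ 1 / 4 * X + 32 * r ^ 2 / t := by
    have h1 := (le_abs_self _).trans (hnoise e)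
    have h2 : 2 * r * √qe ≤ t / 32 * qe + 32 * r ^ 2 / t := by
      have h3 := sq_nonneg (t / 32 * √qe - r)
      have h4 : √qe ^ 2 = qe := Real.sq_sqrt hqe0
      have h5 : t / 32 * qe + 32 * r ^ 2 / t - 2 * r * √qe
          = 32 / t * (t / 32 * √qe - r) ^ 2 := by
        field_simp
        linear_combination (-(t : ℝ) ^ 2) * h4
      have h6 : 0 ≤ 32 / (t : ℝ) * (t / 32 * √qe - r) ^ 2 := by positivity
      linarith
    linarith
  have hX2 : X ≤ 2 * (t * M * (v ⬝ᵥ v) + 32 * r ^ 2 / t) := by linarith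
  have hee : e ⬝ᵥ e ≤ 16 * (M * (v ⬝ᵥ v) + 32 * r ^ 2 / t ^ 2) / lam := by
    rw [le_div_iff₀ hlam]
    have h1 : t / 8 * (lam * (e ⬝ᵥ e)) ≤ 2 * (t * M * (v ⬝ᵥ v) + 32 * r ^ 2 / t) :=
      (mul_le_mul_of_nonneg_left hDe (by positivity)).trans (hlowe.trans hX2)
    have h2 : 2 * (t * M * (v ⬝ᵥ v) + 32 * r ^ 2 / t)
        = t / 8 * (16 * (M * (v ⬝ᵥ v) + 32 * r ^ 2 / t ^ 2)) := by
      field_simp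
      ring
    rw [h2] at h1
    have h3 := le_of_mul_le_mul_left h1 (by positivity)
    linarith
  have herr : Φhat *ᵥ θ - q = Φhat *ᵥ e - v := by
    rw [he, ← hvq, Matrix.mulVec_sub]; abel
  have hΦe : (Φhat *ᵥ e) ⬝ᵥ (Φhat *ᵥ e) = e ⬝ᵥ e := by
    rw [← dotProduct_mulVec_transpose, Matrix.mulVec_mulVec, horth, Matrix.one_mulVec]
  have hsq : (Φhat *ᵥ e - v) ⬝ᵥ (Φhat *ᵥ e - v)
      ≤ 2 * ((Φhat *ᵥ e) ⬝ᵥ (Φhat *ᵥ e)) + 2 * (v ⬝ᵥ v) := by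
    simp only [dotProduct, Finset.mul_sum, ← Finset.sum_add_distrib]
    refine Finset.sum_le_sum fun i _ => ?_
    simp only [Pi.sub_apply]
    nlinarith [sq_nonneg ((Φhat *ᵥ e) i + v i)]
  rw [vnorm_sq, herr]
  rw [hΦe] at hsq
  have hMv : M * (v ⬝ᵥ v) ≤ M * (subspaceDist Φhat Φstar ^ 2 * vnorm θstar ^ 2) :=
    mul_le_mul_of_nonneg_left hv2 hM
  have hfin : 32 * (M * (v ⬝ᵥ v) + 32 * r ^ 2 / t ^ 2) / lam
      ≤ 32 * (M * (subspaceDist Φhat Φstar ^ 2 * vnorm θstar ^ 2) + 32 * r ^ 2 / t ^ 2) / lam := by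
    gcongr
  have h16 : 2 * (16 * (M * (v ⬝ᵥ v) + 32 * r ^ 2 / t ^ 2) / lam)
      = 32 * (M * (v ⬝ᵥ v) + 32 * r ^ 2 / t ^ 2) / lam := by ring
  linarith

end Projection

/-! ### Noise term and assembly of the rate. -/

section Estimation

variable {n m d : ℕ} {A : Matrix (Fin n) (Fin n) ℝ} {B : Matrix (Fin n) (Fin m) ℝ}
  {K : Matrix (Fin m) (Fin n) ℝ} {σu : ℝ} {Q : Matrix (Fin n) (Fin n) ℝ}

theorem lambdaMin_of_isEmpty {ι : Type*} [Fintype ι] [DecidableEq ι] [IsEmpty ι]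
    (S : Matrix ι ι ℝ) : lambdaMin S = 0 := by
  have h : spectrum ℝ S = ∅ := by
    refine Set.eq_empty_iff_forall_notMem.mpr fun z hz => hz ?_
    exact isUnit_of_subsingleton _
  rw [lambdaMin, h, Real.sInf_empty]

theorem pos_dim_of_lambdaMin_pos {S : Matrix (Fin d) (Fin d) ℝ} (h : 0 < lambdaMin S) :
    0 < d := by
  rcases Nat.eq_zero_or_pos d with rfl | hd
  · exact absurd (lambdaMin_of_isEmpty S) h.ne'
  · exact hd

theorem pos_state_dim_of_orthonormal {Φ : Matrix ((Fin n ⊕ Fin m) × Fin n) (Fin d) ℝ}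
    (horth : Φᵀ * Φ = 1) (hd : 0 < d) : 0 < n := by
  rcases Nat.eq_zero_or_pos n with rfl | hn
  · have h := congrFun (congrFun horth ⟨0, hd⟩) ⟨0, hd⟩
    rw [Matrix.mul_apply, Finset.univ_eq_empty, Finset.sum_empty, Matrix.one_apply_eq] at h
    exact absurd h zero_ne_one
  · exact hn

/-- The left side is 2(5δ⁶)^d with 5δ⁶ < 1, so d > 0 allows replacing the exponent by 1. -/
theorem five_pow_mul_exp_le {δ : ℝ} (hδ : 0 < δ) (hδ2 : δ < 1 / 2) (hd : 0 < d) :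
    (5 : ℝ) ^ d * (2 * Real.exp (-(6 * (d * Real.log (1 / δ))))) ≤ δ / 2 := by
  have h1 : Real.exp (-(6 * (d * Real.log (1 / δ)))) = (δ ^ 6) ^ d := by
    conv_rhs => rw [← exp_neg_log_one_div hδ, ← Real.exp_nat_mul, ← Real.exp_nat_mul]
    congr 1
    push_cast
    ring
  have h5 : δ ^ 5 ≤ (1 / 2) ^ 5 := by gcongr
  have h6 : 5 * δ ^ 6 ≤ 5 / 32 * δ := by nlinarith
  have h7 : (5 * δ ^ 6) ^ d ≤ 5 * δ ^ 6 :=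
    pow_le_of_le_one (by positivity) (by linarith) hd.ne'
  rw [h1]
  rw [mul_pow] at h7
  linarith

theorem Delta_upper [NeZero n] (hQ : (Q - 1).PosSemidef) (hst : IsStable (A + B * K))
    (hσu : σu ^ 2 ≤ 1) (t : ℕ) (q : (Fin n ⊕ Fin m) × Fin n → ℝ) :
    ∑ i, (fun j => q (j, i)) ⬝ᵥ avgCov A B K σu t *ᵥ (fun j => q (j, i))
      ≤ 3 * opNorm (lyapP A B Q K) ^ 2 * Psi B ^ 2 * (q ⬝ᵥ q) := by
  have h : q ⬝ᵥ q = ∑ i, (fun j => q (j, i)) ⬝ᵥ fun j => q (j, i) := by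
    simp only [dotProduct, Fintype.sum_prod_type]
    exact Finset.sum_comm
  rw [h, Finset.mul_sum]
  exact Finset.sum_le_sum fun i _ => avgCov_upper hQ hst hσu t _

/-- Test with one column of Φ̂. This allows the term ‖v‖², which carries no factor 1/λ, to be
absorbed in the rate. -/
theorem lambdaMin_Delta_le [NeZero n] (hQ : (Q - 1).PosSemidef) (hst : IsStable (A + B * K))
    (hσu : σu ^ 2 ≤ 1) {t : ℕ} {Φ : Matrix ((Fin n ⊕ Fin m) × Fin n) (Fin d) ℝ}
    (horth : Φᵀ * Φ = 1) (hd : 0 < d) :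
    lambdaMin (Delta A B K σu t Φ) ≤ 3 * opNorm (lyapP A B Q K) ^ 2 * Psi B ^ 2 := by
  set y : Fin d → ℝ := Pi.single ⟨0, hd⟩ 1 with hy
  have hyy : y ⬝ᵥ y = 1 := by simp [hy]
  have hΦ : (Φ *ᵥ y) ⬝ᵥ (Φ *ᵥ y) = 1 := by
    rw [← dotProduct_mulVec_transpose, Matrix.mulVec_mulVec, horth, Matrix.one_mulVec, hyy]
  have h1 := lambdaMin_mul_le (Delta_isHermitian (A := A) (B := B) (K := K) (σu := σu) t Φ) y
  have h2 := Delta_upper (m := m) (B := B) (σu := σu) hQ hst hσu t (Φ *ᵥ y)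
  rw [← Delta_quadratic, hΦ] at h2
  rw [hyy] at h1
  linarith

variable {Ω : Type*} [MeasurableSpace Ω] {μ : Measure Ω} [IsProbabilityMeasure μ] {σ : ℝ≥0}
  {x : ℕ → Ω → Fin n → ℝ} {u : ℕ → Ω → Fin m → ℝ}
  {w : ℕ → Ω → Fin n → ℝ} {g : ℕ → Ω → Fin m → ℝ}

/-- Off an event of probability at most `δ / 2`, the noise term of the normal equations is
controlled as soon as the Gram matrix is at most `4 t V`. -/
theorem IsRollout.exists_noise_bound [NeZero n] (h : IsRollout μ A B K σu σ x u w g)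
    {δ : ℝ} (hδ : 0 < δ) (hδ2 : δ < 1 / 2) (hd : 0 < d) {t : ℕ} (ht : 0 < t)
    {V : Matrix (Fin d) (Fin d) ℝ} (hV : V.PosDef)
    (Φ : Matrix ((Fin n ⊕ Fin m) × Fin n) (Fin d) ℝ) :
    ∃ S : Set Ω, μ S ≤ ENNReal.ofReal (δ / 2) ∧ ∀ ω ∉ S,
      (∀ y, ∑ s ∈ Finset.range t,
        ((kronId n (Sum.elim (x s ω) (u s ω)))ᵀ *ᵥ (Φ *ᵥ y)) ⬝ᵥ
          ((kronId n (Sum.elim (x s ω) (u s ω)))ᵀ *ᵥ (Φ *ᵥ y)) ≤ 4 * t * (y ⬝ᵥ V *ᵥ y)) →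
      ∀ y, |∑ s ∈ Finset.range t,
        ((kronId n (Sum.elim (x s ω) (u s ω)))ᵀ *ᵥ (Φ *ᵥ y)) ⬝ᵥ w s ω|
          ≤ 2 * √(48 * (σ : ℝ) ^ 2 * t * (d * Real.log (1 / δ))) * √(y ⬝ᵥ V *ᵥ y) := by
  classical
  have ht0 : (0 : ℝ) < t := by exact_mod_cast ht
  have hσ : (0 : ℝ) < (σ : ℝ) ^ 2 := by
    have h1 : (1 : ℝ) ≤ (σ : ℝ) ^ 2 := by exact_mod_cast h.one_le_sigma
    linarith
  have hL : 0 < Real.log (1 / δ) := Real.log_pos (by rw [lt_div_iff₀ hδ]; linarith)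
  obtain ⟨N, hcard, hball, hnorm⟩ := exists_norming_finset_posDef hV
  -- Here 48 = 8 · 6: the tail exponent r²/(8σ²t) becomes 6d log(1/δ), enough for 5^d net points.
  set r := √(48 * (σ : ℝ) ^ 2 * t * (d * Real.log (1 / δ))) with hr
  have hr2 : r ^ 2 = 48 * (σ : ℝ) ^ 2 * t * (d * Real.log (1 / δ)) :=
    Real.sq_sqrt (by positivity)
  set bad : (Fin d → ℝ) → Set Ω := fun c =>
    {ω | ∑ s ∈ Finset.range t, ((kronId n (Sum.elim (x s ω) (u s ω)))ᵀ *ᵥ (Φ *ᵥ c)) ⬝ᵥ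
        ((kronId n (Sum.elim (x s ω) (u s ω)))ᵀ *ᵥ (Φ *ᵥ c)) ≤ 4 * t ∧
      r < |∑ s ∈ Finset.range t,
        ((kronId n (Sum.elim (x s ω) (u s ω)))ᵀ *ᵥ (Φ *ᵥ c)) ⬝ᵥ w s ω|} with hbad
  refine ⟨⋃ c ∈ N, bad c, ?_, fun ω hω hup => ?_⟩
  · have hexp : r ^ 2 / (8 * (σ : ℝ) ^ 2 * t) = 6 * (d * Real.log (1 / δ)) := by
      have hσ' : (σ : ℝ) ≠ 0 := fun h0 => by simp [h0] at hσ
      rw [hr2]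
      field_simp
      ring
    have hb : ∀ c ∈ N, μ (bad c)
        ≤ ENNReal.ofReal (2 * Real.exp (-(6 * (d * Real.log (1 / δ))))) := fun c _ => by
      rw [← hexp]
      exact h.measure_noise_gt_le (Φ *ᵥ c) ht (Real.sqrt_nonneg _)
    refine (measure_biUnion_finset_le N bad).trans ((Finset.sum_le_sum hb).trans ?_)
    rw [Finset.sum_const, nsmul_eq_mul, ← ENNReal.ofReal_natCast,
      ← ENNReal.ofReal_mul (Nat.cast_nonneg _)]
    refine ENNReal.ofReal_le_ofReal (le_trans ?_ (five_pow_mul_exp_le hδ hδ2 hd))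
    refine mul_le_mul_of_nonneg_right ?_ (by positivity)
    rw [Fintype.card_fin] at hcard
    exact_mod_cast hcard
  · let f : (Fin d → ℝ) →ₗ[ℝ] ℝ :=
      { toFun := fun y => ∑ s ∈ Finset.range t,
          ((kronId n (Sum.elim (x s ω) (u s ω)))ᵀ *ᵥ (Φ *ᵥ y)) ⬝ᵥ w s ω
        map_add' := fun y y' => by
          simp only [Matrix.mulVec_add, add_dotProduct, Finset.sum_add_distrib]
        map_smul' := fun a y => by
          simp only [Matrix.mulVec_smul, smul_dotProduct, Finset.smul_sum, RingHom.id_apply] }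
    refine hnorm f r fun c hc => ?_
    by_contra hlt
    -- The assumed bound by 4tV, evaluated on a net point, supplies the quadratic variation
    -- condition of the tail estimate.
    refine hω (Set.mem_biUnion hc ⟨(hup c).trans ?_, not_le.mp hlt⟩)
    have := mul_le_mul_of_nonneg_left (hball c hc) (by positivity : (0 : ℝ) ≤ 4 * t)
    linarith

/-- The numerical part of the error bound: the terms of the deterministic error estimate are
dominated by those of the stated rate. -/
theorem rate_arithmetic {p Ψ lam L t e s2 D b : ℝ} (hlam : 0 < lam) (ht : 0 < t)
    (hle : lam ≤ 3 * p ^ 2 * Ψ ^ 2) (hb : 0 ≤ b) (hD : 0 ≤ D)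
    (he : e ≤ 32 * (12 * p ^ 2 * Ψ ^ 2 * D + 32 * (48 * s2 * t * L) / t ^ 2) / lam + 2 * D) :
    e ≤ 49152 * (L * s2 / (t * lam) + (1 + b) * (p ^ 2 * Ψ ^ 2 * D / lam)) := by
  -- The constant of the theorem is 49152 = 32 · 32 · 48; the bias terms need only 384 + 6.
  have h1 : 32 * (12 * p ^ 2 * Ψ ^ 2 * D + 32 * (48 * s2 * t * L) / t ^ 2) / lam
      = 384 * (p ^ 2 * Ψ ^ 2 * D / lam) + 49152 * (L * s2 / (t * lam)) := by
    field_simp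
    ring
  have h2 : D ≤ 3 * (p ^ 2 * Ψ ^ 2 * D / lam) := by
    rw [← mul_div_assoc, le_div_iff₀ hlam]
    nlinarith [mul_le_mul_of_nonneg_right hle hD]
  have h3 : 0 ≤ p ^ 2 * Ψ ^ 2 * D / lam := by positivity
  have h4 := mul_nonneg hb h3
  rw [h1] at he
  linarith

omit [IsProbabilityMeasure μ] in
theorem IsRollout.lsEstimate_error_le_rate [NeZero n] (h : IsRollout μ A B K σu σ x u w g)
    {Φstar Φhat : Matrix ((Fin n ⊕ Fin m) × Fin n) (Fin d) ℝ} {θstar : Fin d → ℝ}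
    (hvec : Matrix.vec (Matrix.fromCols A B) = Φstar *ᵥ θstar) (horth : Φhatᵀ * Φhat = 1)
    (hQ : (Q - 1).PosSemidef) (hst : IsStable (A + B * K)) (hσu : σu ^ 2 ≤ 1) (hd : 0 < d)
    {t : ℕ} (ht : 2 ≤ t) (hlam : 0 < lambdaMin (Delta A B K σu t Φhat)) {L b : ℝ} (hL : 0 ≤ L)
    (hb : 0 ≤ b) {ω : Ω}
    (hgood : ∀ v, |∑ s ∈ Finset.range t, (v ⬝ᵥ noiseRegressor (A + B * K) B σu w g s ω) ^ 2
        - t * (v ⬝ᵥ noiseCov (A + B * K) B σu t *ᵥ v)|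
        ≤ t / 2 * (v ⬝ᵥ noiseCov (A + B * K) B σu t *ᵥ v))
    (hx : 16 * ((x 0 ω ⬝ᵥ x 0 ω) * opNorm (lyapP A B Q K)) ≤ t)
    (hnoise : (∀ y, ∑ s ∈ Finset.range t,
        ((kronId n (Sum.elim (x s ω) (u s ω)))ᵀ *ᵥ (Φhat *ᵥ y)) ⬝ᵥ
          ((kronId n (Sum.elim (x s ω) (u s ω)))ᵀ *ᵥ (Φhat *ᵥ y))
            ≤ 4 * t * (y ⬝ᵥ Delta A B K σu t Φhat *ᵥ y)) →
      ∀ y, |∑ s ∈ Finset.range t,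
        ((kronId n (Sum.elim (x s ω) (u s ω)))ᵀ *ᵥ (Φhat *ᵥ y)) ⬝ᵥ w s ω|
          ≤ 2 * √(48 * (σ : ℝ) ^ 2 * t * (d * L)) * √(y ⬝ᵥ Delta A B K σu t Φhat *ᵥ y)) :
    vnorm (Φhat *ᵥ lsEstimate Φhat t (fun s => x s ω) (fun s => u s ω) - Φstar *ᵥ θstar) ^ 2
      ≤ 49152 * (d * L * (σ : ℝ) ^ 2 / (t * lambdaMin (Delta A B K σu t Φhat))
        + (1 + b) * (opNorm (lyapP A B Q K) ^ 2 * Psi B ^ 2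
          * (subspaceDist Φhat Φstar ^ 2 * vnorm θstar ^ 2)
            / lambdaMin (Delta A B K σu t Φhat))) := by
  have ht0 : (0 : ℝ) < t := by exact_mod_cast (by omega : 0 < t)
  have hexc := h.excitation_bounds hQ hst ht hgood hx
  have hupΔ : ∀ q, ∑ s ∈ Finset.range t,
      ((kronId n (Sum.elim (x s ω) (u s ω)))ᵀ *ᵥ q) ⬝ᵥ
        ((kronId n (Sum.elim (x s ω) (u s ω)))ᵀ *ᵥ q)
      ≤ 4 * t * ∑ i, (fun j => q (j, i)) ⬝ᵥ avgCov A B K σu t *ᵥ (fun j => q (j, i)) := fun q => by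
    rw [sum_kronId_transpose_sq t (fun s => Sum.elim (x s ω) (u s ω)) q, Finset.mul_sum]
    exact Finset.sum_le_sum fun i _ => (hexc _).2
  have hlow : ∀ y, t / 8 * (y ⬝ᵥ Delta A B K σu t Φhat *ᵥ y) ≤ ∑ s ∈ Finset.range t,
      ((kronId n (Sum.elim (x s ω) (u s ω)))ᵀ *ᵥ (Φhat *ᵥ y)) ⬝ᵥ
        ((kronId n (Sum.elim (x s ω) (u s ω)))ᵀ *ᵥ (Φhat *ᵥ y)) := fun y => by
    rw [Delta_quadratic, sum_kronId_transpose_sq t (fun s => Sum.elim (x s ω) (u s ω)),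
      Finset.mul_sum]
    exact Finset.sum_le_sum fun i _ => (hexc _).1
  have hup : ∀ q, ∑ s ∈ Finset.range t,
      ((kronId n (Sum.elim (x s ω) (u s ω)))ᵀ *ᵥ q) ⬝ᵥ
        ((kronId n (Sum.elim (x s ω) (u s ω)))ᵀ *ᵥ q)
      ≤ t * (12 * opNorm (lyapP A B Q K) ^ 2 * Psi B ^ 2) * (q ⬝ᵥ q) := fun q => by
    refine (hupΔ q).trans ((mul_le_mul_of_nonneg_left (Delta_upper hQ hst hσu t q)
      (by positivity)).trans_eq (by ring))
  have hs := hnoise fun y => by rw [Delta_quadratic]; exact hupΔ _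
  have hfin := lsEstimate_error_le hvec horth (by omega : 0 < t) (x := fun s => x s ω)
    (u := fun s => u s ω) (w := fun s => w s ω) (fun s => h.state_eq s ω) hlam
    (by positivity) (lambdaMin_mul_le (Delta_isHermitian t Φhat)) hlow hup hs
  rw [Real.sq_sqrt (by positivity)] at hfin
  exact rate_arithmetic hlam ht0 (lambdaMin_Delta_le hQ hst hσu horth hd) hb (by positivity) hfin

end Estimation

end LSEst

end

theorem mainTheorem3 :
    ∃ c C : ℝ, 0 < c ∧ 0 < C ∧
      ∀ (n m d : ℕ)
        (A : Matrix (Fin n) (Fin n) ℝ) (B : Matrix (Fin n) (Fin m) ℝ)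
        (Φstar Φhat : Matrix ((Fin n ⊕ Fin m) × Fin n) (Fin d) ℝ) (θstar : Fin d → ℝ)
        (Q : Matrix (Fin n) (Fin n) ℝ) (K : Matrix (Fin m) (Fin n) ℝ)
        (σu : ℝ) (σ : ℝ≥0) (δ : ℝ) (t : ℕ)
        (Ω : Type*) [MeasurableSpace Ω] (μ : Measure Ω) [IsProbabilityMeasure μ]
        (x : ℕ → Ω → Fin n → ℝ) (u : ℕ → Ω → Fin m → ℝ)
        (w : ℕ → Ω → Fin n → ℝ) (g : ℕ → Ω → Fin m → ℝ),
        Matrix.vec (Matrix.fromCols A B) = Φstar *ᵥ θstar →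
        Φhatᵀ * Φhat = 1 →
        (Q - 1).PosSemidef →
        LSEst.IsStable (A + B * K) →
        σu ^ 2 ≤ 1 →
        0 < δ → δ < 1 / 2 →
        LSEst.IsRollout μ A B K σu σ x u w g →
        0 < LSEst.lambdaMin (LSEst.Delta A B K σu t Φhat) →
        ∃ E : Set Ω, MeasurableSet E ∧ ENNReal.ofReal (1 - δ) ≤ μ E ∧
          ∀ ω ∈ E,
            c * LSEst.tauLS n m σ (LSEst.opNorm (LSEst.lyapP A B Q K)) (LSEst.Psi B)
                (LSEst.vnorm (x 0 ω) ^ 2) δ ≤ (t : ℝ) →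
            LSEst.vnorm (Φhat *ᵥ LSEst.lsEstimate Φhat t (fun s => x s ω) (fun s => u s ω)
                - Φstar *ᵥ θstar) ^ 2
              ≤ C * ((d : ℝ) * (σ : ℝ) ^ 2
                    / ((t : ℝ) * LSEst.lambdaMin (LSEst.Delta A B K σu t Φhat))
                    * Real.log (1 / δ)
                  + (1 + (σ : ℝ) ^ 4 * LSEst.opNorm (LSEst.lyapP A B Q K) ^ 7 * LSEst.Psi B ^ 6
                        * ((n : ℝ) + (m : ℝ) + Real.log (1 / δ))
                        / ((t : ℝ) * LSEst.lambdaMin (LSEst.Delta A B K σu t Φhat) ^ 2))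
                    * (LSEst.opNorm (LSEst.lyapP A B Q K) ^ 2 * LSEst.Psi B ^ 2
                        * LSEst.subspaceDist Φhat Φstar ^ 2 * LSEst.vnorm θstar ^ 2
                        / LSEst.lambdaMin (LSEst.Delta A B K σu t Φhat))) := by
  refine ⟨89128960, 49152, by norm_num, by norm_num, ?_⟩
  intro n m d A B Φstar Φhat θstar Q K σu σ δ t Ω _ μ _ x u w g hvec horth hQ hst hσu hδ hδ2 h
    hlam
  -- `lambdaMin` is 0 in dimension 0, so its positivity excludes the degenerate cases.
  have hd := LSEst.pos_dim_of_lambdaMin_pos hlam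
  have : NeZero n := ⟨(LSEst.pos_state_dim_of_orthonormal horth hd).ne'⟩
  have hL : 0 < Real.log (1 / δ) := Real.log_pos (by rw [lt_div_iff₀ hδ]; linarith)
  have hp : 0 ≤ LSEst.opNorm (LSEst.lyapP A B Q K) := LSEst.opNorm_nonneg _
  -- The part of the burn-in condition not involving the initial state is deterministic. If it
  -- fails, no outcome satisfies the full condition and the whole space serves as the event.
  by_cases hT : 89128960 * ((σ : ℝ) ^ 4 * LSEst.opNorm (LSEst.lyapP A B Q K) ^ 3
      * LSEst.Psi B ^ 2 * ((n : ℝ) + (m : ℝ) + Real.log (1 / δ))) ≤ t ∧ 2 ≤ t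
  · obtain ⟨hT, ht⟩ := hT
    have h1 := h.measure_cov_deviation_le hQ hst hσu hδ hδ2 ht hT
    obtain ⟨S, hS, hnoise⟩ := h.exists_noise_bound hδ hδ2 hd (by omega : 0 < t)
      (LSEst.Delta_posDef hlam) Φhat
    set R := {ω | ¬ ∀ v, |∑ s ∈ Finset.range t,
        (v ⬝ᵥ LSEst.noiseRegressor (A + B * K) B σu w g s ω) ^ 2
          - t * (v ⬝ᵥ LSEst.noiseCov (A + B * K) B σu t *ᵥ v)|
        ≤ t / 2 * (v ⬝ᵥ LSEst.noiseCov (A + B * K) B σu t *ᵥ v)} with hR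
    -- The bad sets are only bounded in outer measure, so a measurable hull is removed.
    refine ⟨(toMeasurable μ (R ∪ S))ᶜ, (measurableSet_toMeasurable _ _).compl, ?_,
      fun ω hω htau => ?_⟩
    · rw [prob_compl_eq_one_sub (measurableSet_toMeasurable _ _), measure_toMeasurable,
        ENNReal.ofReal_sub _ hδ.le, ENNReal.ofReal_one]
      refine tsub_le_tsub_left ((measure_union_le R S).trans ((add_le_add h1 hS).trans_eq ?_)) _
      rw [← ENNReal.ofReal_add (by linarith) (by linarith), add_halves]
    · have hmem : ω ∉ R ∪ S := fun hm => hω (subset_toMeasurable μ _ hm)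
      have hgood := not_not.mp fun hc => hmem (Or.inl hc)
      have hx : 16 * ((x 0 ω ⬝ᵥ x 0 ω) * LSEst.opNorm (LSEst.lyapP A B Q K)) ≤ t := by
        have h2 := (mul_le_mul_of_nonneg_left (le_max_right _ _) (by norm_num)).trans htau
        rw [LSEst.vnorm_sq] at h2
        have h3 := mul_nonneg (LSEst.dotProduct_self_nonneg' (x 0 ω)) hp
        linarith
      have hΨ : 0 ≤ LSEst.Psi B := zero_le_one.trans LSEst.one_le_Psi
      refine (h.lsEstimate_error_le_rate hvec horth hQ hst hσu hd ht hlam hL.le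
        (b := (σ : ℝ) ^ 4 * LSEst.opNorm (LSEst.lyapP A B Q K) ^ 7 * LSEst.Psi B ^ 6
          * ((n : ℝ) + (m : ℝ) + Real.log (1 / δ))
          / ((t : ℝ) * LSEst.lambdaMin (LSEst.Delta A B K σu t Φhat) ^ 2)) (by positivity)
        hgood hx (hnoise ω fun hm => hmem (Or.inr hm))).trans_eq ?_
      ring
  · refine ⟨Set.univ, MeasurableSet.univ, ?_, fun ω _ htau => absurd ?_ hT⟩
    · rw [measure_univ]
      exact ENNReal.ofReal_le_one.mpr (by linarith)
    · refine ⟨(mul_le_mul_of_nonneg_left (le_max_left _ _) (by norm_num)).trans htau, ?_⟩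
      have h2 := (mul_le_mul_of_nonneg_left (le_max_right _ _) (by norm_num)).trans htau
      have h3 := mul_nonneg (sq_nonneg (LSEst.vnorm (x 0 ω))) hp
      -- From the summand +1 in `tauLS`, multiplied by the large constant.
      have h4 : (2 : ℝ) ≤ t := by linarith
      exact_mod_cast h4
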